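/- Let $(p_k)_{k\ge 1}$ be a probability distribution with $p_k>0$ for infinitely many $k$. Balls $1,2,\ldots$ are thrown into boxes $1,2,\ldots$; each ball, independently of the others, hits box $k$ with probability $p_k$. The $n$th ball is thrown at time $S_n=\xi_1+\dots+\xi_n$, where $\xi_1,\xi_2,\ldots$ are independent exponential random variables of unit mean, independent of the boxes hit. For $j\in\mathbb N=\{1,2,\ldots\}$ let $K_j(t)$ be the number of boxes containing at least $j$ balls at time $t$, and put $\rho(t)=\#\{k: p_k>0,\ 1/p_k\le t\}$. **Theorem.** Assume that $\rho(t)\sim t^\alpha L(t)$ as $t\to\infty$ for some $\alpha\in(0,1)$ and some $L$ slowly varying at $+\infty$ (that is, $L$ is positive and Lebesgue measurable on some half-line $[X,\infty)$, and $L(\lambda t)/L(t)\to1$ as $t\to\infty$ for every $\lambda>0$). Then, for each $j\in\mathbb N$, almost surely $K_j(t)<\infty$ for all $t$, the variable $K_j(t)$ is square integrable for every $t$, $$\limsup_{t\to\infty}\frac{K_j(t)-\mathbb E K_j(t)}{(\mathrm{Var}\,K_j(t)\,\log\log \mathrm{Var}\,K_j(t))^{1/2}}=\sqrt2\quad\text{a.s.},$$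 and, as $t\to\infty$, $$\mathbb E K_j(t)\sim\frac{\Gamma(j-\alpha)}{(j-1)!}\,t^\alpha L(t),\qquad \mathrm{Var}\,K_j(t)\sim c_j\,t^\alpha L(t),$$ where $\Gamma$ is the Euler gamma function and $$c_j:=\sum_{i=0}^{j-1}\frac{\Gamma(i+j-\alpha)}{i!\,(j-1)!\,2^{i+j-1-\alpha}}-\frac{\Gamma(j-\alpha)}{(j-1)!}>0.$$ Here $f(t)\sim g(t)$ means $f(t)/g(t)\to1$. -/

import Mathlib

open MeasureTheory ProbabilityTheory Filter Asymptotics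
open scoped Topology Nat

noncomputable section

/-- `L` is slowly varying at `+∞`: it is positive and Lebesgue measurable on some half-line
`[X, ∞)`, and `L (c t) / L t → 1` as `t → ∞` for every `c > 0`. -/
def SlowlyVarying (L : ℝ → ℝ) : Prop :=
  (∃ X : ℝ, (∀ t, X ≤ t → 0 < L t) ∧ AEMeasurable L (volume.restrict (Set.Ici X))) ∧
    ∀ c : ℝ, 0 < c → Tendsto (fun t => L (c * t) / L t) atTop (𝓝 1)

/-- The counting function `ρ(t) = #{k : 1 / p k ≤ t}` of the sequence `1 / p k`
(with `1 / 0 = ∞`, so that boxes of probability zero are never counted). -/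
def boxCounting (p : ℕ → ℝ) (t : ℝ) : ℝ :=
  ({k : ℕ | 0 < p k ∧ 1 / p k ≤ t}.ncard : ℝ)

/-- `p` is a discrete probability distribution on the boxes (labelled by `ℕ`) which charges
infinitely many of them. -/
structure IsBoxDistribution (p : ℕ → ℝ) : Prop where
  nonneg : ∀ k, 0 ≤ p k
  hasSum_one : HasSum p 1
  infinite_support : {k | 0 < p k}.Infinite

/-- The random input of the Poissonized occupancy scheme: `ξ n` is the waiting time between the
throws of the balls `n - 1` and `n` (between time `0` and the first throw if `n = 0`), and `B n`
is the box hit by ball `n`. The waiting times are i.i.d. standard exponential, the box labels are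
i.i.d. with distribution `p`, and the two sequences are independent of each other. -/
structure IsPoissonizedScheme {Ω : Type*} [MeasurableSpace Ω] (μ : Measure Ω) (p : ℕ → ℝ)
    (ξ : ℕ → Ω → ℝ) (B : ℕ → Ω → ℕ) : Prop where
  measurable_wait : ∀ n, Measurable (ξ n)
  measurable_box : ∀ n, Measurable (B n)
  law_wait : ∀ n, μ.map (ξ n) = expMeasure 1
  law_box : ∀ n k, μ (B n ⁻¹' {k}) = ENNReal.ofReal (p k)
  indep_wait : iIndepFun ξ μ
  indep_box : iIndepFun B μ
  indep_wait_box : IndepFun (fun ω n => ξ n ω) (fun ω n => B n ω) μ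

/-- The time at which ball `n` is thrown (balls are numbered from `0`): a random walk with
steps `ξ`. -/
def throwTime {Ω : Type*} (ξ : ℕ → Ω → ℝ) (n : ℕ) (ω : Ω) : ℝ :=
  ∑ i ∈ Finset.range (n + 1), ξ i ω

/-- The number of balls contained in box `k` at time `t`. -/
def ballsInBox {Ω : Type*} (ξ : ℕ → Ω → ℝ) (B : ℕ → Ω → ℕ) (t : ℝ) (k : ℕ) (ω : Ω) : ℕ∞ :=
  {n : ℕ | throwTime ξ n ω ≤ t ∧ B n ω = k}.encard

/-- The set of boxes containing at least `j` balls at time `t`. -/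
def boxesAtLeast {Ω : Type*} (ξ : ℕ → Ω → ℝ) (B : ℕ → Ω → ℕ) (j : ℕ) (t : ℝ) (ω : Ω) : Set ℕ :=
  {k : ℕ | (j : ℕ∞) ≤ ballsInBox ξ B t k ω}

/-- `K_j(t)`, the number of boxes containing at least `j` balls at time `t`. -/
def occupancy {Ω : Type*} (ξ : ℕ → Ω → ℝ) (B : ℕ → Ω → ℕ) (j : ℕ) (t : ℝ) (ω : Ω) : ℝ :=
  ((boxesAtLeast ξ B j t ω).ncard : ℝ)

/-- The constant `c_j` in the asymptotics of the variance of `K_j(t)`. -/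
def varianceConst (α : ℝ) (j : ℕ) : ℝ :=
  (∑ i ∈ Finset.range j,
      Real.Gamma ((i : ℝ) + (j : ℝ) - α) /
        ((i ! : ℝ) * ((j - 1)! : ℝ) * (2 : ℝ) ^ ((i : ℝ) + (j : ℝ) - 1 - α))) -
    Real.Gamma ((j : ℝ) - α) / ((j - 1)! : ℝ)

end

/-! Throwing the balls at the points of a Poisson process makes the boxes independent: at time `t`
box `k` holds a Poisson number of balls with mean `p k * t`. Hence `K_j(t)` is a sum of independent
indicators with success probabilities `poissonTail j (p k * t)`, and each of them increases in `t`.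
Independence comes from the joint generating function of the contents of finitely many boxes at
box-dependent times (`integral_prod_pow_boxCount`). The generating function is found by a
martingale: the product of the weights of the first `n` balls, times the mean weight of the future
after the `n`th throw, has constant expectation.

Mean and variance have the form `∑ f (p k * t)`, which equals `∫ f' x * ρ (t / x) dx`. Since `ρ (t /
x) / ρ t → x ^ (-α)`, with a Potter bound as domination, such a sum is asymptotic to `ρ t * ∫ f' x *
x ^ (-α) dx` (`tendsto_tsum_boxes_div`). The integrals are values of the Gamma function. The
variance constant is positive because the boxes with `1 ≤ p k * t < 2`, a positive fraction of `ρ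
t`, each contribute a fixed amount of variance.

For the iterated logarithm the basic tool is `mgf_eventCount_bounds`: for small `θ`, the moment
generating function of a centred count with variance `V` lies between `exp (θ² V / 2 * (1 ∓ |θ|))`.
Chernoff's inequality gives the upper tail, and exponential tilting gives Kolmogorov's matching
lower bound. All estimates use the scale `v = c_j ρ`, which is monotone and equivalent to the
variance.

Upper half: along a geometric sequence of times the tails are summable. Between two such times
dyadic chaining bounds the oscillation (`measure_block_le`). An increment of the count is again a
count of independent events, with variance at most its mean, and monotonicity of the count disposes
of times off the finest grid.

Lower half: at time `n!` keep only the boxes with `p k * n!` between `1 / √(n + 1)` and `√n`. These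
blocks are disjoint for distinct `n`, so the block sums are independent, and they carry
asymptotically the whole variance. Although the times are so sparse, `log (log (v n!))` is at most
about `log n`, so the large deviation probabilities are at least `1 / n` and the second
Borel–Cantelli lemma applies. The remaining boxes have too little variance to cancel the deviation
infinitely often. -/

noncomputable section

/-! ### The tail of the Poisson distribution -/

/-- The probability that a Poisson variable of mean `x` is at least `j`. -/
def poissonTail (j : ℕ) (x : ℝ) : ℝ :=
  1 - Real.exp (-x) * ∑ i ∈ Finset.range j, x ^ i / (i ! : ℝ)

/-- The derivative of `poissonTail (m + 1)`. -/
def erlangDensity (m : ℕ) (x : ℝ) : ℝ := Real.exp (-x) * x ^ m / (m ! : ℝ)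

/-- The sum telescopes: differentiating the newly added Poisson term produces the next density and
cancels the previous one. -/
lemma hasDerivAt_poissonTail (m : ℕ) (x : ℝ) :
    HasDerivAt (poissonTail (m + 1)) (erlangDensity m x) x := by
  induction m with
  | zero =>
    have h : HasDerivAt (fun x : ℝ => 1 - Real.exp (-x)) (Real.exp (-x)) x := by
      have := ((hasDerivAt_neg x).exp).const_sub 1
      simpa using this
    have e : poissonTail (0 + 1) = fun x : ℝ => 1 - Real.exp (-x) := by
      funext y; simp [poissonTail]
    rw [e]; simpa [erlangDensity] using h
  | succ m ih =>
    have e : poissonTail (m + 1 + 1) =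
        fun y => poissonTail (m + 1) y - Real.exp (-y) * (y ^ (m + 1) / ((m + 1)! : ℝ)) := by
      funext y
      simp only [poissonTail]
      rw [Finset.sum_range_succ _ (m + 1)]
      ring
    have h2 : HasDerivAt (fun y : ℝ => Real.exp (-y) * (y ^ (m + 1) / ((m + 1)! : ℝ)))
        (Real.exp (-x) * (-1) * (x ^ (m + 1) / ((m + 1)! : ℝ)) +
          Real.exp (-x) * (((m + 1 : ℕ) : ℝ) * x ^ m / ((m + 1)! : ℝ))) x := by
      have := ((hasDerivAt_neg x).exp).mul ((hasDerivAt_pow (m + 1) x).div_const ((m + 1)! : ℝ))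
      refine this.congr_deriv ?_
      simp
    rw [e]
    refine (ih.sub h2).congr_deriv ?_
    have hm : ((m + 1)! : ℝ) = (m + 1) * (m ! : ℝ) := by
      rw [Nat.factorial_succ]; push_cast; ring
    have h0 : (m ! : ℝ) ≠ 0 := by positivity
    have h1 : (m + 1 : ℝ) ≠ 0 := by positivity
    simp only [erlangDensity, hm]
    push_cast
    field_simp
    ring

lemma poissonTail_zero (m : ℕ) : poissonTail (m + 1) 0 = 0 := by
  simp [poissonTail, Finset.sum_range_succ']

lemma erlangDensity_nonneg (m : ℕ) {x : ℝ} (hx : 0 ≤ x) : 0 ≤ erlangDensity m x := by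
  unfold erlangDensity; positivity

lemma continuous_erlangDensity (m : ℕ) : Continuous (erlangDensity m) := by
  unfold erlangDensity; fun_prop

lemma continuous_poissonTail (m : ℕ) : Continuous (poissonTail m) := by
  unfold poissonTail; fun_prop

lemma erlangDensity_le_one (m : ℕ) {x : ℝ} (hx : 0 ≤ x) : erlangDensity m x ≤ 1 := by
  unfold erlangDensity
  have := Real.pow_div_factorial_le_exp x hx m
  rw [mul_div_assoc]
  calc Real.exp (-x) * (x ^ m / (m ! : ℝ)) ≤ Real.exp (-x) * Real.exp x := by gcongr
    _ = 1 := by rw [← Real.exp_add]; simp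

lemma monotoneOn_poissonTail (m : ℕ) : MonotoneOn (poissonTail (m + 1)) (Set.Ici 0) := by
  apply monotoneOn_of_deriv_nonneg (convex_Ici 0) (continuous_poissonTail _).continuousOn
  · intro x _; exact (hasDerivAt_poissonTail m x).differentiableAt.differentiableWithinAt
  · intro x hx
    rw [(hasDerivAt_poissonTail m x).deriv]
    rw [interior_Ici] at hx
    exact erlangDensity_nonneg m (le_of_lt hx)

lemma poissonTail_nonneg (m : ℕ) {x : ℝ} (hx : 0 ≤ x) : 0 ≤ poissonTail (m + 1) x := by
  have := monotoneOn_poissonTail m (Set.self_mem_Ici) (Set.mem_Ici.2 hx) hx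
  rwa [poissonTail_zero] at this

lemma poissonTail_lt_one (m : ℕ) {x : ℝ} (hx : 0 ≤ x) : poissonTail (m + 1) x < 1 := by
  have : 0 < Real.exp (-x) * ∑ i ∈ Finset.range (m + 1), x ^ i / (i ! : ℝ) := by
    apply mul_pos (Real.exp_pos _)
    apply Finset.sum_pos'
    · intro i _; positivity
    · exact ⟨0, by simp, by simp⟩
  unfold poissonTail; linarith

lemma poissonTail_eq_integral (m : ℕ) (x : ℝ) :
    poissonTail (m + 1) x = ∫ y in (0 : ℝ)..x, erlangDensity m y := by
  rw [intervalIntegral.integral_eq_sub_of_hasDerivAt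
    (fun y _ => hasDerivAt_poissonTail m y)
    ((continuous_erlangDensity m).intervalIntegrable _ _), poissonTail_zero, sub_zero]

lemma poissonTail_le_self (m : ℕ) {x : ℝ} (hx : 0 ≤ x) : poissonTail (m + 1) x ≤ x := by
  rw [poissonTail_eq_integral]
  calc ∫ y in (0 : ℝ)..x, erlangDensity m y ≤ ∫ y in (0 : ℝ)..x, (1 : ℝ) := by
        apply intervalIntegral.integral_mono_on hx
          ((continuous_erlangDensity m).intervalIntegrable _ _) (by simp)
        intro y hy; exact erlangDensity_le_one m hy.1
    _ = x := by simp

lemma poissonTail_pos (m : ℕ) {x : ℝ} (hx : 0 < x) : 0 < poissonTail (m + 1) x := by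
  rw [poissonTail_eq_integral]
  apply intervalIntegral.intervalIntegral_pos_of_pos_on
    ((continuous_erlangDensity m).intervalIntegrable _ _) _ hx
  intro y hy
  have := hy.1
  unfold erlangDensity; positivity

/-- Both sides vanish at `0`, and their derivatives compare because `exp (-(c * y)) ≤ exp (-y)`. The
bound later controls the growth of the mean over short time intervals, where regular variation gives
no uniform estimate. -/
lemma poissonTail_mul_le (m : ℕ) {c x : ℝ} (hc : 1 ≤ c) (hx : 0 ≤ x) :
    poissonTail (m + 1) (c * x) ≤ c ^ (m + 1) * poissonTail (m + 1) x := by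
  have hd : ∀ y, HasDerivAt (fun y => c ^ (m + 1) * poissonTail (m + 1) y -
      poissonTail (m + 1) (c * y))
      (c ^ (m + 1) * erlangDensity m y - erlangDensity m (c * y) * c) y := by
    intro y
    have h1 := (hasDerivAt_poissonTail m y).const_mul (c ^ (m + 1))
    have h2 : HasDerivAt (fun y => poissonTail (m + 1) (c * y)) (erlangDensity m (c * y) * c) y :=
      (hasDerivAt_poissonTail m (c * y)).comp y
        (by simpa using (hasDerivAt_id y).const_mul c)
    exact h1.sub h2
  have hmono : MonotoneOn (fun y => c ^ (m + 1) * poissonTail (m + 1) y -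
      poissonTail (m + 1) (c * y)) (Set.Ici 0) := by
    apply monotoneOn_of_deriv_nonneg (convex_Ici 0)
    · exact fun y _ => (hd y).continuousAt.continuousWithinAt
    · exact fun y _ => (hd y).differentiableAt.differentiableWithinAt
    · intro y hy
      rw [interior_Ici] at hy
      have hy : 0 < y := hy
      rw [(hd y).deriv]
      have : erlangDensity m (c * y) * c ≤ c ^ (m + 1) * erlangDensity m y := by
        unfold erlangDensity
        have h : Real.exp (-(c * y)) ≤ Real.exp (-y) := by
          apply Real.exp_le_exp.2; nlinarith
        calc Real.exp (-(c * y)) * (c * y) ^ m / (m ! : ℝ) * c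
            ≤ Real.exp (-y) * (c * y) ^ m / (m ! : ℝ) * c := by gcongr
          _ = _ := by rw [mul_pow, pow_succ]; ring
      linarith
  have := hmono (Set.self_mem_Ici) (Set.mem_Ici.2 hx) hx
  simp only [mul_zero, poissonTail_zero, sub_zero] at this
  linarith

/-! ### The counting function of the boxes -/

section Counting

variable {p : ℕ → ℝ}

lemma finite_boxes (hp : IsBoxDistribution p) (t : ℝ) :
    {k : ℕ | 0 < p k ∧ 1 / p k ≤ t}.Finite := by
  rcases le_or_gt t 0 with ht | ht
  · convert Set.finite_empty
    ext k
    simp only [Set.mem_ofPred_eq, Set.mem_empty_iff_false, iff_false, not_and, not_le]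
    intro h; exact ht.trans_lt (by positivity)
  · have h := hp.hasSum_one.summable.tendsto_cofinite_zero
    have := h.eventually (gt_mem_nhds (show (0 : ℝ) < 1 / t by positivity))
    rw [eventually_cofinite] at this
    refine this.subset ?_
    rintro k ⟨hk, hk'⟩
    simp only [Set.mem_ofPred_eq, not_lt]
    rw [div_le_iff₀ ht]
    rw [div_le_iff₀ hk] at hk'
    linarith

lemma boxCounting_mono (hp : IsBoxDistribution p) : Monotone (boxCounting p) := by
  intro s t hst
  unfold boxCounting
  have hsub : {k : ℕ | 0 < p k ∧ 1 / p k ≤ s} ⊆ {k : ℕ | 0 < p k ∧ 1 / p k ≤ t} :=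
    fun k hk => ⟨hk.1, hk.2.trans hst⟩
  exact_mod_cast Set.ncard_le_ncard hsub (finite_boxes hp t)

lemma boxCounting_nonneg (t : ℝ) : 0 ≤ boxCounting p t := by unfold boxCounting; positivity

lemma boxCounting_eq_tsum (hp : IsBoxDistribution p) {x t : ℝ} (hx : 0 < x) (ht : 0 < t) :
    HasSum (fun k => if x ≤ p k * t then (1 : ℝ) else 0) (boxCounting p (t / x)) := by
  have hset : ∀ k, (x ≤ p k * t) ↔ k ∈ {k : ℕ | 0 < p k ∧ 1 / p k ≤ t / x} := by
    intro k
    constructor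
    · intro h
      have hk : 0 < p k := by
        by_contra hneg
        have : p k * t ≤ 0 := mul_nonpos_of_nonpos_of_nonneg (not_lt.1 hneg) ht.le
        linarith
      refine ⟨hk, ?_⟩
      rw [div_le_div_iff₀ hk hx]; linarith
    · rintro ⟨hk, h⟩
      rw [div_le_div_iff₀ hk hx] at h; linarith
  have hfin := finite_boxes hp (t / x)
  have : HasSum (fun k => if x ≤ p k * t then (1 : ℝ) else 0)
      (∑ k ∈ hfin.toFinset, if x ≤ p k * t then (1 : ℝ) else 0) :=
    hasSum_sum_of_ne_finset_zero (by
      intro k hk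
      rw [Set.Finite.mem_toFinset, ← hset] at hk
      simp [hk])
  convert this using 1
  rw [Finset.sum_congr rfl (g := fun _ => (1 : ℝ))]
  · rw [Finset.sum_const, boxCounting, Set.ncard_eq_toFinset_card _ hfin, nsmul_one]
  · intro k hk
    rw [Set.Finite.mem_toFinset, ← hset] at hk
    simp [hk]

lemma eventually_boxCounting_pos (hp : IsBoxDistribution p) :
    ∀ᶠ t in atTop, 0 < boxCounting p t := by
  obtain ⟨k, hk⟩ := hp.infinite_support.nonempty
  filter_upwards [eventually_ge_atTop (1 / p k)] with t ht
  unfold boxCounting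
  exact_mod_cast (Set.ncard_pos (finite_boxes hp t)).2 ⟨k, hk, ht⟩

/-- Regular variation of index `α` of the counting function. -/
def RegularlyVarying (f : ℝ → ℝ) (α : ℝ) : Prop :=
  ∀ c : ℝ, 0 < c → Tendsto (fun t => f (c * t) / f t) atTop (𝓝 (c ^ α))

lemma SlowlyVarying.eventually_pos {L : ℝ → ℝ} (hL : SlowlyVarying L) :
    ∀ᶠ t in atTop, 0 < L t := by
  obtain ⟨⟨X, hX, _⟩, _⟩ := hL
  filter_upwards [eventually_ge_atTop X] with t ht using hX t ht

lemma SlowlyVarying.regularlyVarying {L : ℝ → ℝ} (hL : SlowlyVarying L) {f : ℝ → ℝ} {α : ℝ}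
    (hf : f ~[atTop] fun t : ℝ => t ^ α * L t) : RegularlyVarying f α := by
  intro c hc
  have hcm : Tendsto (fun t : ℝ => c * t) atTop atTop := tendsto_id.const_mul_atTop hc
  have h1 : (fun t => f (c * t)) ~[atTop] fun t => (c * t) ^ α * L (c * t) := hf.comp_tendsto hcm
  have h3 : Tendsto (fun t => ((c * t) ^ α * L (c * t)) / (t ^ α * L t)) atTop (𝓝 (c ^ α)) := by
    have := (hL.2 c hc).const_mul (c ^ α)
    rw [mul_one] at this
    refine this.congr' ?_
    filter_upwards [eventually_gt_atTop 0, hL.eventually_pos] with t ht hLt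
    rw [Real.mul_rpow hc.le ht.le]
    have : t ^ α ≠ 0 := (Real.rpow_pos_of_pos ht _).ne'
    field_simp
  exact (h1.div hf).symm.tendsto_nhds h3

/-- Iterating `f (2 * t) ≤ 2 ^ β * f t` gives the bound for powers of two. Monotonicity fills the
gaps, and the extra factor `2 ^ β` pays for rounding `c` up to a power of two. -/
lemma RegularlyVarying.potter {f : ℝ → ℝ} {α β : ℝ} (hα : 0 < α) (hαβ : α < β)
    (hf : RegularlyVarying f α)
    (hmono : Monotone f) (hpos : ∀ᶠ t in atTop, 0 < f t) :
    ∃ t₀ : ℝ, 0 < t₀ ∧ ∀ t, t₀ ≤ t → 0 < f t ∧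
      ∀ c, 1 ≤ c → f (c * t) ≤ (2 : ℝ) ^ β * c ^ β * f t := by
  have h2 := hf 2 two_pos
  have hlt : (2 : ℝ) ^ α < 2 ^ β := Real.rpow_lt_rpow_of_exponent_lt one_lt_two hαβ
  obtain ⟨T, hT⟩ := eventually_atTop.1 ((h2.eventually (gt_mem_nhds hlt)).and hpos)
  refine ⟨max T 1, by positivity, fun t ht => ?_⟩
  have htT := (le_max_left _ _).trans ht
  have ht1 : 1 ≤ t := (le_max_right _ _).trans ht
  have hβ : 0 < β := hα.trans hαβ
  refine ⟨(hT t htT).2, fun c hc => ?_⟩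
  have iter : ∀ n : ℕ, f (2 ^ n * t) ≤ ((2 : ℝ) ^ β) ^ n * f t := by
    intro n
    induction n with
    | zero => simp
    | succ n ih =>
      have hge : T ≤ 2 ^ n * t := htT.trans (le_mul_of_one_le_left (by linarith)
        (one_le_pow₀ one_le_two))
      obtain ⟨ha, hb⟩ := hT _ hge
      have : f (2 * (2 ^ n * t)) ≤ 2 ^ β * f (2 ^ n * t) := by
        rw [div_lt_iff₀ hb] at ha; exact ha.le
      calc f (2 ^ (n + 1) * t) = f (2 * (2 ^ n * t)) := by congr 1; ring
        _ ≤ 2 ^ β * f (2 ^ n * t) := this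
        _ ≤ 2 ^ β * (((2 : ℝ) ^ β) ^ n * f t) := by gcongr
        _ = _ := by ring
  obtain ⟨n, hn1, hn2⟩ := exists_nat_pow_near hc (one_lt_two)
  calc f (c * t) ≤ f (2 ^ (n + 1) * t) := hmono (by gcongr)
    _ ≤ ((2 : ℝ) ^ β) ^ (n + 1) * f t := iter _
    _ = 2 ^ β * ((2 : ℝ) ^ n) ^ β * f t := by
        rw [pow_succ, ← Real.rpow_natCast, ← Real.rpow_mul (by norm_num), ← Real.rpow_natCast,
          ← Real.rpow_mul (by norm_num), mul_comm β]
        ring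
    _ ≤ _ := by
        have := (hT t htT).2
        gcongr

end Counting

/-! ### An Abelian theorem for sums over the boxes -/

section Abelian

variable {p : ℕ → ℝ}

/-- Layer-cake formula: `f (p k * t)` is the integral of `f'` over `x ≤ p k * t`, and `ρ (t / x)`
counts the `k` satisfying this inequality. Sum and integral may be exchanged because the absolute
integrals are at most `C * (p k * t)`, which is summable. -/
lemma hasSum_boxes {f f' : ℝ → ℝ} {C : ℝ} (hp : IsBoxDistribution p)
    (hf : ∀ x, 0 ≤ x → f x = ∫ y in (0 : ℝ)..x, f' y) (hm : Measurable f')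
    (hC : ∀ x, 0 < x → |f' x| ≤ C) {t : ℝ} (ht : 0 < t) :
    HasSum (fun k => f (p k * t)) (∫ x in Set.Ioi (0 : ℝ), f' x * boxCounting p (t / x)) := by
  have hpt : ∀ k, 0 ≤ p k * t := fun k => mul_nonneg (hp.nonneg k) ht.le
  set F : ℕ → ℝ → ℝ := fun k x => f' x * (if x ≤ p k * t then 1 else 0) with hF
  have hFi : ∀ k, F k = (Set.Iic (p k * t)).indicator f' := by
    intro k; funext x
    by_cases h : x ≤ p k * t <;> simp [hF, h, Set.indicator]
  have hrestr : ∀ k, (volume.restrict (Set.Ioi (0 : ℝ))).restrict (Set.Iic (p k * t)) =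
      volume.restrict (Set.Ioc 0 (p k * t)) := by
    intro k
    rw [Measure.restrict_restrict measurableSet_Iic, Set.inter_comm, Set.Ioi_inter_Iic]
  have hint : ∀ k, IntegrableOn f' (Set.Ioc 0 (p k * t)) := by
    intro k
    refine Measure.integrableOn_of_bounded (M := C) (by simp) hm.aestronglyMeasurable ?_
    filter_upwards [ae_restrict_mem measurableSet_Ioc] with x hx using hC x hx.1
  have hFint : ∀ k, Integrable (F k) (volume.restrict (Set.Ioi (0 : ℝ))) := by
    intro k
    rw [hFi, integrable_indicator_iff measurableSet_Iic, IntegrableOn, hrestr]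
    exact hint k
  have hFval : ∀ k, ∫ x in Set.Ioi (0 : ℝ), F k x = f (p k * t) := by
    intro k
    rw [hFi, integral_indicator measurableSet_Iic, hrestr, hf _ (hpt k),
      intervalIntegral.integral_of_le (hpt k)]
  have hsum : Summable fun k => ∫ x in Set.Ioi (0 : ℝ), ‖F k x‖ := by
    refine Summable.of_nonneg_of_le (fun k => integral_nonneg fun x => norm_nonneg _) (fun k => ?_)
      ((hp.hasSum_one.summable.mul_right t).mul_left C)
    have : (fun x => ‖F k x‖) = (Set.Iic (p k * t)).indicator fun x => ‖f' x‖ := by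
      rw [hFi]; funext x; exact norm_indicator_eq_indicator_norm _ _
    rw [this, integral_indicator measurableSet_Iic, hrestr]
    calc ∫ x in Set.Ioc 0 (p k * t), ‖f' x‖ ≤ ∫ x in Set.Ioc 0 (p k * t), C := by
          refine setIntegral_mono_on (hint k).norm (by simp) measurableSet_Ioc ?_
          intro x hx; exact hC x hx.1
      _ = C * (p k * t) := by
          rw [setIntegral_const, Real.volume_real_Ioc_of_le (hpt k), sub_zero, smul_eq_mul,
            mul_comm]
  have h := hasSum_integral_of_summable_integral_norm hFint hsum
  simp only [hFval] at h
  have he : ∫ x in Set.Ioi (0 : ℝ), f' x * boxCounting p (t / x) =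
      ∫ x in Set.Ioi (0 : ℝ), ∑' k, F k x := by
    refine setIntegral_congr_fun measurableSet_Ioi fun x hx => ?_
    simp only [hF]
    rw [tsum_mul_left, (boxCounting_eq_tsum hp hx ht).tsum_eq]
  rwa [he]

/-- Dominated convergence in the layer-cake formula. The ratio `ρ (t / x) / ρ t` tends to `x ^
(-α)`; it is at most `1` for `x ≥ 1` by monotonicity and at most `2 ^ β * x ^ (-β)` for `x ≤ 1` by
the Potter bound. -/
theorem tendsto_tsum_boxes_div {f f' : ℝ → ℝ} {C α β : ℝ} (hp : IsBoxDistribution p)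
    (hR : RegularlyVarying (boxCounting p) α) (hα : 0 < α) (hαβ : α < β)
    (hf : ∀ x, 0 ≤ x → f x = ∫ y in (0 : ℝ)..x, f' y) (hm : Measurable f')
    (hC : ∀ x, 0 < x → |f' x| ≤ C)
    (hi : IntegrableOn (fun x => f' x) (Set.Ioi 0))
    (hiβ : IntegrableOn (fun x => f' x * x ^ (-β)) (Set.Ioi 0)) :
    Tendsto (fun t => (∑' k, f (p k * t)) / boxCounting p t) atTop
      (𝓝 (∫ x in Set.Ioi (0 : ℝ), f' x * x ^ (-α))) := by
  obtain ⟨t₀, ht₀, hpot⟩ :=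
    hR.potter hα hαβ (boxCounting_mono hp) (eventually_boxCounting_pos hp)
  have hβ : 0 < β := hα.trans hαβ
  have hmain : Tendsto (fun t => ∫ x in Set.Ioi (0 : ℝ),
      f' x * (boxCounting p (t / x) / boxCounting p t)) atTop
      (𝓝 (∫ x in Set.Ioi (0 : ℝ), f' x * x ^ (-α))) := by
    refine tendsto_integral_filter_of_dominated_convergence
      (fun x => ‖f' x‖ + (2 : ℝ) ^ β * ‖f' x * x ^ (-β)‖) ?_ ?_ ?_ ?_
    · refine Eventually.of_forall fun t => ?_
      have : Measurable fun x : ℝ => boxCounting p (t / x) :=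
        (boxCounting_mono hp).measurable.comp (by fun_prop)
      exact (hm.mul (this.div_const _)).aestronglyMeasurable
    · filter_upwards [eventually_ge_atTop t₀] with t ht
      filter_upwards [ae_restrict_mem measurableSet_Ioi] with x hx
      have hx : 0 < x := hx
      obtain ⟨hpos, hc⟩ := hpot t ht
      have hr0 : 0 ≤ boxCounting p (t / x) / boxCounting p t :=
        div_nonneg (boxCounting_nonneg _) hpos.le
      rw [norm_mul, Real.norm_of_nonneg hr0]
      have hxβ : 0 < x ^ (-β) := Real.rpow_pos_of_pos hx _
      rw [norm_mul, Real.norm_of_nonneg hxβ.le]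
      rcases le_total 1 x with h1 | h1
      · have : boxCounting p (t / x) / boxCounting p t ≤ 1 := by
          rw [div_le_one hpos]
          exact boxCounting_mono hp (div_le_self (ht₀.le.trans ht) h1)
        have h2 : ‖f' x‖ * (boxCounting p (t / x) / boxCounting p t) ≤ ‖f' x‖ * 1 := by gcongr
        have h3 : 0 ≤ (2 : ℝ) ^ β * (‖f' x‖ * x ^ (-β)) := by positivity
        linarith
      · have : boxCounting p (t / x) / boxCounting p t ≤ 2 ^ β * x ^ (-β) := by
          rw [div_le_iff₀ hpos]
          have := hc (x⁻¹) ((one_le_inv₀ hx).2 h1)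
          rwa [Real.inv_rpow hx.le, ← Real.rpow_neg hx.le, inv_mul_eq_div] at this
        calc _ ≤ ‖f' x‖ * (2 ^ β * x ^ (-β)) := by gcongr
          _ = 2 ^ β * (‖f' x‖ * x ^ (-β)) := by ring
          _ ≤ _ := by linarith [norm_nonneg (f' x)]
    · exact hi.norm.add (hiβ.norm.const_mul _)
    · filter_upwards [ae_restrict_mem measurableSet_Ioi] with x hx
      have hx : 0 < x := hx
      have := (hR x⁻¹ (by positivity)).const_mul (f' x)
      rw [Real.inv_rpow hx.le, ← Real.rpow_neg hx.le] at this
      simpa only [inv_mul_eq_div] using this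
  refine hmain.congr' ?_
  filter_upwards [eventually_gt_atTop 0] with t ht
  rw [(hasSum_boxes hp hf hm hC ht).tsum_eq, ← integral_div]
  simp only [mul_div_assoc]

end Abelian

/-! ### Integrals of the Erlang density against powers -/

lemma integrableOn_pow_mul_rpow_mul_exp {r β : ℝ} (hr : 0 < r) (hβ1 : β < 1) (n : ℕ) :
    IntegrableOn (fun x : ℝ => x ^ n * Real.exp (-(r * x)) * x ^ (-β)) (Set.Ioi 0) := by
  have hpos : 0 < (n : ℝ) + 1 - β := by have : (0 : ℝ) ≤ n := Nat.cast_nonneg n; linarith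
  have h := integrableOn_rpow_mul_exp_neg_mul_rpow (s := (n : ℝ) - β) (p := 1) (b := r)
    (by linarith) one_pos hr
  refine h.congr_fun (fun x hx => ?_) measurableSet_Ioi
  have hx : 0 < x := hx
  simp only [Real.rpow_one]
  rw [sub_eq_add_neg, Real.rpow_add hx, Real.rpow_natCast, neg_mul]
  ring

lemma integral_pow_mul_rpow_mul_exp {r α : ℝ} (hr : 0 < r) (hα1 : α < 1) (n : ℕ) :
    ∫ x in Set.Ioi (0 : ℝ), x ^ n * Real.exp (-(r * x)) * x ^ (-α) =
      Real.Gamma (n + 1 - α) / r ^ ((n : ℝ) + 1 - α) := by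
  have hpos : 0 < (n : ℝ) + 1 - α := by have : (0 : ℝ) ≤ n := Nat.cast_nonneg n; linarith
  have h := Real.integral_rpow_mul_exp_neg_mul_Ioi hpos hr
  rw [one_div, Real.inv_rpow hr.le, inv_mul_eq_div] at h
  rw [← h]
  refine setIntegral_congr_fun measurableSet_Ioi fun x hx => ?_
  have hx : 0 < x := hx
  rw [show (n : ℝ) + 1 - α - 1 = (n : ℝ) + (-α) by ring, Real.rpow_add hx, Real.rpow_natCast]
  ring

lemma integrableOn_erlangDensity_mul_rpow {β : ℝ} (hβ1 : β < 1) (m : ℕ) :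
    IntegrableOn (fun x : ℝ => erlangDensity m x * x ^ (-β)) (Set.Ioi 0) := by
  have : IntegrableOn (fun x : ℝ => x ^ m * Real.exp (-(1 * x)) * x ^ (-β) / (m ! : ℝ))
      (Set.Ioi 0) := (integrableOn_pow_mul_rpow_mul_exp one_pos hβ1 m).div_const (m ! : ℝ)
  refine this.congr_fun (fun x _ => ?_) measurableSet_Ioi
  simp only [erlangDensity, one_mul]; ring

lemma integral_erlangDensity_mul_rpow {α : ℝ} (hα1 : α < 1) (m : ℕ) :
    ∫ x in Set.Ioi (0 : ℝ), erlangDensity m x * x ^ (-α) =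
      Real.Gamma (((m + 1 : ℕ) : ℝ) - α) / (m ! : ℝ) := by
  have := integral_pow_mul_rpow_mul_exp one_pos hα1 m
  rw [Real.one_rpow, div_one] at this
  push_cast
  rw [← this, ← integral_div]
  refine setIntegral_congr_fun measurableSet_Ioi fun x _ => ?_
  simp only [erlangDensity, one_mul]; ring

/-- The derivative of `x ↦ poissonTail (m + 1) x * (1 - poissonTail (m + 1) x)`. -/
def erlangVarDensity (m : ℕ) (x : ℝ) : ℝ := erlangDensity m x * (1 - 2 * poissonTail (m + 1) x)

lemma erlangVarDensity_eq_integral (m : ℕ) (x : ℝ) :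
    poissonTail (m + 1) x * (1 - poissonTail (m + 1) x) =
      ∫ y in (0 : ℝ)..x, erlangVarDensity m y := by
  have hd : ∀ y, HasDerivAt (fun y => poissonTail (m + 1) y * (1 - poissonTail (m + 1) y))
      (erlangVarDensity m y) y := by
    intro y
    have h := hasDerivAt_poissonTail m y
    refine (h.mul (h.const_sub 1)).congr_deriv ?_
    unfold erlangVarDensity; ring
  have hc : Continuous (erlangVarDensity m) := by
    unfold erlangVarDensity
    exact (continuous_erlangDensity m).mul
      (continuous_const.sub (continuous_const.mul (continuous_poissonTail _)))
  rw [intervalIntegral.integral_eq_sub_of_hasDerivAt (fun y _ => hd y) (hc.intervalIntegrable _ _),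
    poissonTail_zero]
  ring

lemma continuous_erlangVarDensity (m : ℕ) : Continuous (erlangVarDensity m) := by
  unfold erlangVarDensity
  exact (continuous_erlangDensity m).mul
    (continuous_const.sub (continuous_const.mul (continuous_poissonTail _)))

lemma abs_erlangVarDensity_le (m : ℕ) {x : ℝ} (hx : 0 ≤ x) :
    |erlangVarDensity m x| ≤ erlangDensity m x := by
  unfold erlangVarDensity
  rw [abs_mul, abs_of_nonneg (erlangDensity_nonneg m hx)]
  apply mul_le_of_le_one_right (erlangDensity_nonneg m hx)
  rw [abs_le]
  constructor <;> linarith [poissonTail_nonneg m hx, poissonTail_lt_one m hx]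

lemma integrableOn_erlangVarDensity_mul_rpow {β : ℝ} (hβ1 : β < 1) (m : ℕ) :
    IntegrableOn (fun x : ℝ => erlangVarDensity m x * x ^ (-β)) (Set.Ioi 0) := by
  refine (integrableOn_erlangDensity_mul_rpow hβ1 m).mono' ?_ ?_
  · exact ((continuous_erlangVarDensity m).measurable.mul
      (measurable_id.pow_const _)).aestronglyMeasurable
  · filter_upwards [ae_restrict_mem measurableSet_Ioi] with x hx
    have hx : 0 < x := hx
    have h : 0 ≤ x ^ (-β) := Real.rpow_nonneg hx.le _
    rw [norm_mul, Real.norm_of_nonneg h]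
    exact mul_le_mul_of_nonneg_right (abs_erlangVarDensity_le m hx.le) h

/-- Here `1 - 2 * poissonTail (m + 1) x` equals `2 * exp (-x) * ∑ x ^ i / i! - 1`. Each term of the
sum yields a Gamma integral of rate `2`, and the `-1` yields the mean constant. -/
lemma integral_erlangVarDensity_mul_rpow {α : ℝ} (hα1 : α < 1) (m : ℕ) :
    ∫ x in Set.Ioi (0 : ℝ), erlangVarDensity m x * x ^ (-α) = varianceConst α (m + 1) := by
  have key : ∀ x : ℝ, erlangVarDensity m x * x ^ (-α) =
      (∑ i ∈ Finset.range (m + 1), 2 / ((i ! : ℝ) * (m ! : ℝ)) *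
        (x ^ (i + m) * Real.exp (-(2 * x)) * x ^ (-α))) - erlangDensity m x * x ^ (-α) := by
    intro x
    have h2 : Real.exp (-(2 * x)) = Real.exp (-x) * Real.exp (-x) := by
      rw [← Real.exp_add]; ring_nf
    have : ∑ i ∈ Finset.range (m + 1), 2 / ((i ! : ℝ) * (m ! : ℝ)) *
        (x ^ (i + m) * Real.exp (-(2 * x)) * x ^ (-α)) =
        2 * Real.exp (-x) * erlangDensity m x * x ^ (-α) *
          ∑ i ∈ Finset.range (m + 1), x ^ i / (i ! : ℝ) := by
      rw [Finset.mul_sum]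
      refine Finset.sum_congr rfl fun i _ => ?_
      rw [h2, pow_add]
      unfold erlangDensity
      field_simp
    rw [this]
    unfold erlangVarDensity poissonTail
    ring
  simp only [key]
  have hint : ∀ i ∈ Finset.range (m + 1), IntegrableOn (fun x : ℝ => 2 / ((i ! : ℝ) * (m ! : ℝ)) *
        (x ^ (i + m) * Real.exp (-(2 * x)) * x ^ (-α))) (Set.Ioi 0) := fun i _ =>
    (integrableOn_pow_mul_rpow_mul_exp two_pos hα1 (i + m)).const_mul _
  rw [integral_sub (integrable_finsetSum _ hint) (integrableOn_erlangDensity_mul_rpow hα1 m),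
    integral_finsetSum _ hint, integral_erlangDensity_mul_rpow hα1]
  simp only [varianceConst, Nat.add_sub_cancel]
  congr 1
  refine Finset.sum_congr rfl fun i _ => ?_
  rw [integral_const_mul, integral_pow_mul_rpow_mul_exp two_pos hα1]
  push_cast
  rw [show (i : ℝ) + m + 1 - α = (i : ℝ) + (m + 1) - 1 - α + 1 by ring, Real.rpow_add two_pos,
    Real.rpow_one, show (i : ℝ) + (m + 1) - 1 - α + 1 = (i : ℝ) + (m + 1) - α by ring]
  field_simp

/-! ### Asymptotics of the mean, of the variance and of the contribution of the small boxes -/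

section Asymp

variable {p : ℕ → ℝ} {α : ℝ}

theorem tendsto_tsum_poissonTail_div (hp : IsBoxDistribution p)
    (hR : RegularlyVarying (boxCounting p) α) (hα0 : 0 < α) (hα1 : α < 1) (m : ℕ) :
    Tendsto (fun t => (∑' k, poissonTail (m + 1) (p k * t)) / boxCounting p t) atTop
      (𝓝 (Real.Gamma (((m + 1 : ℕ) : ℝ) - α) / (m ! : ℝ))) := by
  rw [← integral_erlangDensity_mul_rpow hα1]
  -- Any exponent strictly between `α` and `1` serves: above `α` for the Potter bound, below `1` for
  -- integrability at `0`.
  refine tendsto_tsum_boxes_div (C := 1) (β := (α + 1) / 2) hp hR hα0 (by linarith)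
    (fun x _ => poissonTail_eq_integral m x) (continuous_erlangDensity m).measurable
    (fun x hx => ?_) ?_ (integrableOn_erlangDensity_mul_rpow (by linarith) m)
  · rw [abs_of_nonneg (erlangDensity_nonneg m hx.le)]
    exact erlangDensity_le_one m hx.le
  · simpa using integrableOn_erlangDensity_mul_rpow (β := 0) (by norm_num) m

theorem tendsto_tsum_poissonTail_var_div (hp : IsBoxDistribution p)
    (hR : RegularlyVarying (boxCounting p) α) (hα0 : 0 < α) (hα1 : α < 1) (m : ℕ) :
    Tendsto (fun t => (∑' k, poissonTail (m + 1) (p k * t) * (1 - poissonTail (m + 1) (p k * t))) /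
      boxCounting p t) atTop (𝓝 (varianceConst α (m + 1))) := by
  rw [← integral_erlangVarDensity_mul_rpow hα1]
  refine tendsto_tsum_boxes_div (C := 1) (β := (α + 1) / 2)
    (f := fun x => poissonTail (m + 1) x * (1 - poissonTail (m + 1) x)) hp hR hα0 (by linarith)
    (fun x _ => erlangVarDensity_eq_integral m x) (continuous_erlangVarDensity m).measurable
    (fun x hx => ?_) ?_ (integrableOn_erlangVarDensity_mul_rpow (by linarith) m)
  · exact (abs_erlangVarDensity_le m hx.le).trans (erlangDensity_le_one m hx.le)
  · simpa using integrableOn_erlangVarDensity_mul_rpow (β := 0) (by norm_num) m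

/-- The case `f x = min x ε`, with `f'` the indicator of `x ≤ ε`. It serves to bound the variance
due to boxes with `p k * t ≤ ε`, each contributing at most `p k * t`. -/
theorem tendsto_tsum_min_div (hp : IsBoxDistribution p)
    (hR : RegularlyVarying (boxCounting p) α) (hα0 : 0 < α) (hα1 : α < 1) {ε : ℝ} (hε : 0 < ε) :
    Tendsto (fun t => (∑' k, min (p k * t) ε) / boxCounting p t) atTop
      (𝓝 (ε ^ (1 - α) / (1 - α))) := by
  have hind : ∀ (g : ℝ → ℝ), (fun x => (Set.Iic ε).indicator (fun _ => (1 : ℝ)) x * g x) =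
      (Set.Iic ε).indicator g := by
    intro g; funext x; by_cases h : x ∈ Set.Iic ε <;> simp [h]
  have hrestr : (volume.restrict (Set.Ioi (0 : ℝ))).restrict (Set.Iic ε) =
      volume.restrict (Set.Ioc 0 ε) := by
    rw [Measure.restrict_restrict measurableSet_Iic, Set.inter_comm, Set.Ioi_inter_Iic]
  have hintβ : ∀ β : ℝ, β < 1 → IntegrableOn
      (fun x => (Set.Iic ε).indicator (fun _ => (1 : ℝ)) x * x ^ (-β)) (Set.Ioi 0) := by
    intro β hβ
    rw [hind, IntegrableOn, integrable_indicator_iff measurableSet_Iic, IntegrableOn, hrestr]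
    have := intervalIntegral.intervalIntegrable_rpow' (a := 0) (b := ε) (r := -β) (by linarith)
    exact (intervalIntegrable_iff_integrableOn_Ioc_of_le hε.le).1 this
  have hval : ∫ x in Set.Ioi (0 : ℝ), (Set.Iic ε).indicator (fun _ => (1 : ℝ)) x * x ^ (-α) =
      ε ^ (1 - α) / (1 - α) := by
    rw [hind, integral_indicator measurableSet_Iic, hrestr,
      ← intervalIntegral.integral_of_le hε.le, integral_rpow (Or.inl (by linarith)),
      Real.zero_rpow (by linarith)]
    rw [show -α + 1 = 1 - α by ring, sub_zero]
  rw [← hval]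
  refine tendsto_tsum_boxes_div (C := 1) (β := (α + 1) / 2) (f := fun x => min x ε) hp hR hα0
    (by linarith) (fun x hx => ?_) (measurable_const.indicator measurableSet_Iic)
    (fun x hx => ?_) ?_ (hintβ _ (by linarith))
  · rw [intervalIntegral.integral_of_le hx, integral_indicator measurableSet_Iic,
      Measure.restrict_restrict measurableSet_Iic]
    rw [Set.inter_comm, Set.Ioc_inter_Iic]
    simp [hx, hε.le]
  · by_cases h : x ∈ Set.Iic ε <;> simp [h]
  · simpa using hintβ 0 (by norm_num)

/-- Positivity is read off from the limit of variance over `ρ`, not from the formula. A box with `1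
≤ p k * t < 2` contributes at least `c` to the variance, and the number of such boxes is `ρ t - ρ (t
/ 2)`, asymptotically `(1 - 2 ^ (-α)) * ρ t`. -/
theorem varianceConst_pos (hp : IsBoxDistribution p)
    (hR : RegularlyVarying (boxCounting p) α) (hα0 : 0 < α) (hα1 : α < 1) (m : ℕ) :
    0 < varianceConst α (m + 1) := by
  set c : ℝ := poissonTail (m + 1) 1 * (1 - poissonTail (m + 1) 2) with hc
  have hcpos : 0 < c := mul_pos (poissonTail_pos m one_pos)
    (by linarith [poissonTail_lt_one m (zero_le_two (α := ℝ))])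
  have hlim : Tendsto (fun t => c * (1 - boxCounting p (2⁻¹ * t) / boxCounting p t)) atTop
      (𝓝 (c * (1 - (2⁻¹ : ℝ) ^ α))) :=
    ((hR 2⁻¹ (by norm_num)).const_sub 1).const_mul c
  have hle : c * (1 - (2⁻¹ : ℝ) ^ α) ≤ varianceConst α (m + 1) := by
    refine le_of_tendsto_of_tendsto hlim (tendsto_tsum_poissonTail_var_div hp hR hα0 hα1 m) ?_
    filter_upwards [eventually_gt_atTop 0, eventually_boxCounting_pos hp] with t ht hpos
    rw [le_div_iff₀ hpos]
    have h1 := boxCounting_eq_tsum hp one_pos ht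
    have h2 := boxCounting_eq_tsum hp two_pos ht
    have h3 := (h1.sub h2).mul_left c
    have hs : Summable fun k =>
        poissonTail (m + 1) (p k * t) * (1 - poissonTail (m + 1) (p k * t)) :=
      (hasSum_boxes (C := 1) hp (fun x _ => erlangVarDensity_eq_integral m x)
        (continuous_erlangVarDensity m).measurable (fun x hx =>
        (abs_erlangVarDensity_le m hx.le).trans (erlangDensity_le_one m hx.le)) ht).summable
    have h4 := h3.summable.tsum_le_tsum (fun k => ?_) hs
    · rw [h3.tsum_eq] at h4
      refine le_trans (le_of_eq ?_) h4
      rw [div_one, inv_mul_eq_div, mul_assoc, sub_mul, div_mul_cancel₀ _ hpos.ne', one_mul]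
    · have hpk : 0 ≤ p k * t := mul_nonneg (hp.nonneg k) ht.le
      have hnn : 0 ≤ poissonTail (m + 1) (p k * t) * (1 - poissonTail (m + 1) (p k * t)) :=
        mul_nonneg (poissonTail_nonneg m hpk) (by linarith [poissonTail_lt_one m hpk])
      by_cases ha : 1 ≤ p k * t
      · by_cases hb : 2 ≤ p k * t
        · simpa [ha, hb] using hnn
        · have hb' : p k * t ≤ 2 := (not_le.1 hb).le
          simp only [ha, hb, if_true, if_false, sub_zero, mul_one]
          have e1 := monotoneOn_poissonTail m (Set.mem_Ici.2 zero_le_one) (Set.mem_Ici.2 hpk) ha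
          have e2 := monotoneOn_poissonTail m (Set.mem_Ici.2 hpk) (Set.mem_Ici.2 zero_le_two) hb'
          exact mul_le_mul e1 (by linarith)
            (by linarith [poissonTail_lt_one m (zero_le_two (α := ℝ))]) (poissonTail_nonneg m hpk)
      · have hb : ¬ 2 ≤ p k * t := fun h => ha (by linarith)
        simpa [ha, hb] using hnn
  have : (2⁻¹ : ℝ) ^ α < 1 := Real.rpow_lt_one (by norm_num) (by norm_num) hα0
  have : 0 < c * (1 - (2⁻¹ : ℝ) ^ α) := mul_pos hcpos (by linarith)
  linarith

end Asymp

/-! ### Moment generating functions of centred Bernoulli variables -/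

lemma abs_exp_sub_quadratic_le {y : ℝ} (hy : |y| ≤ 1) :
    |Real.exp y - (1 + y + y ^ 2 / 2)| ≤ |y| * y ^ 2 * (2 / 9) := by
  have h := Real.exp_bound hy (n := 3) (by norm_num)
  simp only [Finset.sum_range_succ, Finset.sum_range_zero, Nat.factorial] at h
  norm_num at h
  calc |Real.exp y - (1 + y + y ^ 2 / 2)| ≤ |y| ^ 3 * (2 / 9) := h
    _ = |y| * y ^ 2 * (2 / 9) := by rw [← sq_abs y]; ring

/-- Expand the exponential to second order. Centring kills the linear term; keeping the square in
the cubic remainder leaves an error proportional to `|θ|` times the variance term, so the bounds are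
multiplicative in the variance and can be summed over the boxes. -/
lemma bernoulli_mgf_bounds {q θ : ℝ} (hq0 : 0 ≤ q) (hq1 : q ≤ 1) (hθ : |θ| ≤ 1) :
    Real.exp (θ ^ 2 * (q * (1 - q)) / 2 * (1 - |θ|)) ≤
        q * Real.exp (θ * (1 - q)) + (1 - q) * Real.exp (θ * (0 - q)) ∧
      q * Real.exp (θ * (1 - q)) + (1 - q) * Real.exp (θ * (0 - q)) ≤
        Real.exp (θ ^ 2 * (q * (1 - q)) / 2 * (1 + |θ|)) := by
  have h1q : 0 ≤ 1 - q := by linarith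
  have ha : |θ * (1 - q)| ≤ |θ| := by
    rw [abs_mul, abs_of_nonneg h1q]
    exact mul_le_of_le_one_right (abs_nonneg _) (by linarith)
  have hb : |θ * (0 - q)| ≤ |θ| := by
    rw [abs_mul, zero_sub, abs_neg, abs_of_nonneg hq0]
    exact mul_le_of_le_one_right (abs_nonneg _) (by linarith)
  have ea := abs_le.1 ((abs_exp_sub_quadratic_le (ha.trans hθ)).trans
    (mul_le_mul_of_nonneg_right (mul_le_mul_of_nonneg_right ha (sq_nonneg _)) (by norm_num)))
  have eb := abs_le.1 ((abs_exp_sub_quadratic_le (hb.trans hθ)).trans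
    (mul_le_mul_of_nonneg_right (mul_le_mul_of_nonneg_right hb (sq_nonneg _)) (by norm_num)))
  set v := q * (1 - q) with hv
  have hv0 : 0 ≤ v := mul_nonneg hq0 h1q
  have hv1 : v ≤ 1 / 4 := by nlinarith [sq_nonneg (q - 1 / 2)]
  set a := |θ| with hadef
  have ha0 : 0 ≤ a := abs_nonneg θ
  have hsq : θ ^ 2 = a ^ 2 := (sq_abs θ).symm
  set P := q * Real.exp (θ * (1 - q)) + (1 - q) * Real.exp (θ * (0 - q)) with hP
  have hPu : P ≤ 1 + θ ^ 2 * v / 2 * (1 + 4 / 9 * a) := by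
    have e1 := mul_le_mul_of_nonneg_left ea.2 hq0
    have e2 := mul_le_mul_of_nonneg_left eb.2 h1q
    have : q * (1 + θ * (1 - q) + (θ * (1 - q)) ^ 2 / 2 + a * (θ * (1 - q)) ^ 2 * (2 / 9)) +
        (1 - q) * (1 + θ * (0 - q) + (θ * (0 - q)) ^ 2 / 2 + a * (θ * (0 - q)) ^ 2 * (2 / 9)) =
        1 + θ ^ 2 * v / 2 * (1 + 4 / 9 * a) := by rw [hv]; ring
    rw [← this]; linarith
  have hPl : 1 + θ ^ 2 * v / 2 * (1 - 4 / 9 * a) ≤ P := by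
    have e1 := mul_le_mul_of_nonneg_left ea.1 hq0
    have e2 := mul_le_mul_of_nonneg_left eb.1 h1q
    have : q * (1 + θ * (1 - q) + (θ * (1 - q)) ^ 2 / 2 - a * (θ * (1 - q)) ^ 2 * (2 / 9)) +
        (1 - q) * (1 + θ * (0 - q) + (θ * (0 - q)) ^ 2 / 2 - a * (θ * (0 - q)) ^ 2 * (2 / 9)) =
        1 + θ ^ 2 * v / 2 * (1 - 4 / 9 * a) := by rw [hv]; ring
    rw [← this]; linarith
  have hw0 : 0 ≤ θ ^ 2 * v / 2 := by positivity
  have hw1 : θ ^ 2 * v / 2 ≤ a / 8 := by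
    rw [hsq]
    have : a ^ 2 ≤ a := by nlinarith
    nlinarith [mul_le_mul this hv1 hv0 ha0]
  set w := θ ^ 2 * v / 2 with hw
  constructor
  · set u := w * (1 - 4 / 9 * a) with hu
    have hu0 : 0 ≤ u := mul_nonneg hw0 (by linarith)
    have hu1 : u ≤ a / 8 := by
      have : u ≤ w * 1 := mul_le_mul_of_nonneg_left (by linarith) hw0
      linarith
    -- With `log (1 + u) ≥ 1 - 1 / (1 + u) ≥ u * (1 - u)` and `u ≤ a / 8`, the loss fits into the
    -- slack between `4 / 9 * a` and `a`.
    have hlog := Real.one_sub_inv_le_log_of_pos (show 0 < 1 + u by linarith)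
    have h2 : w * (1 - a) ≤ 1 - (1 + u)⁻¹ := by
      have h3 : u * (1 - u) ≤ 1 - (1 + u)⁻¹ := by
        have : 1 - (1 + u)⁻¹ = u / (1 + u) := by field_simp; ring
        rw [this, le_div_iff₀ (by linarith)]
        nlinarith [mul_nonneg hu0 (mul_nonneg hu0 hu0)]
      have h4 : w * (1 - a) ≤ u * (1 - u) := by
        have h5 : (1 - a) ≤ (1 - 4 / 9 * a) * (1 - u) := by nlinarith
        have := mul_le_mul_of_nonneg_left h5 hw0
        rw [hu] at *
        linarith
      linarith
    calc Real.exp (w * (1 - a)) ≤ Real.exp (Real.log (1 + u)) := by gcongr; linarith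
      _ = 1 + u := Real.exp_log (by linarith)
      _ ≤ P := hPl
  · have := Real.add_one_le_exp (w * (1 + a))
    have : w * (1 + 4 / 9 * a) ≤ w * (1 + a) := mul_le_mul_of_nonneg_left (by linarith) hw0
    linarith

/-! ### Numbers of occurrences among countably many independent events -/

/-- The number of events `A k` which occur. -/
def eventCount {Ω : Type*} (A : ℕ → Set Ω) (ω : Ω) : ℝ := ({k : ℕ | ω ∈ A k}.ncard : ℝ)

/-- The number of events `A k` with `k < n` which occur. -/
def partialCount {Ω : Type*} (A : ℕ → Set Ω) (n : ℕ) (ω : Ω) : ℝ :=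
  ∑ k ∈ Finset.range n, (A k).indicator (fun _ => (1 : ℝ)) ω

section PartialCount

variable {Ω : Type*} {A : ℕ → Set Ω}

lemma partialCount_nonneg (n : ℕ) (ω : Ω) : 0 ≤ partialCount A n ω :=
  Finset.sum_nonneg fun _ _ => Set.indicator_nonneg (fun _ _ => zero_le_one) _

lemma partialCount_eq_card (n : ℕ) (ω : Ω) :
    partialCount A n ω = ({k : ℕ | k < n ∧ ω ∈ A k}.ncard : ℝ) := by
  classical
  have : {k : ℕ | k < n ∧ ω ∈ A k} = ((Finset.range n).filter fun k => ω ∈ A k : Finset ℕ) := by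
    ext k; simp
  rw [this, Set.ncard_coe_finset, Finset.card_filter]
  unfold partialCount
  push_cast
  exact Finset.sum_congr rfl fun k _ => by simp [Set.indicator]

lemma partialCount_le_eventCount {ω : Ω} (h : {k : ℕ | ω ∈ A k}.Finite) (n : ℕ) :
    partialCount A n ω ≤ eventCount A ω := by
  rw [partialCount_eq_card, eventCount]
  have hsub : {k : ℕ | k < n ∧ ω ∈ A k} ⊆ {k : ℕ | ω ∈ A k} := fun k hk => hk.2
  exact_mod_cast Set.ncard_le_ncard hsub h

lemma eventually_partialCount_eq {ω : Ω} (h : {k : ℕ | ω ∈ A k}.Finite) :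
    ∀ᶠ n in atTop, partialCount A n ω = eventCount A ω := by
  obtain ⟨N, hN⟩ := h.bddAbove
  filter_upwards [eventually_gt_atTop N] with n hn
  rw [partialCount_eq_card, eventCount]
  congr 2
  ext k
  exact ⟨fun hk => hk.2, fun hk => ⟨(hN hk).trans_lt hn, hk⟩⟩

lemma indicator_one_eq (s : Set Ω) (F : ℝ → ℝ) (ω : Ω) :
    F (s.indicator (fun _ => (1 : ℝ)) ω) =
      s.indicator (fun _ => F 1 - F 0) ω + F 0 := by
  by_cases h : ω ∈ s <;> simp [h]

end PartialCount

section EventCount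

variable {Ω : Type*} [MeasurableSpace Ω] {μ : Measure Ω} [IsProbabilityMeasure μ] {A : ℕ → Set Ω}

lemma measurable_partialCount (hA : ∀ k, MeasurableSet (A k)) (n : ℕ) :
    Measurable (partialCount A n) := by
  unfold partialCount
  exact Finset.measurable_sum _ fun k _ => measurable_const.indicator (hA k)

lemma ae_finite_events (hs : Summable fun k => μ.real (A k)) :
    ∀ᵐ ω ∂μ, {k : ℕ | ω ∈ A k}.Finite := by
  have : ∑' k, μ (A k) ≠ ⊤ := by
    have h := hs.tsum_ofReal_ne_top
    simpa [Measure.real] using h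
  exact ae_finite_setOfPred_mem this

lemma aemeasurable_eventCount (hA : ∀ k, MeasurableSet (A k))
    (hs : Summable fun k => μ.real (A k)) : AEMeasurable (eventCount A) μ := by
  refine aemeasurable_of_tendsto_metrizable_ae atTop
    (fun n => (measurable_partialCount hA n).aemeasurable) ?_
  filter_upwards [ae_finite_events hs] with ω hω
  exact tendsto_const_nhds.congr' ((eventually_partialCount_eq hω).mono fun n hn => hn.symm)

lemma integral_comp_indicator {s : Set Ω} (hsm : MeasurableSet s) (F : ℝ → ℝ) :
    ∫ ω, F (s.indicator (fun _ => (1 : ℝ)) ω) ∂μ =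
      μ.real s * F 1 + (1 - μ.real s) * F 0 := by
  simp_rw [indicator_one_eq s F]
  rw [integral_add ((integrable_const _).indicator hsm) (integrable_const _),
    integral_indicator_const _ hsm]
  simp
  ring

lemma integral_exp_partialCount_sub (hA : ∀ k, MeasurableSet (A k)) (hi : iIndepSet A μ)
    (θ : ℝ) (n : ℕ) :
    ∫ ω, Real.exp (θ * (partialCount A n ω - ∑ k ∈ Finset.range n, μ.real (A k))) ∂μ =
      ∏ k ∈ Finset.range n, (μ.real (A k) * Real.exp (θ * (1 - μ.real (A k))) +
        (1 - μ.real (A k)) * Real.exp (θ * (0 - μ.real (A k)))) := by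
  have h1 : iIndepFun (fun k => (A k).indicator fun _ => (1 : ℝ)) μ := hi.iIndepFun_indicator
  have h2 := h1.comp (fun k y => y - μ.real (A k)) (fun k => by fun_prop)
  have h3 := h2.mgf_sum (t := θ) (fun k =>
    (measurable_const.indicator (hA k)).sub_const _) (Finset.range n)
  have h4 : ∀ k, mgf ((fun y => y - μ.real (A k)) ∘ ((A k).indicator fun _ => (1 : ℝ))) μ θ =
      μ.real (A k) * Real.exp (θ * (1 - μ.real (A k))) +
        (1 - μ.real (A k)) * Real.exp (θ * (0 - μ.real (A k))) := by
    intro k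
    exact integral_comp_indicator (hA k) (fun y => Real.exp (θ * (y - μ.real (A k))))
  rw [Finset.prod_congr rfl fun k _ => h4 k] at h3
  rw [← h3]
  unfold mgf
  refine integral_congr_ae (ae_of_all _ fun ω => ?_)
  simp [partialCount, Finset.sum_sub_distrib]

lemma integrable_exp_partialCount (hA : ∀ k, MeasurableSet (A k)) (θ c : ℝ) (n : ℕ) :
    Integrable (fun ω => Real.exp (θ * (partialCount A n ω - c))) μ := by
  have hb : ∀ ω, partialCount A n ω ≤ n := by
    intro ω
    calc partialCount A n ω ≤ ∑ k ∈ Finset.range n, (1 : ℝ) :=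
          Finset.sum_le_sum fun k _ => Set.indicator_le_self' (fun _ _ => zero_le_one) ω
      _ = n := by simp
  have hm : Measurable fun ω => Real.exp (θ * (partialCount A n ω - c)) :=
    Real.measurable_exp.comp (((measurable_partialCount hA n).sub_const c).const_mul θ)
  refine Integrable.of_bound hm.aestronglyMeasurable
    (Real.exp (|θ| * (n + |c|))) (ae_of_all _ fun ω => ?_)
  rw [Real.norm_of_nonneg (Real.exp_pos _).le]
  apply Real.exp_le_exp.2
  calc θ * (partialCount A n ω - c) ≤ |θ * (partialCount A n ω - c)| := le_abs_self _
    _ = |θ| * |partialCount A n ω - c| := abs_mul _ _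
    _ ≤ _ := by
      gcongr
      calc |partialCount A n ω - c| ≤ |partialCount A n ω| + |c| := abs_sub _ _
        _ ≤ n + |c| := by
          rw [abs_of_nonneg (partialCount_nonneg n ω)]; linarith [hb ω]

lemma summable_mul_one_sub (hs : Summable fun k => μ.real (A k)) :
    Summable fun k => μ.real (A k) * (1 - μ.real (A k)) :=
  hs.of_nonneg_of_le (fun k => mul_nonneg measureReal_nonneg
    (by linarith [measureReal_le_one (μ := μ) (s := A k)]))
    fun k => mul_le_of_le_one_right measureReal_nonneg
      (by linarith [measureReal_nonneg (μ := μ) (s := A k)])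

/-- The bound at `θ = 1` is uniform over the partial counts, which almost surely stabilise by
Borel–Cantelli, so Fatou's lemma applies. The exponential then yields the moments and the domination
in `mgf_eventCount_bounds`. -/
lemma integrable_exp_eventCount (hA : ∀ k, MeasurableSet (A k)) (hi : iIndepSet A μ)
    (hs : Summable fun k => μ.real (A k)) : Integrable (fun ω => Real.exp (eventCount A ω)) μ := by
  set a := ∑' k, μ.real (A k) with ha
  set V := ∑' k, μ.real (A k) * (1 - μ.real (A k)) with hV
  have hq1 : ∀ k, μ.real (A k) ≤ 1 := fun k => measureReal_le_one
  have hv0 : ∀ k, 0 ≤ μ.real (A k) * (1 - μ.real (A k)) :=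
    fun k => mul_nonneg measureReal_nonneg (by linarith [hq1 k])
  have hbound : ∀ n, ∫ ω, Real.exp (partialCount A n ω) ∂μ ≤ Real.exp (a + V) := by
    intro n
    have h := integral_exp_partialCount_sub hA hi 1 n
    have hle : ∏ k ∈ Finset.range n, (μ.real (A k) * Real.exp (1 * (1 - μ.real (A k))) +
        (1 - μ.real (A k)) * Real.exp (1 * (0 - μ.real (A k)))) ≤ Real.exp V := by
      calc _ ≤ ∏ k ∈ Finset.range n, Real.exp (μ.real (A k) * (1 - μ.real (A k))) := by
            refine Finset.prod_le_prod (fun k _ => ?_) fun k _ => ?_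
            · have := hq1 k
              have : 0 ≤ 1 - μ.real (A k) := by linarith
              have : 0 ≤ μ.real (A k) := measureReal_nonneg
              positivity
            · refine ((bernoulli_mgf_bounds (θ := 1) measureReal_nonneg (hq1 k) (by simp)).2).trans
                (le_of_eq ?_)
              rw [abs_one]; ring_nf
        _ = Real.exp (∑ k ∈ Finset.range n, μ.real (A k) * (1 - μ.real (A k))) :=
            (Real.exp_sum _ _).symm
        _ ≤ _ := by
            apply Real.exp_le_exp.2
            exact (summable_mul_one_sub hs).sum_le_tsum _ fun k _ => hv0 k
    have e : ∀ ω, Real.exp (partialCount A n ω) =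
        Real.exp (∑ k ∈ Finset.range n, μ.real (A k)) *
        Real.exp (1 * (partialCount A n ω - ∑ k ∈ Finset.range n, μ.real (A k))) := by
      intro ω; rw [← Real.exp_add]; ring_nf
    simp_rw [e]
    rw [integral_const_mul, h, Real.exp_add]
    exact mul_le_mul (Real.exp_le_exp.2 (hs.sum_le_tsum _ fun k _ => measureReal_nonneg)) hle
      (h ▸ integral_nonneg fun ω => (Real.exp_pos _).le) (Real.exp_pos _).le
  have hmeas : AEMeasurable (fun ω => Real.exp (eventCount A ω)) μ :=
    Real.measurable_exp.comp_aemeasurable (aemeasurable_eventCount hA hs)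
  refine ⟨hmeas.aestronglyMeasurable, ?_⟩
  have hlim : ∀ᵐ ω ∂μ, ENNReal.ofReal (Real.exp (eventCount A ω)) ≤
      liminf (fun n => ENNReal.ofReal (Real.exp (partialCount A n ω))) atTop := by
    filter_upwards [ae_finite_events hs] with ω hω
    refine le_of_eq (Tendsto.liminf_eq ?_).symm
    exact tendsto_const_nhds.congr' ((eventually_partialCount_eq hω).mono fun n hn => by
      simp only [hn])
  rw [hasFiniteIntegral_iff_ofReal (ae_of_all _ fun ω => (Real.exp_pos _).le)]
  calc ∫⁻ ω, ENNReal.ofReal (Real.exp (eventCount A ω)) ∂μ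
      ≤ ∫⁻ ω, liminf (fun n => ENNReal.ofReal (Real.exp (partialCount A n ω))) atTop ∂μ :=
        lintegral_mono_ae hlim
    _ ≤ liminf (fun n => ∫⁻ ω, ENNReal.ofReal (Real.exp (partialCount A n ω)) ∂μ) atTop :=
        lintegral_liminf_le fun n =>
          (Real.measurable_exp.comp (measurable_partialCount hA n)).ennreal_ofReal
    _ ≤ ENNReal.ofReal (Real.exp (a + V)) := by
        refine liminf_le_of_frequently_le' (Frequently.of_forall fun n => ?_)
        rw [← ofReal_integral_eq_lintegral_ofReal]
        · exact ENNReal.ofReal_le_ofReal (hbound n)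
        · simpa using integrable_exp_partialCount (μ := μ) hA 1 0 n
        · exact ae_of_all _ fun ω => (Real.exp_pos _).le
    _ < ⊤ := ENNReal.ofReal_lt_top

theorem memLp_eventCount (hA : ∀ k, MeasurableSet (A k)) (hi : iIndepSet A μ)
    (hs : Summable fun k => μ.real (A k)) : MemLp (eventCount A) 2 μ := by
  rw [memLp_two_iff_integrable_sq (aemeasurable_eventCount hA hs).aestronglyMeasurable]
  refine ((integrable_exp_eventCount hA hi hs).const_mul 2).mono'
    ((aemeasurable_eventCount hA hs).pow_const 2).aestronglyMeasurable (ae_of_all _ fun ω => ?_)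
  have h0 : 0 ≤ eventCount A ω := by unfold eventCount; positivity
  rw [Real.norm_of_nonneg (sq_nonneg _)]
  have := Real.quadratic_le_exp_of_nonneg h0
  nlinarith

theorem integral_eventCount (hA : ∀ k, MeasurableSet (A k)) (hi : iIndepSet A μ)
    (hs : Summable fun k => μ.real (A k)) :
    ∫ ω, eventCount A ω ∂μ = ∑' k, μ.real (A k) := by
  have h1 : Tendsto (fun n => ∫ ω, partialCount A n ω ∂μ) atTop (𝓝 (∫ ω, eventCount A ω ∂μ)) := by
    refine tendsto_integral_of_dominated_convergence (eventCount A)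
      (fun n => (measurable_partialCount hA n).aestronglyMeasurable)
      ((memLp_eventCount hA hi hs).integrable one_le_two) (fun n => ?_) ?_
    · filter_upwards [ae_finite_events hs] with ω hω
      rw [Real.norm_of_nonneg (partialCount_nonneg n ω)]
      exact partialCount_le_eventCount hω n
    · filter_upwards [ae_finite_events hs] with ω hω
      exact tendsto_const_nhds.congr' ((eventually_partialCount_eq hω).mono fun n hn => hn.symm)
  have h2 : ∀ n, ∫ ω, partialCount A n ω ∂μ = ∑ k ∈ Finset.range n, μ.real (A k) := by
    intro n
    unfold partialCount
    rw [integral_finsetSum _ fun k _ => (integrable_const _).indicator (hA k)]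
    exact Finset.sum_congr rfl fun k _ => by simp [integral_indicator_const _ (hA k)]
  simp_rw [h2] at h1
  exact tendsto_nhds_unique h1 hs.hasSum.tendsto_sum_nat

/-- Variances of the partial counts add up by independence, and both of their first two moments
converge by domination with the full count. -/
theorem variance_eventCount (hA : ∀ k, MeasurableSet (A k)) (hi : iIndepSet A μ)
    (hs : Summable fun k => μ.real (A k)) :
    Var[eventCount A; μ] = ∑' k, μ.real (A k) * (1 - μ.real (A k)) := by
  have hL := memLp_eventCount hA hi hs
  have hind : ∀ k, MemLp ((A k).indicator fun _ => (1 : ℝ)) 2 μ := fun k =>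
    memLp_indicator_const 2 (hA k) 1 (Or.inr (measure_ne_top _ _))
  have hfun : ∀ n, partialCount A n = ∑ k ∈ Finset.range n, (A k).indicator fun _ => (1 : ℝ) := by
    intro n; funext ω; simp [partialCount]
  have hLn : ∀ n, MemLp (partialCount A n) 2 μ := by
    intro n; rw [hfun]; exact memLp_finsetSum' _ fun k _ => hind k
  have hvar1 : ∀ k, Var[(A k).indicator fun _ => (1 : ℝ); μ] =
      μ.real (A k) * (1 - μ.real (A k)) := by
    intro k
    rw [variance_eq_sub (hind k)]
    have e1 := integral_comp_indicator (μ := μ) (hA k) (fun y => y ^ 2)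
    have e2 := integral_comp_indicator (μ := μ) (hA k) (fun y => y)
    simp only [Pi.pow_apply]
    rw [e1, e2]; ring
  have hvar : ∀ n, Var[partialCount A n; μ] =
      ∑ k ∈ Finset.range n, μ.real (A k) * (1 - μ.real (A k)) := by
    intro n
    have h1 : iIndepFun (fun k => (A k).indicator fun _ => (1 : ℝ)) μ := hi.iIndepFun_indicator
    rw [hfun, IndepFun.variance_sum (fun k _ => hind k) fun i _ k _ hik => h1.indepFun hik]
    exact Finset.sum_congr rfl fun k _ => hvar1 k
  have hconv : ∀ᵐ ω ∂μ, Tendsto (fun n => partialCount A n ω) atTop (𝓝 (eventCount A ω)) := by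
    filter_upwards [ae_finite_events hs] with ω hω
    exact tendsto_const_nhds.congr' ((eventually_partialCount_eq hω).mono fun n hn => hn.symm)
  have h1 : Tendsto (fun n => ∫ ω, partialCount A n ω ∂μ) atTop (𝓝 (∫ ω, eventCount A ω ∂μ)) := by
    refine tendsto_integral_of_dominated_convergence (eventCount A)
      (fun n => (measurable_partialCount hA n).aestronglyMeasurable)
      (hL.integrable one_le_two) (fun n => ?_) hconv
    filter_upwards [ae_finite_events hs] with ω hω
    rw [Real.norm_of_nonneg (partialCount_nonneg n ω)]
    exact partialCount_le_eventCount hω n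
  have h2 : Tendsto (fun n => ∫ ω, partialCount A n ω ^ 2 ∂μ) atTop
      (𝓝 (∫ ω, eventCount A ω ^ 2 ∂μ)) := by
    refine tendsto_integral_of_dominated_convergence (fun ω => eventCount A ω ^ 2)
      (fun n => ((measurable_partialCount hA n).pow_const 2).aestronglyMeasurable)
      hL.integrable_sq (fun n => ?_) ?_
    · filter_upwards [ae_finite_events hs] with ω hω
      rw [Real.norm_of_nonneg (sq_nonneg _)]
      exact pow_le_pow_left₀ (partialCount_nonneg n ω) (partialCount_le_eventCount hω n) 2
    · filter_upwards [hconv] with ω hω using hω.pow 2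
  have h3 := h2.sub (h1.pow 2)
  have h4 : ∀ n, ∫ ω, partialCount A n ω ^ 2 ∂μ - (∫ ω, partialCount A n ω ∂μ) ^ 2 =
      ∑ k ∈ Finset.range n, μ.real (A k) * (1 - μ.real (A k)) := by
    intro n
    rw [← hvar, variance_eq_sub (hLn n)]; rfl
  simp_rw [h4] at h3
  rw [variance_eq_sub hL]
  exact tendsto_nhds_unique h3 (summable_mul_one_sub hs).hasSum.tendsto_sum_nat

/-- Two-sided bounds for the moment generating function of the centred number of occurrences. -/
theorem mgf_eventCount_bounds (hA : ∀ k, MeasurableSet (A k)) (hi : iIndepSet A μ)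
    (hs : Summable fun k => μ.real (A k)) {θ : ℝ} (hθ : |θ| ≤ 1) :
    Integrable (fun ω => Real.exp (θ * (eventCount A ω - ∫ ω', eventCount A ω' ∂μ))) μ ∧
    Real.exp (θ ^ 2 * Var[eventCount A; μ] / 2 * (1 - |θ|)) ≤
      ∫ ω, Real.exp (θ * (eventCount A ω - ∫ ω', eventCount A ω' ∂μ)) ∂μ ∧
    ∫ ω, Real.exp (θ * (eventCount A ω - ∫ ω', eventCount A ω' ∂μ)) ∂μ ≤
      Real.exp (θ ^ 2 * Var[eventCount A; μ] / 2 * (1 + |θ|)) := by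
  rw [variance_eventCount hA hi hs]
  simp_rw [integral_eventCount hA hi hs]
  set a := ∑' k, μ.real (A k) with ha
  have hq1 : ∀ k, μ.real (A k) ≤ 1 := fun k => measureReal_le_one
  have hsn : ∀ n, ∑ k ∈ Finset.range n, μ.real (A k) ≤ a := fun n =>
    hs.sum_le_tsum _ fun k _ => measureReal_nonneg
  have hsn0 : ∀ n, 0 ≤ ∑ k ∈ Finset.range n, μ.real (A k) := fun n =>
    Finset.sum_nonneg fun k _ => measureReal_nonneg
  have ha0 : 0 ≤ a := tsum_nonneg fun k => measureReal_nonneg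
  have hdomI : Integrable (fun ω => Real.exp a * Real.exp (eventCount A ω)) μ :=
    (integrable_exp_eventCount hA hi hs).const_mul _
  have hdom : ∀ x y c : ℝ, 0 ≤ x → x ≤ y → 0 ≤ c → c ≤ a →
      ‖Real.exp (θ * (x - c))‖ ≤ Real.exp a * Real.exp y := by
    intro x y c hx hxy hc hca
    rw [Real.norm_of_nonneg (Real.exp_pos _).le, ← Real.exp_add]
    apply Real.exp_le_exp.2
    have h1 : |x - c| ≤ x + c := by rw [abs_le]; constructor <;> linarith
    calc θ * (x - c) ≤ |θ * (x - c)| := le_abs_self _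
      _ = |θ| * |x - c| := abs_mul _ _
      _ ≤ 1 * (x + c) := mul_le_mul hθ h1 (abs_nonneg _) zero_le_one
      _ ≤ a + y := by linarith
  have hC0 : ∀ ω, 0 ≤ eventCount A ω := fun ω => by unfold eventCount; positivity
  have hint : Integrable (fun ω => Real.exp (θ * (eventCount A ω - a))) μ := by
    refine hdomI.mono' ?_ (ae_of_all _ fun ω => hdom _ _ _ (hC0 ω) le_rfl ha0 le_rfl)
    exact (Real.measurable_exp.comp_aemeasurable
      (((aemeasurable_eventCount hA hs).sub_const a).const_mul θ)).aestronglyMeasurable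
  refine ⟨hint, ?_⟩
  have hlim : Tendsto (fun n => ∫ ω, Real.exp (θ * (partialCount A n ω -
      ∑ k ∈ Finset.range n, μ.real (A k))) ∂μ) atTop
      (𝓝 (∫ ω, Real.exp (θ * (eventCount A ω - a)) ∂μ)) := by
    refine tendsto_integral_of_dominated_convergence
      (fun ω => Real.exp a * Real.exp (eventCount A ω))
      (fun n => (integrable_exp_partialCount hA _ _ n).aestronglyMeasurable) hdomI
      (fun n => ?_) ?_
    · filter_upwards [ae_finite_events hs] with ω hω
      exact hdom _ _ _ (partialCount_nonneg n ω) (partialCount_le_eventCount hω n) (hsn0 n) (hsn n)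
    · filter_upwards [ae_finite_events hs] with ω hω
      have h1 : Tendsto (fun n => partialCount A n ω) atTop (𝓝 (eventCount A ω)) :=
        tendsto_const_nhds.congr' ((eventually_partialCount_eq hω).mono fun n hn => hn.symm)
      exact (Real.continuous_exp.tendsto _).comp
        ((h1.sub hs.hasSum.tendsto_sum_nat).const_mul θ)
  simp_rw [integral_exp_partialCount_sub hA hi θ] at hlim
  have hVlim := (summable_mul_one_sub (μ := μ) hs).hasSum.tendsto_sum_nat
  constructor
  · refine le_of_tendsto_of_tendsto' ((Real.continuous_exp.tendsto _).comp
      (((hVlim.const_mul (θ ^ 2)).div_const 2).mul_const (1 - |θ|))) hlim fun n => ?_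
    simp only [Function.comp]
    rw [Finset.mul_sum, Finset.sum_div, Finset.sum_mul, Real.exp_sum]
    exact Finset.prod_le_prod (fun k _ => (Real.exp_pos _).le) fun k _ =>
      (bernoulli_mgf_bounds measureReal_nonneg (hq1 k) hθ).1
  · refine le_of_tendsto_of_tendsto' hlim ((Real.continuous_exp.tendsto _).comp
      (((hVlim.const_mul (θ ^ 2)).div_const 2).mul_const (1 + |θ|))) fun n => ?_
    simp only [Function.comp]
    rw [Finset.mul_sum, Finset.sum_div, Finset.sum_mul, Real.exp_sum]
    refine Finset.prod_le_prod (fun k _ => ?_) fun k _ =>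
      (bernoulli_mgf_bounds measureReal_nonneg (hq1 k) hθ).2
    exact (Real.exp_pos _).le.trans (bernoulli_mgf_bounds measureReal_nonneg (hq1 k) hθ).1

end EventCount

/-! ### Tail bounds -/

section Tails

variable {Ω : Type*} [MeasurableSpace Ω] {μ : Measure Ω} [IsProbabilityMeasure μ]

/-- Chernoff's inequality. The parameter `θ` and the variance bound `V` stay free because each
application optimises them differently. -/
theorem eventCount_upper_tail {A : ℕ → Set Ω} (hA : ∀ k, MeasurableSet (A k)) (hi : iIndepSet A μ)
    (hs : Summable fun k => μ.real (A k)) {θ V : ℝ} (hθ0 : 0 ≤ θ) (hθ1 : θ ≤ 1)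
    (hV : Var[eventCount A; μ] ≤ V) (x : ℝ) :
    μ.real {ω | x ≤ eventCount A ω - ∫ ω', eventCount A ω' ∂μ} ≤
      Real.exp (-θ * x + θ ^ 2 * V / 2 * (1 + θ)) := by
  have hθ : |θ| ≤ 1 := by rwa [abs_of_nonneg hθ0]
  obtain ⟨h1, -, h2⟩ := mgf_eventCount_bounds hA hi hs hθ
  refine (measure_ge_le_exp_mul_mgf x hθ0 h1).trans ?_
  rw [Real.exp_add]
  refine mul_le_mul_of_nonneg_left (h2.trans ?_) (Real.exp_pos _).le
  rw [abs_of_nonneg hθ0]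
  gcongr

theorem eventCount_lower_tail {A : ℕ → Set Ω} (hA : ∀ k, MeasurableSet (A k)) (hi : iIndepSet A μ)
    (hs : Summable fun k => μ.real (A k)) {θ V : ℝ} (hθ0 : 0 ≤ θ) (hθ1 : θ ≤ 1)
    (hV : Var[eventCount A; μ] ≤ V) (x : ℝ) :
    μ.real {ω | eventCount A ω - ∫ ω', eventCount A ω' ∂μ ≤ -x} ≤
      Real.exp (-θ * x + θ ^ 2 * V / 2 * (1 + θ)) := by
  have hθ : |-θ| ≤ 1 := by rwa [abs_neg, abs_of_nonneg hθ0]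
  obtain ⟨h1, -, h2⟩ := mgf_eventCount_bounds hA hi hs hθ
  refine (measure_le_le_exp_mul_mgf (-x) (neg_nonpos.2 hθ0) h1).trans ?_
  rw [Real.exp_add, neg_neg, mul_neg, neg_mul]
  refine mul_le_mul_of_nonneg_left (h2.trans ?_) (Real.exp_pos _).le
  rw [abs_neg, abs_of_nonneg hθ0, neg_sq]
  gcongr

/-- Kolmogorov's lower exponential bound, in terms of the moment generating function. -/
theorem lower_bound_of_mgf {S : Ω → ℝ} (hS : AEMeasurable S μ) {θ ε V : ℝ} (hθ : 0 < θ)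
    (hε : 0 < ε) (hε1 : ε ≤ 1) (hV : 0 ≤ V)
    (hint : ∀ t, 0 ≤ t → t ≤ θ * (1 + ε) → Integrable (fun ω => Real.exp (t * S ω)) μ)
    (hup : ∀ t, 0 ≤ t → t ≤ θ * (1 + ε) →
      ∫ ω, Real.exp (t * S ω) ∂μ ≤ Real.exp (t ^ 2 * V / 2 * (1 + ε ^ 2 / 10)))
    (hlow : Real.exp (θ ^ 2 * V / 2 * (1 - ε ^ 2 / 10)) ≤ ∫ ω, Real.exp (θ * S ω) ∂μ)
    (hbig : 6 ≤ ε ^ 2 * (θ ^ 2 * V)) :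
    1 / 2 * Real.exp (-(θ ^ 2 * V * (1 / 2 + 2 * ε))) ≤
      μ.real {ω | (1 - ε) * (θ * V) ≤ S ω} := by
  set D := {ω | (1 - ε) * (θ * V) ≤ S ω} with hD
  have hDm : NullMeasurableSet D μ := nullMeasurableSet_le aemeasurable_const hS
  set W := θ ^ 2 * V with hW
  have hW0 : 0 ≤ W := by positivity
  set t₁ := θ * (1 - ε) with ht₁
  set t₂ := θ * (1 + ε) with ht₂
  have ht10 : 0 ≤ t₁ := mul_nonneg hθ.le (by linarith)
  have ht12 : t₁ ≤ t₂ := mul_le_mul_of_nonneg_left (by linarith) hθ.le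
  have hθ2 : θ ≤ t₂ := le_mul_of_one_le_right hθ.le (by linarith)
  set e₁ := Real.exp (ε * (1 - ε) * W) with he₁
  set e₂ := Real.exp (-(ε * (1 + ε) * W)) with he₂
  set e₃ := Real.exp ((1 + ε) * W) with he₃
  -- Under the tilted measure `S` concentrates near `θ * V`. Below the window `(1 ± ε) * θ * V` the
  -- exponential is dominated by the one with the smaller parameter `t₁`, above it by the one with
  -- `t₂`; inside the window it is at most `e₃`.
  have hpt : ∀ ω, Real.exp (θ * S ω) ≤ e₁ * Real.exp (t₁ * S ω) + e₂ * Real.exp (t₂ * S ω) +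
      D.indicator (fun _ => e₃) ω := by
    intro ω
    have p1 : 0 ≤ e₁ * Real.exp (t₁ * S ω) := by positivity
    have p2 : 0 ≤ e₂ * Real.exp (t₂ * S ω) := by positivity
    have p3 : 0 ≤ D.indicator (fun _ => e₃) ω := Set.indicator_nonneg (fun _ _ => by positivity) ω
    by_cases h1 : S ω < (1 - ε) * (θ * V)
    · have : Real.exp (θ * S ω) ≤ e₁ * Real.exp (t₁ * S ω) := by
        rw [he₁, ← Real.exp_add]
        apply Real.exp_le_exp.2
        have := mul_le_mul_of_nonneg_left h1.le (mul_nonneg hε.le hθ.le)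
        rw [hW, ht₁]; linarith
      linarith
    · by_cases h2 : (1 + ε) * (θ * V) < S ω
      · have : Real.exp (θ * S ω) ≤ e₂ * Real.exp (t₂ * S ω) := by
          rw [he₂, ← Real.exp_add]
          apply Real.exp_le_exp.2
          have := mul_le_mul_of_nonneg_left h2.le (mul_nonneg hε.le hθ.le)
          rw [hW, ht₂]; linarith
        linarith
      · have hmem : ω ∈ D := not_lt.1 h1
        have : Real.exp (θ * S ω) ≤ e₃ := by
          apply Real.exp_le_exp.2
          have := mul_le_mul_of_nonneg_left (not_lt.1 h2) hθ.le
          rw [hW]; linarith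
        rw [Set.indicator_of_mem hmem]
        linarith
  have hi1 := (hint t₁ ht10 ht12).const_mul e₁
  have hi2 := (hint t₂ (hθ.le.trans hθ2) le_rfl).const_mul e₂
  have hi3 : Integrable (D.indicator fun _ => e₃) μ := (integrable_const e₃).indicator₀ hDm
  have hI : ∫ ω, Real.exp (θ * S ω) ∂μ ≤
      e₁ * ∫ ω, Real.exp (t₁ * S ω) ∂μ + e₂ * ∫ ω, Real.exp (t₂ * S ω) ∂μ + μ.real D * e₃ := by
    calc _ ≤ ∫ ω, (e₁ * Real.exp (t₁ * S ω) + e₂ * Real.exp (t₂ * S ω) +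
          D.indicator (fun _ => e₃) ω) ∂μ :=
          integral_mono (hint θ hθ.le hθ2) ((hi1.add hi2).add hi3) hpt
      _ = _ := by
          rw [integral_add (by exact hi1.add hi2) hi3, integral_add hi1 hi2, integral_const_mul,
            integral_const_mul, integral_indicator₀ hDm]
          simp
  have hε2 : 0 ≤ ε ^ 2 := sq_nonneg ε
  have hεsq : ε ^ 2 ≤ ε := by nlinarith
  have b1 : e₁ * ∫ ω, Real.exp (t₁ * S ω) ∂μ ≤ Real.exp (W / 2 - ε ^ 2 * W * (3 / 10)) := by
    calc _ ≤ e₁ * Real.exp (t₁ ^ 2 * V / 2 * (1 + ε ^ 2 / 10)) :=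
          mul_le_mul_of_nonneg_left (hup t₁ ht10 ht12) (Real.exp_pos _).le
      _ ≤ _ := by
          rw [he₁, ← Real.exp_add]
          apply Real.exp_le_exp.2
          have : ε * (1 - ε) * W + t₁ ^ 2 * V / 2 * (1 + ε ^ 2 / 10) =
            W * (ε * (1 - ε) + (1 - ε) ^ 2 / 2 * (1 + ε ^ 2 / 10)) := by rw [ht₁, hW]; ring
          rw [this, show W / 2 - ε ^ 2 * W * (3 / 10) = W * (1 / 2 - ε ^ 2 * (3 / 10)) by ring]
          apply mul_le_mul_of_nonneg_left _ hW0
          have : (1 - ε) ^ 2 ≤ 1 := by nlinarith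
          nlinarith [mul_le_mul_of_nonneg_right this hε2]
  have b2 : e₂ * ∫ ω, Real.exp (t₂ * S ω) ∂μ ≤ Real.exp (W / 2 - ε ^ 2 * W * (3 / 10)) := by
    calc _ ≤ e₂ * Real.exp (t₂ ^ 2 * V / 2 * (1 + ε ^ 2 / 10)) :=
          mul_le_mul_of_nonneg_left (hup t₂ (hθ.le.trans hθ2) le_rfl) (Real.exp_pos _).le
      _ ≤ _ := by
          rw [he₂, ← Real.exp_add]
          apply Real.exp_le_exp.2
          have : -(ε * (1 + ε) * W) + t₂ ^ 2 * V / 2 * (1 + ε ^ 2 / 10) =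
            W * (-(ε * (1 + ε)) + (1 + ε) ^ 2 / 2 * (1 + ε ^ 2 / 10)) := by rw [ht₂, hW]; ring
          rw [this, show W / 2 - ε ^ 2 * W * (3 / 10) = W * (1 / 2 - ε ^ 2 * (3 / 10)) by ring]
          apply mul_le_mul_of_nonneg_left _ hW0
          have : (1 + ε) ^ 2 ≤ 4 := by nlinarith
          nlinarith [mul_le_mul_of_nonneg_right this hε2]
  set T := Real.exp (W / 2 - W * ε ^ 2 / 20) with hT
  have hTl : T ≤ ∫ ω, Real.exp (θ * S ω) ∂μ := by
    refine le_trans (le_of_eq ?_) hlow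
    rw [hT]; congr 1; ring
  -- The exponents differ by `ε ^ 2 * W / 4`, which is at least `3 / 2` by `hbig`. So the two outer
  -- parts together take at most half of `T`, and the window carries the other half.
  have hsmall : Real.exp (W / 2 - ε ^ 2 * W * (3 / 10)) ≤ T * (1 / 4) := by
    have h4 : Real.exp (-(3 / 2)) ≤ 1 / 4 := by
      rw [Real.exp_neg, inv_le_comm₀ (Real.exp_pos _) (by norm_num), one_div, inv_inv]
      have : Real.exp (3 / 2) = Real.exp (1 / 2) * Real.exp (1 / 2) * Real.exp (1 / 2) := by
        rw [← Real.exp_add, ← Real.exp_add]; norm_num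
      have h := Real.quadratic_le_exp_of_nonneg (x := (1 / 2 : ℝ)) (by norm_num)
      rw [this]
      have h' : (1.625 : ℝ) ≤ Real.exp (1 / 2) := by norm_num at h ⊢; linarith
      calc (4 : ℝ) ≤ 1.625 * 1.625 * 1.625 := by norm_num
        _ ≤ _ := by gcongr
    calc _ ≤ T * Real.exp (-(3 / 2)) := by
          rw [hT, ← Real.exp_add]
          apply Real.exp_le_exp.2
          linarith
      _ ≤ _ := mul_le_mul_of_nonneg_left h4 (Real.exp_pos _).le
  have hfin : 1 / 2 * T ≤ μ.real D * e₃ := by linarith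
  have he3 : 0 < e₃ := Real.exp_pos _
  rw [← div_le_iff₀ he3] at hfin
  refine le_trans ?_ hfin
  rw [mul_div_assoc, hT, he₃, ← Real.exp_sub]
  refine mul_le_mul_of_nonneg_left (Real.exp_le_exp.2 ?_) (by norm_num)
  nlinarith [mul_le_mul_of_nonneg_left hεsq hW0]

/-- The condition `hθε` keeps every parameter in play below `ε ^ 2 / 10`, so the relative error
`|t|` in the moment generating function meets the tolerance of `lower_bound_of_mgf`. -/
theorem eventCount_lower_bound {A : ℕ → Set Ω} (hA : ∀ k, MeasurableSet (A k))
    (hi : iIndepSet A μ) (hs : Summable fun k => μ.real (A k)) {θ ε : ℝ} (hθ : 0 < θ)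
    (hε : 0 < ε) (hε1 : ε ≤ 1) (hθε : θ * (1 + ε) ≤ ε ^ 2 / 10)
    (hbig : 6 ≤ ε ^ 2 * (θ ^ 2 * Var[eventCount A; μ])) :
    1 / 2 * Real.exp (-(θ ^ 2 * Var[eventCount A; μ] * (1 / 2 + 2 * ε))) ≤
      μ.real {ω | (1 - ε) * (θ * Var[eventCount A; μ]) ≤
        eventCount A ω - ∫ ω', eventCount A ω' ∂μ} := by
  have hεε : ε ^ 2 / 10 ≤ 1 := by nlinarith
  have hV0 : 0 ≤ Var[eventCount A; μ] := variance_nonneg _ _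
  have habs : ∀ t, 0 ≤ t → t ≤ θ * (1 + ε) → |t| ≤ 1 := fun t h0 h1 => by
    rw [abs_of_nonneg h0]; linarith
  have hθ2 : θ ≤ θ * (1 + ε) := le_mul_of_one_le_right hθ.le (by linarith)
  refine lower_bound_of_mgf ((aemeasurable_eventCount hA hs).sub_const _) hθ hε hε1 hV0
    (fun t h0 h1 => (mgf_eventCount_bounds hA hi hs (habs t h0 h1)).1)
    (fun t h0 h1 => ((mgf_eventCount_bounds hA hi hs (habs t h0 h1)).2.2).trans ?_)
    (le_trans ?_ (mgf_eventCount_bounds hA hi hs (habs θ hθ.le hθ2)).2.1) hbig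
  · rw [abs_of_nonneg h0]
    gcongr
    linarith
  · rw [abs_of_pos hθ]
    gcongr
    linarith

end Tails

/-! ### Functionals of the marked Poisson process -/

section Weights

/-- Weight of a ball thrown at time `s` into box `b`: it is `z k` if `b = k ∈ F` and `s ≤ τ k`,
and `1` otherwise. -/
def ballWeight (F : Finset ℕ) (τ : ℕ → ℝ) (z : ℕ → ℂ) (s : ℝ) (b : ℕ) : ℂ :=
  ∏ k ∈ F, if s ≤ τ k ∧ b = k then z k else 1

/-- Mean of `ballWeight` over the box. -/
def meanWeight (p : ℕ → ℝ) (F : Finset ℕ) (τ : ℕ → ℝ) (z : ℕ → ℂ) (s : ℝ) : ℂ :=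
  1 - ∑ k ∈ F, (1 - z k) * (if s ≤ τ k then (p k : ℂ) else 0)

/-- Mean of the product of the weights of the balls thrown after time `s`. -/
def futureWeight (p : ℕ → ℝ) (F : Finset ℕ) (τ : ℕ → ℝ) (z : ℕ → ℂ) (s : ℝ) : ℂ :=
  Complex.exp (-∑ k ∈ F, p k * (1 - z k) * (max (τ k - s) 0 : ℝ))

variable {p : ℕ → ℝ} {F : Finset ℕ} {τ : ℕ → ℝ} {z : ℕ → ℂ}

/-- A ball lies in one box only, so at most one factor differs from `1` and the product is affine in
the indicators. -/
lemma ballWeight_eq (s : ℝ) (b : ℕ) :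
    ballWeight F τ z s b = 1 - ∑ k ∈ F, (1 - z k) * (if s ≤ τ k ∧ b = k then 1 else 0) := by
  unfold ballWeight
  induction F using Finset.induction_on with
  | empty => simp
  | insert a F ha ih =>
    rw [Finset.prod_insert ha, Finset.sum_insert ha, ih]
    by_cases h : s ≤ τ a ∧ b = a
    · have : ∑ k ∈ F, (1 - z k) * (if s ≤ τ k ∧ b = k then (1 : ℂ) else 0) = 0 := by
        refine Finset.sum_eq_zero fun k hk => ?_
        have : ¬ (s ≤ τ k ∧ b = k) := by
          rintro ⟨-, h2⟩
          exact ha (by rw [← h.2, h2]; exact hk)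
        simp [this]
      rw [this, if_pos h, if_pos h]; ring
    · rw [if_neg h, if_neg h]; ring

lemma norm_ballWeight_le (hz : ∀ k, ‖z k‖ ≤ 1) (s : ℝ) (b : ℕ) : ‖ballWeight F τ z s b‖ ≤ 1 := by
  unfold ballWeight
  rw [norm_prod]
  refine Finset.prod_le_one (fun _ _ => norm_nonneg _) fun k _ => ?_
  split_ifs
  · exact hz k
  · simp

lemma measurable_ballWeight : Measurable fun q : ℝ × ℕ => ballWeight F τ z q.1 q.2 := by
  unfold ballWeight
  refine Finset.measurable_prod _ fun k _ => ?_
  refine Measurable.ite ?_ measurable_const measurable_const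
  exact (measurableSet_le measurable_fst measurable_const).inter
    (measurable_snd (measurableSet_singleton k))

lemma measurable_meanWeight : Measurable (meanWeight p F τ z) := by
  unfold meanWeight
  refine measurable_const.sub (Finset.measurable_sum _ fun k _ => measurable_const.mul ?_)
  exact Measurable.ite measurableSet_Iic measurable_const measurable_const

lemma continuous_futureWeight : Continuous (futureWeight p F τ z) := by
  unfold futureWeight; fun_prop

lemma norm_futureWeight_le (hp : ∀ k, 0 ≤ p k) (hz : ∀ k, ‖z k‖ ≤ 1) (s : ℝ) :
    ‖futureWeight p F τ z s‖ ≤ 1 := by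
  unfold futureWeight
  rw [Complex.norm_exp, Real.exp_le_one_iff, Complex.neg_re, neg_nonpos, Complex.re_sum]
  refine Finset.sum_nonneg fun k _ => ?_
  have h1 : 0 ≤ 1 - (z k).re := by linarith [(Complex.re_le_norm (z k)).trans (hz k)]
  have h2 : 0 ≤ max (τ k - s) 0 := le_max_right _ _
  rw [Complex.re_mul_ofReal, Complex.re_ofReal_mul]
  have h3 : (1 - z k).re = 1 - (z k).re := by simp
  rw [h3]
  exact mul_nonneg (mul_nonneg (hp k) h1) h2

lemma futureWeight_eq_one {s : ℝ} (h : ∀ k ∈ F, τ k ≤ s) : futureWeight p F τ z s = 1 := by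
  unfold futureWeight
  rw [Finset.sum_eq_zero, neg_zero, Complex.exp_zero]
  intro k hk
  rw [max_eq_right (by linarith [h k hk])]; simp

lemma futureWeight_eq_prod (s : ℝ) : futureWeight p F τ z s =
    ∏ k ∈ F, Complex.exp ((p k * max (τ k - s) 0 : ℝ) * (z k - 1)) := by
  unfold futureWeight
  rw [← Complex.exp_sum, ← Finset.sum_neg_distrib]
  congr 1
  refine Finset.sum_congr rfl fun k _ => ?_
  push_cast; ring

lemma norm_meanWeight_le (hp : ∀ k, 0 ≤ p k) (hz : ∀ k, ‖z k‖ ≤ 1) (s : ℝ) :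
    ‖meanWeight p F τ z s‖ ≤ 1 + ∑ k ∈ F, 2 * p k := by
  unfold meanWeight
  refine (norm_sub_le _ _).trans ?_
  rw [norm_one]
  refine add_le_add_right ((norm_sum_le _ _).trans (Finset.sum_le_sum fun k _ => ?_)) 1
  rw [norm_mul]
  refine mul_le_mul ?_ ?_ (norm_nonneg _) (by norm_num)
  · calc ‖1 - z k‖ ≤ ‖(1 : ℂ)‖ + ‖z k‖ := norm_sub_le _ _
      _ ≤ 2 := by rw [norm_one]; linarith [hz k]
  · split_ifs
    · rw [Complex.norm_real, Real.norm_of_nonneg (hp k)]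
    · simpa using hp k

lemma hasDerivAt_max_sub {t u : ℝ} (h : u ≠ t) :
    HasDerivAt (fun u : ℝ => max (t - u) 0) (if u ≤ t then -1 else 0) u := by
  rcases lt_or_gt_of_ne h with h | h
  · rw [if_pos h.le]
    refine ((hasDerivAt_id u).const_sub t).congr_of_eventuallyEq ?_
    filter_upwards [gt_mem_nhds h] with v hv
    simp only [id]
    exact max_eq_left (by linarith)
  · rw [if_neg (not_le.2 h)]
    refine (hasDerivAt_const u (0 : ℝ)).congr_of_eventuallyEq ?_
    filter_upwards [lt_mem_nhds h] with v hv
    exact max_eq_right (by linarith)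

lemma hasDerivAt_futureWeight {s : ℝ} (h : ∀ k ∈ F, s ≠ τ k) :
    HasDerivAt (futureWeight p F τ z)
      (futureWeight p F τ z s * (1 - meanWeight p F τ z s)) s := by
  have h1 : HasDerivAt (fun s : ℝ => -∑ k ∈ F, (p k : ℂ) * (1 - z k) * (max (τ k - s) 0 : ℝ))
      (-∑ k ∈ F, (p k : ℂ) * (1 - z k) * ((if s ≤ τ k then -1 else 0 : ℝ) : ℂ)) s := by
    refine HasDerivAt.neg (HasDerivAt.fun_sum fun k hk => ?_)
    exact ((hasDerivAt_max_sub (h k hk)).ofReal_comp).const_mul _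
  refine h1.cexp.congr_deriv ?_
  unfold futureWeight meanWeight
  simp only [sub_sub_cancel, ← Finset.sum_neg_distrib]
  congr 1
  refine Finset.sum_congr rfl fun k _ => ?_
  by_cases hk : s ≤ τ k
  · simp [hk]; ring
  · simp [hk]

lemma integral_expMeasure_one (f : ℝ → ℂ) :
    ∫ x, f x ∂(expMeasure 1) = ∫ x in Set.Ioi (0 : ℝ), (Real.exp (-x) : ℂ) * f x := by
  have hm : Measurable (gammaPDF 1 1) := by
    unfold gammaPDF; exact (measurable_gammaPDFReal 1 1).ennreal_ofReal
  rw [expMeasure, gammaMeasure, integral_withDensity_eq_integral_toReal_smul hm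
    (ae_of_all _ fun x => ENNReal.ofReal_lt_top), ← integral_indicator measurableSet_Ioi]
  refine integral_congr_ae ?_
  have h0 : ∀ᵐ x : ℝ, x ≠ 0 := by simp [ae_iff]
  filter_upwards [h0] with x hx
  simp only [gammaPDF, gammaPDFReal]
  rcases lt_or_gt_of_ne hx with h | h
  · simp [Set.indicator, h.not_ge, h.not_gt]
  · rw [if_pos h.le, Set.indicator_of_mem (Set.mem_Ioi.2 h), ENNReal.toReal_ofReal (by positivity)]
    simp

/-- One step of the martingale: wait an exponential time for the next ball, then multiply by its
mean weight. By the differential equation for `futureWeight`, the integrand is the derivative of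
`-(exp (-x) * futureWeight (y + x))` except at the finitely many kinks `τ k - y`. -/
lemma integral_meanWeight_mul_futureWeight (hp : ∀ k, 0 ≤ p k) (hz : ∀ k, ‖z k‖ ≤ 1) (y : ℝ) :
    ∫ x, meanWeight p F τ z (y + x) * futureWeight p F τ z (y + x) ∂(expMeasure 1) =
      futureWeight p F τ z y := by
  rw [integral_expMeasure_one]
  set f' : ℝ → ℂ := fun x => (Real.exp (-x) : ℂ) *
    (meanWeight p F τ z (y + x) * futureWeight p F τ z (y + x)) with hf'
  set f : ℝ → ℂ := fun x => -((Real.exp (-x) : ℂ) * futureWeight p F τ z (y + x)) with hf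
  set C : ℝ := 1 + ∑ k ∈ F, 2 * p k with hC
  have hwc : Continuous fun x => futureWeight p F τ z (y + x) :=
    continuous_futureWeight.comp (by fun_prop)
  have hec : Continuous fun x : ℝ => (Real.exp (-x) : ℂ) := by fun_prop
  have hm : Measurable f' := hec.measurable.mul
    ((measurable_meanWeight.comp (measurable_const.add measurable_id)).mul hwc.measurable)
  have hb : ∀ x, ‖f' x‖ ≤ C * Real.exp (-x) := by
    intro x
    rw [hf', norm_mul, norm_mul, Complex.norm_real, Real.norm_of_nonneg (Real.exp_pos _).le]
    have h1 := norm_meanWeight_le (F := F) (τ := τ) hp hz (y + x)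
    have h2 := norm_futureWeight_le (F := F) (τ := τ) hp hz (y + x)
    have hC0 : 0 ≤ C := (norm_nonneg _).trans h1
    calc _ ≤ Real.exp (-x) * (C * 1) := by
          gcongr
      _ = _ := by ring
  have hint : IntegrableOn f' (Set.Ioi 0) :=
    ((integrableOn_exp_neg_Ioi 0).const_mul C).mono' hm.aestronglyMeasurable (ae_of_all _ hb)
  have hlim1 := intervalIntegral_tendsto_integral_Ioi 0 hint tendsto_id
  have hftc : ∀ N : ℝ, 0 ≤ N → ∫ x in (0 : ℝ)..N, f' x = f N - f 0 := by
    intro N hN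
    refine integral_eq_of_hasDerivAt_off_countable f f'
      (s := ((F.image fun k => τ k - y : Finset ℝ) : Set ℝ)) (Finset.countable_toSet _)
      (hec.mul hwc).neg.continuousOn (fun x hx => ?_) ?_
    · have hne : ∀ k ∈ F, y + x ≠ τ k := by
        intro k hk heq
        apply hx.2
        simp only [Finset.coe_image, Set.mem_image, Finset.mem_coe]
        exact ⟨k, hk, by linarith⟩
      have h1 : HasDerivAt (fun x => futureWeight p F τ z (y + x)) _ x :=
        (hasDerivAt_futureWeight (p := p) (z := z) hne).comp_const_add y x
      have h2 : HasDerivAt (fun x : ℝ => (Real.exp (-x) : ℂ)) (-(Real.exp (-x) : ℝ) : ℂ) x := by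
        have := ((hasDerivAt_neg x).exp).ofReal_comp
        refine this.congr_deriv ?_
        push_cast; ring
      refine ((h2.mul h1).neg).congr_deriv ?_
      simp only [hf']; ring
    · rw [intervalIntegrable_iff_integrableOn_Ioc_of_le hN]
      exact hint.mono_set Set.Ioc_subset_Ioi_self
  have hlim2 : Tendsto (fun N : ℝ => f N - f 0) atTop (𝓝 (0 - f 0)) := by
    refine Tendsto.sub_const ?_ _
    rw [tendsto_zero_iff_norm_tendsto_zero]
    refine squeeze_zero (fun _ => norm_nonneg _) (fun N => ?_) Real.tendsto_exp_neg_atTop_nhds_zero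
    simp only [hf]
    rw [norm_neg, norm_mul, Complex.norm_real, Real.norm_of_nonneg (Real.exp_pos _).le]
    exact mul_le_of_le_one_right (Real.exp_pos _).le (norm_futureWeight_le hp hz _)
  have hlim3 : Tendsto (fun N : ℝ => ∫ x in (0 : ℝ)..N, f' x) atTop (𝓝 (0 - f 0)) := by
    refine hlim2.congr' ?_
    filter_upwards [eventually_ge_atTop 0] with N hN using (hftc N hN).symm
  have := tendsto_nhds_unique hlim1 hlim3
  rw [this]
  simp [hf]

end Weights

/-! ### Expectations of products of weights -/

section Thinning

variable {Ω : Type*} [MeasurableSpace Ω] {μ : Measure Ω} [IsProbabilityMeasure μ] {p : ℕ → ℝ}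
  {ξ : ℕ → Ω → ℝ} {B : ℕ → Ω → ℕ} {F : Finset ℕ} {τ : ℕ → ℝ} {z : ℕ → ℂ}

/-- The martingale property: the new waiting time is independent of the past, and integrating it out
replaces `G * w` by `w` thanks to `hfix`. -/
lemma integral_wait_step (hS : IsPoissonizedScheme μ p ξ B) {G w : ℝ → ℂ} (hG : Measurable G)
    (hw : Measurable w) {C : ℝ} (hGC : ∀ x, ‖G x‖ ≤ C) (hwC : ∀ x, ‖w x‖ ≤ 1)
    (hfix : ∀ y, ∫ x, G (y + x) * w (y + x) ∂(expMeasure 1) = w y) (n : ℕ) :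
    ∫ ω, (∏ i ∈ Finset.range n, G (throwTime ξ i ω)) *
      w (∑ i ∈ Finset.range n, ξ i ω) ∂μ = w 0 := by
  have : IsProbabilityMeasure (expMeasure 1) := isProbabilityMeasure_expMeasure one_pos
  have hC0 : 0 ≤ C := (norm_nonneg _).trans (hGC 0)
  induction n with
  | zero => simp
  | succ n ih =>
    -- the past, as a function of the first `n` waiting times
    set ψ : (ℕ → ℝ) → ℂ × ℝ := fun v =>
      (∏ i ∈ Finset.range n, G (∑ l ∈ Finset.range (i + 1), v l), ∑ l ∈ Finset.range n, v l)
      with hψ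
    have hψm : Measurable ψ := by
      refine Measurable.prodMk ?_ ?_
      · refine Finset.measurable_prod _ fun i _ => hG.comp ?_
        exact Finset.measurable_sum _ fun l _ => measurable_pi_apply l
      · exact Finset.measurable_sum _ fun l _ => measurable_pi_apply l
    -- Extension by zero turns the finite vector of past waiting times into a sequence, on which `ψ`
    -- reads only the first `n` coordinates.
    set ext : ((Finset.range n) → ℝ) → ℕ → ℝ :=
      fun y l => if h : l ∈ Finset.range n then y ⟨l, h⟩ else 0 with hext
    have hextm : Measurable ext := by
      rw [measurable_pi_iff]
      intro l
      by_cases h : l ∈ Finset.range n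
      · simp only [hext, h, dif_pos]; exact measurable_pi_apply _
      · simp only [hext, h, dif_neg, not_false_iff]; exact measurable_const
    have hind := (hS.indep_wait.indepFun_finset (Finset.range n) {n} (by simp)
      hS.measurable_wait).comp (hψm.comp hextm)
      (measurable_pi_apply (⟨n, Finset.mem_singleton_self n⟩ : ({n} : Finset ℕ)))
    set U : Ω → ℂ × ℝ := fun ω =>
      (∏ i ∈ Finset.range n, G (throwTime ξ i ω), ∑ i ∈ Finset.range n, ξ i ω) with hU
    have hUeq : (ψ ∘ ext) ∘ (fun ω (i : Finset.range n) => ξ i ω) = U := by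
      funext ω
      have he : ∀ l, l < n → ext (fun i : Finset.range n => ξ i ω) l = ξ l ω := by
        intro l hl; simp [hext, hl]
      simp only [Function.comp, hψ, hU]
      refine Prod.ext ?_ ?_
      · dsimp only
        refine Finset.prod_congr rfl fun i hi => ?_
        rw [throwTime]
        congr 1
        refine Finset.sum_congr rfl fun l hl => he l ?_
        have h1 := Finset.mem_range.1 hi
        have h2 := Finset.mem_range.1 hl
        omega
      · exact Finset.sum_congr rfl fun l hl => he l (Finset.mem_range.1 hl)
    rw [hUeq] at hind
    have hind' : IndepFun U (ξ n) μ := hind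
    have hUm : Measurable U := by
      refine Measurable.prodMk ?_ ?_
      · refine Finset.measurable_prod _ fun i _ => hG.comp ?_
        exact Finset.measurable_sum _ fun l _ => hS.measurable_wait l
      · exact Finset.measurable_sum _ fun l _ => hS.measurable_wait l
    set H : (ℂ × ℝ) × ℝ → ℂ := fun q => q.1.1 * (G (q.1.2 + q.2) * w (q.1.2 + q.2)) with hH
    have hHm : Measurable H := by
      have hadd : Measurable fun q : (ℂ × ℝ) × ℝ => q.1.2 + q.2 := by fun_prop
      exact (measurable_fst.comp measurable_fst).mul ((hG.comp hadd).mul (hw.comp hadd))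
    have hstep : ∀ ω, (∏ i ∈ Finset.range (n + 1), G (throwTime ξ i ω)) *
        w (∑ i ∈ Finset.range (n + 1), ξ i ω) = H (U ω, ξ n ω) := by
      intro ω
      simp only [hH, hU]
      rw [Finset.prod_range_succ, throwTime, Finset.sum_range_succ, mul_assoc]
    simp_rw [hstep]
    have hpair : Measurable fun ω => (U ω, ξ n ω) := hUm.prodMk (hS.measurable_wait n)
    rw [← integral_map (μ := μ) hpair.aemeasurable hHm.aestronglyMeasurable,
      (indepFun_iff_map_prod_eq_prod_map_map hUm.aemeasurable
        (hS.measurable_wait n).aemeasurable).1 hind', hS.law_wait n]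
    have : IsProbabilityMeasure (μ.map U) := Measure.isProbabilityMeasure_map hUm.aemeasurable
    have hU1 : ∀ᵐ u ∂(μ.map U), ‖u.1‖ ≤ C ^ n := by
      rw [ae_map_iff hUm.aemeasurable (measurableSet_le (by fun_prop) measurable_const)]
      refine ae_of_all _ fun ω => ?_
      simp only [hU]
      rw [norm_prod]
      calc _ ≤ ∏ i ∈ Finset.range n, C :=
            Finset.prod_le_prod (fun _ _ => norm_nonneg _) fun i _ => hGC _
        _ = C ^ n := by simp
    have hHint : Integrable H ((μ.map U).prod (expMeasure 1)) := by
      refine Integrable.of_bound hHm.aestronglyMeasurable (C ^ n * (C * 1)) ?_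
      have := Measure.quasiMeasurePreserving_fst (μ := μ.map U) (ν := expMeasure 1) |>.ae hU1
      filter_upwards [this] with q hq
      simp only [hH]
      rw [norm_mul, norm_mul]
      exact mul_le_mul hq (mul_le_mul (hGC _) (hwC _) (norm_nonneg _) hC0) (by positivity)
        (by positivity)
    rw [integral_prod _ hHint]
    simp only [hH]
    simp_rw [integral_const_mul, hfix]
    rw [integral_map (f := fun u : ℂ × ℝ => u.1 * w u.2) hUm.aemeasurable
      (measurable_fst.mul (hw.comp measurable_snd)).aestronglyMeasurable]
    exact ih

lemma integral_ballWeight_box (hS : IsPoissonizedScheme μ p ξ B) (hp : ∀ k, 0 ≤ p k)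
    (n : ℕ) (s : ℝ) :
    ∫ ω, ballWeight F τ z s (B n ω) ∂μ = meanWeight p F τ z s := by
  simp_rw [ballWeight_eq]
  have hset : ∀ k, MeasurableSet {ω | s ≤ τ k ∧ B n ω = k} := fun k =>
    (MeasurableSet.const _).inter (hS.measurable_box n (measurableSet_singleton k))
  have hfun : ∀ k, (fun ω => if s ≤ τ k ∧ B n ω = k then (1 : ℂ) else 0) =
      {ω | s ≤ τ k ∧ B n ω = k}.indicator fun _ => 1 := by
    intro k; funext ω; simp [Set.indicator]
  have hi : ∀ k, Integrable (fun ω => if s ≤ τ k ∧ B n ω = k then (1 : ℂ) else 0) μ := by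
    intro k; rw [hfun]; exact (integrable_const _).indicator (hset k)
  rw [integral_sub (integrable_const _) (integrable_finsetSum _ fun k _ => (hi k).const_mul _),
    integral_finsetSum _ fun k _ => (hi k).const_mul _]
  unfold meanWeight
  simp only [integral_const, probReal_univ, one_smul]
  congr 1
  refine Finset.sum_congr rfl fun k _ => ?_
  rw [integral_const_mul, hfun, integral_indicator_const _ (hset k)]
  congr 1
  by_cases h : s ≤ τ k
  · have : {ω | s ≤ τ k ∧ B n ω = k} = B n ⁻¹' {k} := by ext ω; simp [h]
    rw [this, Measure.real, hS.law_box, ENNReal.toReal_ofReal (hp k), if_pos h]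
    simp
  · have : {ω | s ≤ τ k ∧ B n ω = k} = ∅ := by ext ω; simp [h]
    rw [this, if_neg h]; simp

/-- With the throwing times frozen, the boxes are integrated out first and each ball weight becomes
its mean; the martingale in the waiting times does the rest. -/
lemma integral_prod_ballWeight (hS : IsPoissonizedScheme μ p ξ B) (hp : ∀ k, 0 ≤ p k)
    (hz : ∀ k, ‖z k‖ ≤ 1) (n : ℕ) :
    ∫ ω, (∏ i ∈ Finset.range n, ballWeight F τ z (throwTime ξ i ω) (B i ω)) *
      futureWeight p F τ z (∑ i ∈ Finset.range n, ξ i ω) ∂μ = futureWeight p F τ z 0 := by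
  have hX : Measurable fun ω (i : ℕ) => ξ i ω := measurable_pi_iff.2 hS.measurable_wait
  have hY : Measurable fun ω (i : ℕ) => B i ω := measurable_pi_iff.2 hS.measurable_box
  set H : (ℕ → ℝ) × (ℕ → ℕ) → ℂ := fun q =>
    (∏ i ∈ Finset.range n, ballWeight F τ z (∑ l ∈ Finset.range (i + 1), q.1 l) (q.2 i)) *
      futureWeight p F τ z (∑ i ∈ Finset.range n, q.1 i) with hH
  have hsum : ∀ m, Measurable fun v : ℕ → ℝ => ∑ l ∈ Finset.range m, v l := fun m =>
    Finset.measurable_sum _ fun l _ => measurable_pi_apply l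
  have hHm : Measurable H := by
    refine Measurable.mul (Finset.measurable_prod _ fun i _ => ?_)
      (continuous_futureWeight.measurable.comp ((hsum n).comp measurable_fst))
    exact measurable_ballWeight.comp (((hsum (i + 1)).comp measurable_fst).prodMk
      ((measurable_pi_apply i).comp measurable_snd))
  have hHb : ∀ q, ‖H q‖ ≤ 1 := by
    intro q
    rw [hH, norm_mul, norm_prod]
    exact mul_le_one₀ (Finset.prod_le_one (fun _ _ => norm_nonneg _) fun i _ =>
      norm_ballWeight_le hz _ _) (norm_nonneg _) (norm_futureWeight_le hp hz _)
  have : IsProbabilityMeasure (μ.map fun ω (i : ℕ) => ξ i ω) :=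
    Measure.isProbabilityMeasure_map hX.aemeasurable
  have : IsProbabilityMeasure (μ.map fun ω (i : ℕ) => B i ω) :=
    Measure.isProbabilityMeasure_map hY.aemeasurable
  have hlaw := (indepFun_iff_map_prod_eq_prod_map_map hX.aemeasurable hY.aemeasurable).1
    hS.indep_wait_box
  change ∫ ω, H ((fun i => ξ i ω), (fun i => B i ω)) ∂μ = _
  rw [← integral_map (μ := μ) (hX.prodMk hY).aemeasurable hHm.aestronglyMeasurable, hlaw,
    integral_prod _ (Integrable.of_bound hHm.aestronglyMeasurable 1 (ae_of_all _ hHb))]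
  have hinner : ∀ x : ℕ → ℝ, ∫ y, H (x, y) ∂(μ.map fun ω (i : ℕ) => B i ω) =
      (∏ i ∈ Finset.range n, meanWeight p F τ z (∑ l ∈ Finset.range (i + 1), x l)) *
      futureWeight p F τ z (∑ i ∈ Finset.range n, x i) := by
    intro x
    rw [integral_map hY.aemeasurable
      (hHm.of_uncurry_left (f := fun x y => H (x, y))).aestronglyMeasurable]
    simp only [hH]
    rw [integral_mul_const]
    congr 1
    have hB : iIndepFun (fun i : Fin n => B i) μ := hS.indep_box.precomp Fin.val_injective
    have := iIndepFun.integral_fun_prod_comp (𝕜 := ℂ) (ι := Fin n) (X := fun i : Fin n => B i)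
      (f := fun i b => ballWeight F τ z (∑ l ∈ Finset.range ((i : ℕ) + 1), x l) b) hB
      (fun i => (hS.measurable_box i).aemeasurable)
      (fun i => (measurable_of_countable _).aestronglyMeasurable)
    simp_rw [Finset.prod_range]
    rw [this]
    exact Finset.prod_congr rfl fun i _ => integral_ballWeight_box hS hp i _
  simp_rw [hinner]
  rw [integral_map hX.aemeasurable]
  · exact integral_wait_step hS measurable_meanWeight continuous_futureWeight.measurable
      (norm_meanWeight_le hp hz) (norm_futureWeight_le hp hz)
      (integral_meanWeight_mul_futureWeight hp hz) n
  · refine Measurable.aestronglyMeasurable ?_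
    exact (Finset.measurable_prod _ fun i _ => measurable_meanWeight.comp (hsum (i + 1))).mul
      (continuous_futureWeight.measurable.comp (hsum n))

end Thinning

/-! ### Independence of the boxes -/

/-- The set of outcomes for which ball `n` hits box `k` before time `t`. -/
def hitEvent {Ω : Type*} (ξ : ℕ → Ω → ℝ) (B : ℕ → Ω → ℕ) (t : ℝ) (k n : ℕ) : Set Ω :=
  {ω | throwTime ξ n ω ≤ t ∧ B n ω = k}

/-- The set of outcomes for which box `k` contains at least `j` balls at time `t`. -/
def fullEvent {Ω : Type*} (ξ : ℕ → Ω → ℝ) (B : ℕ → Ω → ℕ) (j k : ℕ) (t : ℝ) : Set Ω :=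
  {ω | (j : ℕ∞) ≤ ballsInBox ξ B t k ω}

section Deterministic

variable {Ω : Type*} {ξ : ℕ → Ω → ℝ} {B : ℕ → Ω → ℕ}

lemma finite_throwTime_le {ω : Ω}
    (h : Tendsto (fun n => ∑ i ∈ Finset.range n, ξ i ω) atTop atTop) (t : ℝ) :
    {n | throwTime ξ n ω ≤ t}.Finite := by
  have h1 := ((tendsto_add_atTop_iff_nat 1).2 h).eventually_gt_atTop t
  rw [← Nat.cofinite_eq_atTop, eventually_cofinite] at h1
  refine h1.subset fun n hn => ?_
  have hn : throwTime ξ n ω ≤ t := hn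
  exact not_lt.2 hn

lemma fullEvent_mono (j k : ℕ) {s t : ℝ} (hst : s ≤ t) :
    fullEvent ξ B j k s ⊆ fullEvent ξ B j k t := by
  intro ω hω
  have hω : (j : ℕ∞) ≤ ballsInBox ξ B s k ω := hω
  refine hω.trans (Set.encard_le_encard fun n hn => ⟨hn.1.trans hst, hn.2⟩)

end Deterministic

section Boxes

variable {Ω : Type*} [MeasurableSpace Ω] {μ : Measure Ω} {p : ℕ → ℝ}
  {ξ : ℕ → Ω → ℝ} {B : ℕ → Ω → ℕ}

lemma ae_wait_nonneg (hS : IsPoissonizedScheme μ p ξ B) : ∀ᵐ ω ∂μ, ∀ n, 0 ≤ ξ n ω := by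
  rw [ae_all_iff]
  intro n
  have : ∀ᵐ x ∂(expMeasure 1), 0 ≤ x := by
    rw [expMeasure, gammaMeasure]
    rw [ae_withDensity_iff (by unfold gammaPDF; exact (measurable_gammaPDFReal 1 1).ennreal_ofReal)]
    refine ae_of_all _ fun x hx => ?_
    by_contra h
    apply hx
    simp [gammaPDF, gammaPDFReal, h]
  rw [← hS.law_wait n] at this
  exact ae_of_ae_map (hS.measurable_wait n).aemeasurable this

lemma measurable_throwTime (hS : IsPoissonizedScheme μ p ξ B) (n : ℕ) :
    Measurable (throwTime ξ n) := by
  unfold throwTime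
  exact Finset.measurable_sum _ fun i _ => hS.measurable_wait i

lemma measurableSet_hitEvent (hS : IsPoissonizedScheme μ p ξ B) (t : ℝ) (k n : ℕ) :
    MeasurableSet (hitEvent ξ B t k n) :=
  (measurableSet_le (measurable_throwTime hS n) measurable_const).inter
    (hS.measurable_box n (measurableSet_singleton k))

/-- At least `j` balls are present exactly when some set of `j` ball labels has all its members
present; there are countably many such sets. -/
lemma measurableSet_fullEvent (hS : IsPoissonizedScheme μ p ξ B) (j k : ℕ) (t : ℝ) :
    MeasurableSet (fullEvent ξ B j k t) := by
  have : fullEvent ξ B j k t =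
      ⋃ s ∈ {s : Finset ℕ | s.card = j}, ⋂ n ∈ s, hitEvent ξ B t k n := by
    ext ω
    simp only [fullEvent, ballsInBox, Set.mem_iUnion, Set.mem_iInter]
    constructor
    · intro h
      obtain ⟨s, hs1, hs2⟩ := Set.exists_subset_encard_eq h
      have hfin : s.Finite := Set.finite_of_encard_eq_coe hs2
      refine ⟨hfin.toFinset, ?_, fun n hn => hs1 (hfin.mem_toFinset.1 hn)⟩
      have : (hfin.toFinset.card : ℕ∞) = j := by
        rw [← hs2, hfin.encard_eq_coe_toFinset_card]
      exact_mod_cast this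
    · rintro ⟨s, hs, h⟩
      have h1 : ((s : Set ℕ)).encard = j := by
        rw [Set.encard_coe_eq_coe_finsetCard]
        have hs : s.card = j := hs
        rw [hs]
      have h2 : (s : Set ℕ) ⊆ {n : ℕ | throwTime ξ n ω ≤ t ∧ B n ω = k} := fun n hn => h n hn
      have := Set.encard_le_encard h2
      rw [h1] at this
      exact this
  rw [this]
  refine MeasurableSet.biUnion (Set.to_countable _) fun s _ => ?_
  exact MeasurableSet.biInter (Set.to_countable _) fun n _ => measurableSet_hitEvent hS t k n

variable [IsProbabilityMeasure μ]

/-- By the second Borel–Cantelli lemma infinitely many waiting times exceed `1`, so the nonnegative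
series cannot converge. -/
lemma ae_tendsto_sum_wait (hS : IsPoissonizedScheme μ p ξ B) :
    ∀ᵐ ω ∂μ, Tendsto (fun n => ∑ i ∈ Finset.range n, ξ i ω) atTop atTop := by
  set s : ℕ → Set Ω := fun n => ξ n ⁻¹' Set.Ioi 1 with hs
  have hsm : ∀ n, MeasurableSet (s n) := fun n => hS.measurable_wait n measurableSet_Ioi
  have hind : iIndepSet s μ := by
    rw [iIndepSet_iff_meas_biInter hsm]
    intro S
    exact hS.indep_wait.meas_biInter fun i _ => ⟨_, measurableSet_Ioi, rfl⟩
  have : IsProbabilityMeasure (expMeasure 1) := isProbabilityMeasure_expMeasure one_pos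
  have hval : ∀ n, μ (s n) = ENNReal.ofReal (Real.exp (-1)) := by
    intro n
    rw [hs, ← Measure.map_apply (hS.measurable_wait n) measurableSet_Ioi, hS.law_wait]
    have h1 := cdf_expMeasure_eq one_pos (1 : ℝ)
    rw [cdf_eq_real, if_pos zero_le_one, mul_one] at h1
    have h2 := probReal_compl_eq_one_sub (μ := expMeasure 1) (measurableSet_Iic (a := (1 : ℝ)))
    rw [Set.compl_Iic, h1, sub_sub_cancel] at h2
    rw [← h2, ofReal_measureReal]
  have hsum : ∑' n, μ (s n) = ⊤ := by
    simp_rw [hval]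
    exact ENNReal.tsum_const_eq_top_of_ne_zero (by simp [Real.exp_pos])
  have hlim := measure_limsup_eq_one hsm hind hsum
  have hfreq : ∀ᵐ ω ∂μ, ∃ᶠ n in atTop, ω ∈ s n := by
    have h : ∀ᵐ ω ∂μ, ω ∈ limsup s atTop := by
      exact (mem_ae_iff_prob_eq_one (MeasurableSet.measurableSet_limsup hsm)).2 hlim
    filter_upwards [h] with ω hω
    rwa [mem_limsup_iff_frequently_mem] at hω
  filter_upwards [hfreq, ae_wait_nonneg hS] with ω h1 h2
  rw [← not_summable_iff_tendsto_nat_atTop_of_nonneg h2]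
  intro hsumm
  have := hsumm.tendsto_atTop_zero.eventually (gt_mem_nhds one_pos)
  exact h1 (this.mono fun n hn hmem => lt_asymm hn hmem)

/-- This holds only almost surely: `ncard` is `0` on an infinite set, so finitely many throws by
time `t` are needed to match it with `encard`. -/
lemma ae_mem_fullEvent_iff (hS : IsPoissonizedScheme μ p ξ B) :
    ∀ᵐ ω ∂μ, ∀ j k t, ω ∈ fullEvent ξ B j k t ↔ (j : ℝ) ≤ eventCount (hitEvent ξ B t k) ω := by
  filter_upwards [ae_tendsto_sum_wait hS] with ω hω j k t
  have hfin : {n : ℕ | throwTime ξ n ω ≤ t ∧ B n ω = k}.Finite :=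
    (finite_throwTime_le hω t).subset fun n hn => hn.1
  change (j : ℕ∞) ≤ {n : ℕ | throwTime ξ n ω ≤ t ∧ B n ω = k}.encard ↔
    (j : ℝ) ≤ ({n : ℕ | throwTime ξ n ω ≤ t ∧ B n ω = k}.ncard : ℝ)
  rw [← hfin.cast_ncard_eq]
  norm_cast

lemma aemeasurable_eventCount_hitEvent (hS : IsPoissonizedScheme μ p ξ B) (t : ℝ) (k : ℕ) :
    AEMeasurable (eventCount (hitEvent ξ B t k)) μ := by
  refine aemeasurable_of_tendsto_metrizable_ae atTop
    (fun n => (measurable_partialCount (measurableSet_hitEvent hS t k) n).aemeasurable) ?_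
  filter_upwards [ae_tendsto_sum_wait hS] with ω hω
  have hfin : {n : ℕ | ω ∈ hitEvent ξ B t k n}.Finite :=
    (finite_throwTime_le hω t).subset fun n hn => hn.1
  exact tendsto_const_nhds.congr' ((eventually_partialCount_eq hfin).mono fun n hn => hn.symm)

/-- The joint generating function of the contents of finitely many boxes at various times. -/
theorem integral_prod_pow_boxCount (hS : IsPoissonizedScheme μ p ξ B) (hp : ∀ k, 0 ≤ p k)
    (F : Finset ℕ) (τ : ℕ → ℝ) {z : ℕ → ℂ} (hz : ∀ k, ‖z k‖ ≤ 1) :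
    ∫ ω, ∏ k ∈ F, z k ^ {n | ω ∈ hitEvent ξ B (τ k) k n}.ncard ∂μ =
      ∏ k ∈ F, Complex.exp ((p k * max (τ k) 0 : ℝ) * (z k - 1)) := by
  have h0 := futureWeight_eq_prod (p := p) (F := F) (τ := τ) (z := z) 0
  simp only [sub_zero] at h0
  rw [← h0]
  have hmeas : ∀ n, Measurable fun ω =>
      (∏ i ∈ Finset.range n, ballWeight F τ z (throwTime ξ i ω) (B i ω)) *
      futureWeight p F τ z (∑ i ∈ Finset.range n, ξ i ω) := fun n =>
    (Finset.measurable_prod _ fun i _ => measurable_ballWeight.comp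
      ((measurable_throwTime hS i).prodMk (hS.measurable_box i))).mul
      (continuous_futureWeight.measurable.comp
        (Finset.measurable_sum _ fun i _ => hS.measurable_wait i))
  -- The expectation is the same for every `n`. Once the throwing time has passed all `τ k`, the
  -- future weight is `1` and the product of ball weights has become the product of the powers `z
  -- k`.
  have hlim : Tendsto (fun n => ∫ ω,
      (∏ i ∈ Finset.range n, ballWeight F τ z (throwTime ξ i ω) (B i ω)) *
      futureWeight p F τ z (∑ i ∈ Finset.range n, ξ i ω) ∂μ) atTop
      (𝓝 (∫ ω, ∏ k ∈ F, z k ^ {n | ω ∈ hitEvent ξ B (τ k) k n}.ncard ∂μ)) := by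
    refine tendsto_integral_of_dominated_convergence (fun _ => 1)
      (fun n => (hmeas n).aestronglyMeasurable) (integrable_const _)
      (fun n => ae_of_all _ fun ω => ?_) ?_
    · rw [norm_mul, norm_prod]
      exact mul_le_one₀ (Finset.prod_le_one (fun _ _ => norm_nonneg _) fun i _ =>
        norm_ballWeight_le hz _ _) (norm_nonneg _) (norm_futureWeight_le hp hz _)
    · filter_upwards [ae_tendsto_sum_wait hS] with ω hω
      refine tendsto_const_nhds.congr' ?_
      have hfin : ∀ k, {n : ℕ | ω ∈ hitEvent ξ B (τ k) k n}.Finite := fun k =>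
        (finite_throwTime_le hω (τ k)).subset fun n hn => hn.1
      have e1 : ∀ᶠ n in atTop, ∀ k ∈ F,
          partialCount (hitEvent ξ B (τ k) k) n ω = eventCount (hitEvent ξ B (τ k) k) ω := by
        rw [eventually_all_finset]
        exact fun k _ => eventually_partialCount_eq (hfin k)
      have e2 : ∀ᶠ n in atTop, ∀ k ∈ F, τ k ≤ ∑ i ∈ Finset.range n, ξ i ω := by
        rw [eventually_all_finset]
        exact fun k _ => hω.eventually_ge_atTop (τ k)
      filter_upwards [e1, e2] with n h1 h2
      rw [futureWeight_eq_one h2, mul_one]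
      unfold ballWeight
      rw [Finset.prod_comm]
      refine Finset.prod_congr rfl fun k hk => ?_
      have h3 := h1 k hk
      classical
      rw [Finset.prod_ite, Finset.prod_const, Finset.prod_const_one, mul_one]
      congr 1
      have h4 : partialCount (hitEvent ξ B (τ k) k) n ω = (((Finset.range n).filter
          fun i => throwTime ξ i ω ≤ τ k ∧ B i ω = k).card : ℝ) := by
        rw [partialCount, Finset.card_filter]
        push_cast
        refine Finset.sum_congr rfl fun i _ => ?_
        simp only [Set.indicator, hitEvent, Set.mem_ofPred_eq]
        congr
      rw [h4, eventCount] at h3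
      exact_mod_cast h3.symm
  simp_rw [integral_prod_ballWeight hS hp hz] at hlim
  exact tendsto_nhds_unique hlim tendsto_const_nhds

lemma cexp_mul_ncard (θ : ℝ) (n : ℕ) :
    Complex.exp ((((n : ℝ) * θ : ℝ) : ℂ) * Complex.I) = Complex.exp (θ * Complex.I) ^ n := by
  rw [← Complex.exp_nat_mul]; push_cast; ring_nf

lemma charFun_boxCount (hS : IsPoissonizedScheme μ p ξ B) (hp : ∀ k, 0 ≤ p k) (k : ℕ) (t θ : ℝ) :
    charFun (μ.map (eventCount (hitEvent ξ B t k))) θ =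
      Complex.exp ((p k * max t 0 : ℝ) * (Complex.exp (θ * Complex.I) - 1)) := by
  have h := integral_prod_pow_boxCount hS hp {k} (fun _ => t)
    (z := fun _ => Complex.exp (θ * Complex.I)) (fun _ => by rw [Complex.norm_exp_ofReal_mul_I])
  simp only [Finset.prod_singleton] at h
  rw [← h, charFun_apply, integral_map (aemeasurable_eventCount_hitEvent hS t k) (by fun_prop)]
  refine integral_congr_ae (ae_of_all _ fun ω => ?_)
  simp only [eventCount]
  rw [← cexp_mul_ncard, Real.inner_apply]

theorem map_boxCount (hS : IsPoissonizedScheme μ p ξ B) (hp : ∀ k, 0 ≤ p k) (k : ℕ) (t : ℝ) :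
    μ.map (eventCount (hitEvent ξ B t k)) =
      (poissonMeasure (Real.toNNReal (p k * max t 0))).map (fun n : ℕ => (n : ℝ)) := by
  have := Measure.isProbabilityMeasure_map (aemeasurable_eventCount_hitEvent hS t k)
  refine Measure.ext_of_charFun ?_
  funext θ
  rw [charFun_boxCount hS hp, charFun_map_cast_poissonMeasure, Real.coe_toNNReal]
  exact mul_nonneg (hp k) (le_max_right _ _)

/-- The joint characteristic function, which is the generating function at points of the unit
circle, factorises. The times `τ k` may differ from box to box, which is what yields independence of
whole box histories. -/
theorem iIndepFun_boxCount (hS : IsPoissonizedScheme μ p ξ B) (hp : ∀ k, 0 ≤ p k)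
    (F : Finset ℕ) (τ : ℕ → ℝ) :
    iIndepFun (fun k : F => eventCount (hitEvent ξ B (τ k) k)) μ := by
  rw [iIndepFun_iff_charFun_pi fun k => aemeasurable_eventCount_hitEvent hS _ _]
  intro θ
  simp_rw [charFun_boxCount hS hp]
  set θ' : ℕ → ℝ := fun k => if h : k ∈ F then θ ⟨k, h⟩ else 0 with hθ'
  have hθ : ∀ k : F, θ' k = θ k := fun k => by simp [hθ']
  have h := integral_prod_pow_boxCount hS hp F τ
    (z := fun k => Complex.exp (θ' k * Complex.I)) (fun _ => by rw [Complex.norm_exp_ofReal_mul_I])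
  rw [← Finset.prod_coe_sort F] at h
  have hl : ∀ ω, ∏ k ∈ F, Complex.exp (θ' k * Complex.I) ^
      {n | ω ∈ hitEvent ξ B (τ k) k n}.ncard = ∏ k : F, Complex.exp (θ k * Complex.I) ^
      {n | ω ∈ hitEvent ξ B (τ k) k n}.ncard := by
    intro ω
    rw [← Finset.prod_coe_sort F]
    simp_rw [hθ]
  simp_rw [hl, hθ] at h
  rw [← h, charFun_apply, integral_map]
  · refine integral_congr_ae (ae_of_all _ fun ω => ?_)
    simp only [PiLp.inner_apply, Real.inner_apply]
    rw [Complex.ofReal_sum, Finset.sum_mul, Complex.exp_sum]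
    refine Finset.prod_congr rfl fun k _ => ?_
    rw [← cexp_mul_ncard]; rfl
  · have : AEMeasurable (fun ω (k : F) => eventCount (hitEvent ξ B (τ k) k) ω) μ :=
      aemeasurable_pi_lambda _ fun k => aemeasurable_eventCount_hitEvent hS _ _
    exact (WithLp.measurable_toLp 2 _).comp_aemeasurable this
  · fun_prop

lemma poissonMeasure_real_Ici (r : NNReal) (j : ℕ) :
    ((poissonMeasure r).map (fun n : ℕ => (n : ℝ))).real (Set.Ici (j : ℝ)) =
      poissonTail j r := by
  have hpre : (fun n : ℕ => (n : ℝ)) ⁻¹' (Set.Ici (j : ℝ)) =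
      ((Finset.range j : Finset ℕ) : Set ℕ)ᶜ := by
    ext n; simp
  rw [map_measureReal_apply (by fun_prop) measurableSet_Ici, hpre,
    probReal_compl_eq_one_sub (Finset.measurableSet _), ← sum_measureReal_singleton]
  simp_rw [poissonMeasure_real_singleton]
  rw [poissonTail, Finset.mul_sum]
  simp only [mul_div_assoc]

theorem measureReal_fullEvent (hS : IsPoissonizedScheme μ p ξ B) (hp : ∀ k, 0 ≤ p k)
    (j k : ℕ) (t : ℝ) : μ.real (fullEvent ξ B j k t) = poissonTail j (p k * max t 0) := by
  have h1 : fullEvent ξ B j k t =ᵐ[μ] eventCount (hitEvent ξ B t k) ⁻¹' (Set.Ici (j : ℝ)) := by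
    rw [eventuallyEq_set]
    filter_upwards [ae_mem_fullEvent_iff hS] with ω hω using hω j k t
  rw [measureReal_congr h1, ← map_measureReal_apply_of_aemeasurable
    (aemeasurable_eventCount_hitEvent hS t k) measurableSet_Ici, map_boxCount hS hp,
    poissonMeasure_real_Ici, Real.coe_toNNReal _ (mul_nonneg (hp k) (le_max_right _ _))]

/-- For a fixed box the events increase with time, so they form a π-system, and independence at
arbitrary times passes to the generated σ-algebras. -/
theorem iIndep_fullEvent (hS : IsPoissonizedScheme μ p ξ B) (hp : ∀ k, 0 ≤ p k) (j : ℕ) :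
    iIndep (fun k => MeasurableSpace.generateFrom (Set.range (fullEvent ξ B j k))) μ := by
  refine iIndepSets.iIndep (π := fun k => Set.range (fullEvent ξ B j k))
    (fun k => MeasurableSpace.generateFrom_le ?_) (fun k => ?_) (fun k => rfl) ?_
  · rintro _ ⟨t, rfl⟩; exact measurableSet_fullEvent hS j k t
  · rintro _ ⟨s, rfl⟩ _ ⟨t, rfl⟩ -
    rcases le_total s t with h | h
    · exact ⟨s, (Set.inter_eq_left.2 (fullEvent_mono j k h)).symm⟩
    · exact ⟨t, (Set.inter_eq_right.2 (fullEvent_mono j k h)).symm⟩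
  · rw [iIndepSets_iff]
    intro F f hf
    choose! τ hτ using hf
    have h1 : ∀ k ∈ F, f k =ᵐ[μ] eventCount (hitEvent ξ B (τ k) k) ⁻¹' (Set.Ici (j : ℝ)) := by
      intro k hk
      rw [← hτ k hk, eventuallyEq_set]
      filter_upwards [ae_mem_fullEvent_iff hS] with ω hω using hω j k (τ k)
    have h2 : (⋂ k ∈ F, f k) =ᵐ[μ]
        ⋂ k : F, eventCount (hitEvent ξ B (τ k) k) ⁻¹' (Set.Ici (j : ℝ)) := by
      have h3 : (⋂ k ∈ F, f k) = ⋂ k : F, f k := by ext ω; simp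
      rw [h3]
      exact Filter.EventuallyEq.countable_iInter fun k => h1 k k.2
    rw [measure_congr h2]
    have h4 := (iIndepFun_boxCount hS hp F τ).meas_iInter
      (s := fun k : F => eventCount (hitEvent ξ B (τ k) k) ⁻¹' (Set.Ici (j : ℝ)))
      (fun k => ⟨_, measurableSet_Ici, rfl⟩)
    rw [h4, ← Finset.prod_coe_sort F]
    exact Finset.prod_congr rfl fun k _ => (measure_congr (h1 k k.2)).symm

end Boxes

/-! ### Families of increasing independent events -/

/-- `E k t` is the event that box `k` contains more than `m` balls at time `t`. -/
structure IsOccupancyFamily {Ω : Type*} [MeasurableSpace Ω] (μ : Measure Ω) (p : ℕ → ℝ) (m : ℕ)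
    (E : ℕ → ℝ → Set Ω) : Prop where
  measurableSet : ∀ k t, MeasurableSet (E k t)
  mono : ∀ k s t, s ≤ t → E k s ⊆ E k t
  iIndep : iIndep (fun k => MeasurableSpace.generateFrom (Set.range (E k))) μ
  measureReal : ∀ k t, 0 ≤ t → μ.real (E k t) = poissonTail (m + 1) (p k * t)

/-- The number of events of a family which have occurred at time `t`. -/
def occCount {Ω : Type*} (E : ℕ → ℝ → Set Ω) (t : ℝ) (ω : Ω) : ℝ := eventCount (fun k => E k t) ω

/-- The mean of `occCount`. -/
def occMean {Ω : Type*} [MeasurableSpace Ω] (μ : Measure Ω) (E : ℕ → ℝ → Set Ω) (t : ℝ) : ℝ :=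
  ∫ ω, occCount E t ω ∂μ

/-- The centred variable `occCount`. -/
def occDev {Ω : Type*} [MeasurableSpace Ω] (μ : Measure Ω) (E : ℕ → ℝ → Set Ω) (t : ℝ)
    (ω : Ω) : ℝ :=
  occCount E t ω - occMean μ E t

namespace IsOccupancyFamily

lemma measurableSet_generateFrom {Ω : Type*} {E : ℕ → ℝ → Set Ω} (k : ℕ) (t : ℝ) :
    MeasurableSet[MeasurableSpace.generateFrom (Set.range (E k))] (E k t) :=
  MeasurableSpace.measurableSet_generateFrom ⟨t, rfl⟩

variable {Ω : Type*} [MeasurableSpace Ω] {μ : Measure Ω} {p : ℕ → ℝ} {m : ℕ}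
  {E : ℕ → ℝ → Set Ω}

lemma generateFrom_le (h : IsOccupancyFamily μ p m E) (k : ℕ) :
    MeasurableSpace.generateFrom (Set.range (E k)) ≤ ‹MeasurableSpace Ω› := by
  refine MeasurableSpace.generateFrom_le ?_
  rintro _ ⟨t, rfl⟩; exact h.measurableSet k t

lemma occMean_nonneg (t : ℝ) : 0 ≤ occMean μ E t :=
  integral_nonneg fun ω => by unfold occCount eventCount; positivity

/-- Increments are themselves counts of independent events, so all bounds for `eventCount` apply to
them. -/
lemma eventCount_diff (h : IsOccupancyFamily μ p m E) {ω : Ω} (hω : ∀ t, {k | ω ∈ E k t}.Finite)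
    {s u : ℝ} (hsu : s ≤ u) :
    eventCount (fun k => E k u \ E k s) ω = occCount E u ω - occCount E s ω := by
  have hsub : {k | ω ∈ E k s} ⊆ {k | ω ∈ E k u} := fun k hk => h.mono k s u hsu hk
  have h1 := Set.ncard_sdiff_add_ncard_of_subset hsub (hω u)
  unfold occCount eventCount
  rw [← h1]
  push_cast
  rw [add_sub_cancel_right]
  rfl

lemma iIndepSet_of_measurableSet (h : IsOccupancyFamily μ p m E) {A : ℕ → Set Ω}
    (hA : ∀ k, MeasurableSet[MeasurableSpace.generateFrom (Set.range (E k))] (A k)) :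
    iIndepSet A μ := by
  rw [iIndepSet_iff_meas_biInter fun k => h.generateFrom_le k _ (hA k)]
  intro S
  exact h.iIndep.meas_biInter fun k _ => hA k

lemma iIndepSet_events (h : IsOccupancyFamily μ p m E) (t : ℝ) :
    iIndepSet (fun k => E k t) μ :=
  h.iIndepSet_of_measurableSet fun k => measurableSet_generateFrom k t

lemma iIndepSet_diff (h : IsOccupancyFamily μ p m E) (s u : ℝ) :
    iIndepSet (fun k => E k u \ E k s) μ :=
  h.iIndepSet_of_measurableSet fun k =>
    (measurableSet_generateFrom k u).diff (measurableSet_generateFrom k s)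

variable [IsProbabilityMeasure μ]

lemma summable_events (h : IsOccupancyFamily μ p m E) (hp : IsBoxDistribution p) (t : ℝ) :
    Summable fun k => μ.real (E k t) := by
  refine (hp.hasSum_one.summable.mul_right |t|).of_nonneg_of_le (fun k => measureReal_nonneg)
    fun k => ?_
  calc μ.real (E k t) ≤ μ.real (E k |t|) := measureReal_mono (h.mono k t _ (le_abs_self t))
    _ = poissonTail (m + 1) (p k * |t|) := h.measureReal k _ (abs_nonneg t)
    _ ≤ p k * |t| := poissonTail_le_self m (mul_nonneg (hp.nonneg k) (abs_nonneg t))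

lemma summable_diff (h : IsOccupancyFamily μ p m E) (hp : IsBoxDistribution p) (s u : ℝ) :
    Summable fun k => μ.real (E k u \ E k s) :=
  (h.summable_events hp u).of_nonneg_of_le (fun k => measureReal_nonneg)
    fun k => measureReal_mono Set.sdiff_subset

lemma ae_finite (h : IsOccupancyFamily μ p m E) (hp : IsBoxDistribution p) :
    ∀ᵐ ω ∂μ, ∀ t, {k | ω ∈ E k t}.Finite := by
  have h1 : ∀ᵐ ω ∂μ, ∀ n : ℕ, {k | ω ∈ E k n}.Finite :=
    ae_all_iff.2 fun n => ae_finite_events (h.summable_events hp n)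
  filter_upwards [h1] with ω hω t
  obtain ⟨n, hn⟩ := exists_nat_ge t
  exact (hω n).subset fun k hk => h.mono k t n hn hk

lemma memLp (h : IsOccupancyFamily μ p m E) (hp : IsBoxDistribution p) (t : ℝ) :
    MemLp (occCount E t) 2 μ :=
  memLp_eventCount (fun k => h.measurableSet k t) (h.iIndepSet_events t) (h.summable_events hp t)

lemma occMean_eq (h : IsOccupancyFamily μ p m E) (hp : IsBoxDistribution p) (t : ℝ) :
    occMean μ E t = ∑' k, μ.real (E k t) :=
  integral_eventCount (fun k => h.measurableSet k t) (h.iIndepSet_events t) (h.summable_events hp t)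

lemma occMean_eq_tsum (h : IsOccupancyFamily μ p m E) (hp : IsBoxDistribution p) {t : ℝ}
    (ht : 0 ≤ t) : occMean μ E t = ∑' k, poissonTail (m + 1) (p k * t) := by
  rw [h.occMean_eq hp]; simp_rw [h.measureReal _ t ht]

lemma variance_eq_tsum (h : IsOccupancyFamily μ p m E) (hp : IsBoxDistribution p) {t : ℝ}
    (ht : 0 ≤ t) : Var[occCount E t; μ] =
      ∑' k, poissonTail (m + 1) (p k * t) * (1 - poissonTail (m + 1) (p k * t)) := by
  have := variance_eventCount (fun k => h.measurableSet k t) (h.iIndepSet_events t)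
    (h.summable_events hp t)
  simp_rw [h.measureReal _ t ht] at this
  exact this

lemma occMean_mono (h : IsOccupancyFamily μ p m E) (hp : IsBoxDistribution p) {s t : ℝ}
    (hst : s ≤ t) : occMean μ E s ≤ occMean μ E t := by
  rw [h.occMean_eq hp, h.occMean_eq hp]
  exact (h.summable_events hp s).tsum_le_tsum (fun k => measureReal_mono (h.mono k s t hst))
    (h.summable_events hp t)

lemma occMean_mul_le (h : IsOccupancyFamily μ p m E) (hp : IsBoxDistribution p) {c t : ℝ}
    (hc : 1 ≤ c) (ht : 0 ≤ t) : occMean μ E (c * t) ≤ c ^ (m + 1) * occMean μ E t := by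
  have hct : 0 ≤ c * t := mul_nonneg (by linarith) ht
  have h1 := h.summable_events hp (c * t)
  have h2 := h.summable_events hp t
  simp_rw [h.measureReal _ _ hct] at h1
  simp_rw [h.measureReal _ _ ht] at h2
  rw [h.occMean_eq_tsum hp hct, h.occMean_eq_tsum hp ht, ← tsum_mul_left]
  refine h1.tsum_le_tsum (fun k => ?_) (h2.mul_left _)
  have := poissonTail_mul_le m hc (mul_nonneg (hp.nonneg k) ht)
  rwa [show c * (p k * t) = p k * (c * t) by ring] at this

lemma integral_eventCount_diff (h : IsOccupancyFamily μ p m E) (hp : IsBoxDistribution p) {s u : ℝ}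
    (hsu : s ≤ u) :
    ∫ ω, eventCount (fun k => E k u \ E k s) ω ∂μ = occMean μ E u - occMean μ E s := by
  have h1 : ∫ ω, eventCount (fun k => E k u \ E k s) ω ∂μ =
      ∫ ω, (occCount E u ω - occCount E s ω) ∂μ := by
    refine integral_congr_ae ?_
    filter_upwards [h.ae_finite hp] with ω hω using h.eventCount_diff hω hsu
  rw [h1, integral_sub ((h.memLp hp u).integrable one_le_two)
    ((h.memLp hp s).integrable one_le_two)]
  rfl

/-- Upper tail of the increments of the centred process. -/
lemma increment_upper_tail (h : IsOccupancyFamily μ p m E) (hp : IsBoxDistribution p) {s u : ℝ}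
    (hsu : s ≤ u) {θ a : ℝ} (hθ0 : 0 ≤ θ) (hθ1 : θ ≤ 1) (ha : occMean μ E u - occMean μ E s ≤ a)
    (x : ℝ) :
    μ.real {ω | x ≤ occDev μ E u ω - occDev μ E s ω} ≤ Real.exp (-θ * x + θ ^ 2 * a) := by
  have hm : ∀ k, MeasurableSet (E k u \ E k s) := fun k =>
    (h.measurableSet k u).diff (h.measurableSet k s)
  have hmean := h.integral_eventCount_diff hp hsu
  have ha0 : 0 ≤ a := le_trans (by linarith [h.occMean_mono hp hsu]) ha
  -- For a sum of independent indicators the variance is at most the mean.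
  have hV : Var[eventCount (fun k => E k u \ E k s); μ] ≤ a := by
    rw [variance_eventCount hm (h.iIndepSet_diff s u) (h.summable_diff hp s u)]
    refine le_trans ?_ ha
    rw [← hmean, integral_eventCount hm (h.iIndepSet_diff s u) (h.summable_diff hp s u)]
    refine (summable_mul_one_sub (h.summable_diff hp s u)).tsum_le_tsum (fun k => ?_)
      (h.summable_diff hp s u)
    exact mul_le_of_le_one_right measureReal_nonneg
      (by linarith [measureReal_nonneg (μ := μ) (s := E k u \ E k s)])
  have h1 := eventCount_upper_tail hm (h.iIndepSet_diff s u) (h.summable_diff hp s u) hθ0 hθ1 hV x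
  rw [hmean] at h1
  have h2 : ({ω | x ≤ occDev μ E u ω - occDev μ E s ω} : Set Ω) =ᵐ[μ]
      {ω | x ≤ eventCount (fun k => E k u \ E k s) ω - (occMean μ E u - occMean μ E s)} := by
    rw [eventuallyEq_set]
    filter_upwards [h.ae_finite hp] with ω hω
    rw [h.eventCount_diff hω hsu, occDev, occDev]
    constructor <;> intro h <;> linarith
  rw [measureReal_congr h2]
  refine h1.trans (Real.exp_le_exp.2 ?_)
  have : θ ^ 2 * a / 2 * (1 + θ) ≤ θ ^ 2 * a / 2 * 2 :=
    mul_le_mul_of_nonneg_left (by linarith) (by positivity)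
  linarith

/-- Since `s ≤ r`, the later time is at most `(1 + x) * r`, so the scaling bound for the mean
applies; `(1 + x) ^ n ≤ 1 + x * (2 ^ n - 1)` for `x` in `[0, 1]` makes it linear in `x`. -/
lemma occMean_increment_le (h : IsOccupancyFamily μ p m E) (hp : IsBoxDistribution p) {s x r : ℝ}
    (hs : 0 ≤ s) (hx0 : 0 ≤ x) (hx1 : x ≤ 1) (hr : s ≤ r) (hr2 : r ≤ 2 * s) :
    occMean μ E (r + s * x) - occMean μ E r ≤ x * (2 ^ (m + 1) * occMean μ E (2 * s)) := by
  have hr0 : 0 ≤ r := hs.trans hr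
  have h1 : occMean μ E (r + s * x) ≤ occMean μ E ((1 + x) * r) := by
    apply h.occMean_mono hp
    nlinarith
  have h2 := h.occMean_mul_le hp (show 1 ≤ 1 + x by linarith) hr0
  have h3 : ∀ n : ℕ, (1 + x) ^ n ≤ 1 + x * (2 ^ n - 1) := by
    intro n
    induction n with
    | zero => simp
    | succ n ih =>
      have hA : (1 : ℝ) ≤ 2 ^ n := one_le_pow₀ one_le_two
      calc (1 + x) ^ (n + 1) = (1 + x) ^ n * (1 + x) := pow_succ _ _
        _ ≤ (1 + x * (2 ^ n - 1)) * (1 + x) := by gcongr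
        _ ≤ 1 + x * (2 ^ (n + 1) - 1) := by
          rw [pow_succ]
          nlinarith [mul_nonneg hx0 (sub_nonneg.2 hA),
            mul_nonneg (mul_nonneg hx0 (sub_nonneg.2 hA)) (sub_nonneg.2 hx1)]
  have h4 : occMean μ E r ≤ occMean μ E (2 * s) := h.occMean_mono hp hr2
  have h0 : 0 ≤ occMean μ E r := occMean_nonneg r
  calc occMean μ E (r + s * x) - occMean μ E r
      ≤ ((1 + x) ^ (m + 1) - 1) * occMean μ E r := by linarith
    _ ≤ (x * 2 ^ (m + 1)) * occMean μ E (2 * s) := by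
        refine mul_le_mul ?_ h4 h0 (by positivity)
        have := h3 (m + 1)
        linarith
    _ = _ := by ring

end IsOccupancyFamily

/-! ### Chaining inside a block -/

/-- Dyadic chaining. -/
lemma dyadic_chain_le {f x : ℕ → ℝ} {g : ℕ → ℕ → ℝ} (hx : ∀ k, 0 ≤ x k)
    (hg0 : ∀ k, g k 0 = 0) (hg : ∀ k i, g (k + 1) (2 * i) = g k i) {M : ℕ}
    (hstep : ∀ k ≤ M, ∀ i < 2 ^ k, g k (i + 1) - g k i ≤ x k)
    (hf : ∀ k, f k = ∑ l ∈ Finset.range (k + 1), x l) :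
    ∀ k ≤ M, ∀ i ≤ 2 ^ k, g k i ≤ f k := by
  have hf0 : ∀ k, 0 ≤ f k := fun k => by rw [hf]; exact Finset.sum_nonneg fun l _ => hx l
  intro k
  induction k with
  | zero =>
    intro hk i hi
    have hi : i ≤ 1 := by simpa using hi
    interval_cases i
    · rw [hg0]; exact hf0 0
    · have := hstep 0 hk 0 (by norm_num)
      rw [hg0, zero_add, sub_zero] at this
      rw [hf]; simpa using this
  | succ k ih =>
    intro hk i hi
    have hfs : f (k + 1) = f k + x (k + 1) := by rw [hf, hf, Finset.sum_range_succ]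
    rw [pow_succ] at hi
    rcases Nat.even_or_odd' i with ⟨l, rfl | rfl⟩
    · rw [hg, hfs]
      linarith [ih (by omega) l (by omega), hx (k + 1)]
    · have h1 := hstep (k + 1) hk (2 * l) (by rw [pow_succ]; omega)
      rw [hg] at h1
      rw [hfs]
      linarith [ih (by omega) l (by omega)]

lemma sum_geometric_three_quarters_le (n : ℕ) : ∑ l ∈ Finset.range n, (3 / 4 : ℝ) ^ l ≤ 4 := by
  have h := Summable.sum_le_tsum (Finset.range n) (fun l _ => by positivity)
    (summable_geometric_of_lt_one (r := (3 / 4 : ℝ)) (by norm_num) (by norm_num))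
  rw [tsum_geometric_of_lt_one (by norm_num) (by norm_num)] at h
  linarith

/-- The numerical estimate behind the chaining argument. -/
lemma chaining_sum_le {κ l : ℝ} (hκ : 16 ≤ κ) (hl : 1 ≤ l) (M : ℕ) :
    ∑ k ∈ Finset.range (M + 1), (2 : ℝ) ^ k * Real.exp (-(κ * (9 / 8) ^ k * l)) ≤
      2 * Real.exp (-(2 * l)) := by
  have hterm : ∀ k : ℕ, (2 : ℝ) ^ k * Real.exp (-(κ * (9 / 8) ^ k * l)) ≤
      Real.exp (-(2 * l)) * (1 / 2) ^ k := by
    intro k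
    -- By Bernoulli's inequality and `16 ≤ κ` the exponent is at least `(16 + 2 * k) * l`, which
    -- beats the factor `2 ^ k` and leaves `exp (-(2 * l))`.
    have h1 : 1 + (k : ℝ) * (1 / 8) ≤ (9 / 8 : ℝ) ^ k := by
      have := one_add_mul_le_pow (a := (1 / 8 : ℝ)) (by norm_num) k
      norm_num at this ⊢; linarith
    have h2 : Real.exp (-(κ * (9 / 8) ^ k * l)) ≤ Real.exp (-(2 * l)) * Real.exp (-2) ^ k := by
      rw [← Real.exp_nat_mul, ← Real.exp_add]
      apply Real.exp_le_exp.2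
      have h3 : 16 * (1 + (k : ℝ) * (1 / 8)) ≤ κ * (9 / 8) ^ k := by gcongr
      have hk : (0 : ℝ) ≤ k := Nat.cast_nonneg k
      nlinarith [mul_le_mul_of_nonneg_right h3 (by linarith : (0 : ℝ) ≤ l)]
    have h4 : Real.exp (-2) ≤ 1 / 4 := by
      rw [Real.exp_neg, inv_le_comm₀ (Real.exp_pos _) (by norm_num)]
      have h := Real.quadratic_le_exp_of_nonneg (x := (2 : ℝ)) (by norm_num)
      norm_num at h ⊢; linarith
    calc (2 : ℝ) ^ k * Real.exp (-(κ * (9 / 8) ^ k * l))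
        ≤ 2 ^ k * (Real.exp (-(2 * l)) * (1 / 4) ^ k) := by
          gcongr
          refine h2.trans ?_
          gcongr
      _ = Real.exp (-(2 * l)) * (1 / 2) ^ k := by
          rw [mul_left_comm, ← mul_pow]; norm_num
  calc _ ≤ ∑ k ∈ Finset.range (M + 1), Real.exp (-(2 * l)) * (1 / 2 : ℝ) ^ k :=
        Finset.sum_le_sum fun k _ => hterm k
    _ ≤ 2 * Real.exp (-(2 * l)) := by
        rw [← Finset.mul_sum, mul_comm]
        refine mul_le_mul_of_nonneg_right ?_ (Real.exp_pos _).le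
        have h := Summable.sum_le_tsum (Finset.range (M + 1)) (fun l _ => by positivity)
          (summable_geometric_of_lt_one (r := (1 / 2 : ℝ)) (by norm_num) (by norm_num))
        rw [tsum_geometric_of_lt_one (by norm_num) (by norm_num)] at h
        linarith

namespace IsOccupancyFamily

variable {Ω : Type*} [MeasurableSpace Ω] {μ : Measure Ω} [IsProbabilityMeasure μ] {p : ℕ → ℝ}
  {m : ℕ} {E : ℕ → ℝ → Set Ω}

/-- Maximal inequality for the centred process over the block `[s, s (1 + d)]`. -/
theorem measure_block_le (h : IsOccupancyFamily μ p m E) (hp : IsBoxDistribution p)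
    {s d η D w l : ℝ} (hs : 0 ≤ s) (hd0 : 0 < d) (hd1 : d ≤ 1) (hη : 0 < η) (hD : 0 < D)
    (hw : 0 < w) (hl : 1 ≤ l) (hmean : 2 ^ (m + 1) * occMean μ E (2 * s) ≤ D * w)
    (hdη : 128 * (d * D) ≤ η ^ 2) {M : ℕ} (hM : (2 : ℝ) ^ M ≤ √w) (hM' : √w < 2 ^ (M + 1))
    (hl1 : η ^ 2 * l ≤ 16 * (d * D) ^ 2 * w ^ (1 / 3 : ℝ)) (hl2 : 2 * (d * D) ≤ η * √l) :
    ∃ G : Set Ω, μ.real G ≤ 2 * Real.exp (-(2 * l)) ∧ ∀ᵐ ω ∂μ, ω ∉ G →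
      ∀ u, s ≤ u → u ≤ s * (1 + d) →
        occDev μ E u ω - occDev μ E s ω ≤ 5 * η * √(w * l) := by
  have hdD : 0 < d * D := mul_pos hd0 hD
  have hl0 : 0 < l := by linarith
  -- Level `k` cuts the block into `2 ^ k` cells. Thresholds `x k` decay like `(3 / 4) ^ k` and cell
  -- means are at most `a k`, of order `2 ^ (-k)`; so `x k ^ 2 / a k` grows like `(9 / 8) ^ k`,
  -- while the thresholds remain summable.
  set u : ℕ → ℕ → ℝ := fun k i => s * (1 + d * (i / 2 ^ k)) with hu
  set x : ℕ → ℝ := fun k => η * (3 / 4) ^ k * √(w * l) with hx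
  set a : ℕ → ℝ := fun k => d * D * w / 2 ^ k with ha
  have hustep : ∀ k i, u k (i + 1) = u k i + s * (d / 2 ^ k) := by
    intro k i; simp only [hu]; push_cast; ring
  have huge : ∀ k i, s ≤ u k i := by
    intro k i
    simp only [hu]
    exact le_mul_of_one_le_right hs (by have : 0 ≤ d * ((i : ℝ) / 2 ^ k) := by positivity
                                        linarith)
  have hule : ∀ k i, i ≤ 2 ^ k → u k i ≤ 2 * s := by
    intro k i hi
    simp only [hu]
    have h1 : (i : ℝ) / 2 ^ k ≤ 1 := by
      rw [div_le_one (by positivity)]; exact_mod_cast hi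
    have h2 : d * ((i : ℝ) / 2 ^ k) ≤ 1 := mul_le_one₀ hd1 (by positivity) h1
    nlinarith
  have hinc : ∀ k i, i < 2 ^ k → occMean μ E (u k (i + 1)) - occMean μ E (u k i) ≤ a k := by
    intro k i hi
    rw [hustep]
    have h2k : (1 : ℝ) ≤ 2 ^ k := one_le_pow₀ one_le_two
    refine (h.occMean_increment_le hp hs (by positivity)
      ((div_le_one (by positivity)).2 (hd1.trans h2k)) (huge k i) (hule k i hi.le)).trans ?_
    calc d / 2 ^ k * (2 ^ (m + 1) * occMean μ E (2 * s)) ≤ d / 2 ^ k * (D * w) := by gcongr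
      _ = a k := by simp only [ha]; ring
  have hustepge : ∀ k i, u k i ≤ u k (i + 1) := by
    intro k i; rw [hustep]; have : 0 ≤ s * (d / 2 ^ k) := by positivity
    linarith
  -- the bad event
  set G : Set Ω := ⋃ k ∈ Finset.range (M + 1), ⋃ i ∈ Finset.range (2 ^ k),
    {ω | x k ≤ occDev μ E (u k (i + 1)) ω - occDev μ E (u k i) ω} with hG
  have hxpos : ∀ k, 0 < x k := by intro k; simp only [hx]; positivity
  have hapos : ∀ k, 0 < a k := by intro k; simp only [ha]; positivity
  have hsq : √(w * l) ^ 2 = w * l := Real.sq_sqrt (by positivity)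
  -- This makes the Chernoff parameter `x k / (4 * a k)` at most `1`. It uses `(3 / 2) ^ 3 ≤ 2 ^ 2`,
  -- so that `(3 / 2) ^ k ≤ w ^ (1 / 3)` up to the last level `M`.
  have hxa : ∀ k ≤ M, x k ≤ 4 * a k := by
    intro k hk
    have hpow : ((3 / 2 : ℝ) ^ k) ^ 2 ≤ (w ^ (1 / 3 : ℝ)) ^ 2 := by
      have h1 : (3 / 2 : ℝ) ^ k ≤ (3 / 2 : ℝ) ^ M := pow_le_pow_right₀ (by norm_num) hk
      have h2 : ((3 / 2 : ℝ) ^ M) ^ 3 ≤ (w ^ (1 / 3 : ℝ)) ^ 3 := by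
        calc ((3 / 2 : ℝ) ^ M) ^ 3 = ((3 / 2 : ℝ) ^ 3) ^ M := by rw [← pow_mul, ← pow_mul, mul_comm]
          _ ≤ ((2 : ℝ) ^ 2) ^ M := by gcongr; norm_num
          _ = ((2 : ℝ) ^ M) ^ 2 := by rw [← pow_mul, ← pow_mul, mul_comm]
          _ ≤ √w ^ 2 := by gcongr
          _ = w := Real.sq_sqrt hw.le
          _ = (w ^ (1 / 3 : ℝ)) ^ 3 := by
              rw [← Real.rpow_natCast, ← Real.rpow_mul hw.le]; norm_num
      have h3 : (3 / 2 : ℝ) ^ M ≤ w ^ (1 / 3 : ℝ) :=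
        le_of_pow_le_pow_left₀ three_ne_zero (by positivity) h2
      exact pow_le_pow_left₀ (by positivity) (h1.trans h3) 2
    have hw3 : w ^ (1 / 3 : ℝ) * (w ^ (1 / 3 : ℝ)) ^ 2 = w := by
      rw [← pow_succ', ← Real.rpow_natCast, ← Real.rpow_mul hw.le]; norm_num
    have hkey : (x k * 2 ^ k) ^ 2 ≤ (4 * (d * D * w)) ^ 2 := by
      calc (x k * 2 ^ k) ^ 2 = (η ^ 2 * l) * (w * ((3 / 4 * 2 : ℝ) ^ k) ^ 2) := by
            simp only [hx]
            rw [mul_pow (3 / 4 : ℝ), mul_pow, mul_pow, mul_pow, mul_pow, hsq]; ring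
        _ ≤ (16 * (d * D) ^ 2 * w ^ (1 / 3 : ℝ)) * (w * (w ^ (1 / 3 : ℝ)) ^ 2) := by
            rw [show (3 / 4 * 2 : ℝ) = 3 / 2 by norm_num]
            gcongr
        _ = 16 * (d * D) ^ 2 * w * (w ^ (1 / 3 : ℝ) * (w ^ (1 / 3 : ℝ)) ^ 2) := by ring
        _ = (4 * (d * D * w)) ^ 2 := by rw [hw3]; ring
    have hle : x k * 2 ^ k ≤ 4 * (d * D * w) :=
      le_of_pow_le_pow_left₀ two_ne_zero (by positivity) hkey
    rw [← le_div_iff₀ (by positivity)] at hle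
    refine hle.trans (le_of_eq ?_)
    simp only [ha]; ring
  set κ : ℝ := η ^ 2 / (8 * (d * D)) with hκ
  have hκ16 : 16 ≤ κ := by
    rw [hκ, le_div_iff₀ (by positivity)]; linarith
  have hsingle : ∀ k ≤ M, ∀ i < 2 ^ k,
      μ.real {ω | x k ≤ occDev μ E (u k (i + 1)) ω - occDev μ E (u k i) ω} ≤
        Real.exp (-(κ * (9 / 8) ^ k * l)) := by
    intro k hk i hi
    have hak := hapos k
    have hxk := hxpos k
    refine (h.increment_upper_tail hp (hustepge k i) (θ := x k / (4 * a k)) (by positivity)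
      ((div_le_one (by positivity)).2 (hxa k hk)) (hinc k i hi) (x k)).trans ?_
    apply Real.exp_le_exp.2
    have e1 : -(x k / (4 * a k)) * x k + (x k / (4 * a k)) ^ 2 * a k =
        -(3 / 16 * (x k ^ 2 / a k)) := by field_simp; ring
    have e2 : x k ^ 2 / a k = 8 * (κ * (9 / 8) ^ k * l) := by
      have e3 : ((3 / 4 : ℝ) ^ k) ^ 2 * 2 ^ k = (9 / 8 : ℝ) ^ k := by
        rw [← pow_mul, mul_comm k 2, pow_mul, ← mul_pow]; norm_num
      simp only [hx, ha, hκ]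
      rw [mul_pow, mul_pow, hsq, ← e3]
      field_simp
    rw [e1, e2]
    have : 0 ≤ κ * (9 / 8) ^ k * l := by positivity
    linarith
  refine ⟨G, ?_, ?_⟩
  · calc μ.real G ≤ ∑ k ∈ Finset.range (M + 1), ∑ i ∈ Finset.range (2 ^ k),
          μ.real {ω | x k ≤ occDev μ E (u k (i + 1)) ω - occDev μ E (u k i) ω} := by
          refine (measureReal_biUnion_finset_le _ _).trans (Finset.sum_le_sum fun k _ => ?_)
          exact measureReal_biUnion_finset_le _ _
      _ ≤ ∑ k ∈ Finset.range (M + 1), (2 : ℝ) ^ k * Real.exp (-(κ * (9 / 8) ^ k * l)) := by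
          refine Finset.sum_le_sum fun k hk => ?_
          calc _ ≤ ∑ i ∈ Finset.range (2 ^ k), Real.exp (-(κ * (9 / 8) ^ k * l)) :=
                Finset.sum_le_sum fun i hi => hsingle k (by
                  have := Finset.mem_range.1 hk; omega) i (Finset.mem_range.1 hi)
            _ = _ := by simp
      _ ≤ _ := chaining_sum_le hκ16 hl M
  · filter_upwards [h.ae_finite hp] with ω hω hωG v hsv hvd
    have hstep : ∀ k ≤ M, ∀ i < 2 ^ k, (occDev μ E (u k (i + 1)) ω - occDev μ E s ω) -
        (occDev μ E (u k i) ω - occDev μ E s ω) ≤ x k := by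
      intro k hk i hi
      by_contra hcon
      apply hωG
      simp only [hG, Set.mem_iUnion]
      refine ⟨k, Finset.mem_range.2 (by omega), i, Finset.mem_range.2 hi, ?_⟩
      simp only [Set.mem_ofPred_eq]
      linarith
    have hchain := dyadic_chain_le (g := fun k i => occDev μ E (u k i) ω - occDev μ E s ω)
      (f := fun k => ∑ l ∈ Finset.range (k + 1), x l) (fun k => (hxpos k).le)
      (fun k => by simp [hu]) (fun k i => by
        have : u (k + 1) (2 * i) = u k i := by
          simp only [hu]; push_cast; rw [pow_succ]; field_simp
        simp only [this]) hstep (fun k => rfl) M le_rfl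
    have hsumx : ∑ l ∈ Finset.range (M + 1), x l ≤ 4 * η * √(w * l) := by
      have : ∑ l ∈ Finset.range (M + 1), x l =
          (∑ l ∈ Finset.range (M + 1), (3 / 4 : ℝ) ^ l) * (η * √(w * l)) := by
        rw [Finset.sum_mul]; exact Finset.sum_congr rfl fun k _ => by simp only [hx]; ring
      rw [this]
      calc _ ≤ 4 * (η * √(w * l)) := by
            gcongr; exact sum_geometric_three_quarters_le _
        _ = _ := by ring
    have haM : a M ≤ η * √(w * l) := by
      have hwsq : √w * √w = w := Real.mul_self_sqrt hw.le
      simp only [ha]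
      rw [div_le_iff₀ (by positivity), Real.sqrt_mul hw.le]
      rw [pow_succ] at hM'
      have hsw : 0 < √w := Real.sqrt_pos.2 hw
      calc d * D * w = d * D * √w * √w := by rw [mul_assoc (d * D), hwsq]
        _ ≤ d * D * √w * (2 ^ M * 2) := by gcongr
        _ = 2 * (d * D) * (√w * 2 ^ M) := by ring
        _ ≤ η * √l * (√w * 2 ^ M) := by gcongr
        _ = _ := by ring
    -- locate `v` in the finest grid
    have hKmono : ∀ r t, r ≤ t → occCount E r ω ≤ occCount E t ω := by
      intro r t hrt
      have := h.eventCount_diff hω hrt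
      have h0 : 0 ≤ eventCount (fun k => E k t \ E k r) ω := by unfold eventCount; positivity
      linarith
    have hexists : ∃ i < 2 ^ M, u M i ≤ v ∧ v ≤ u M (i + 1) := by
      by_contra hcon
      push Not at hcon
      have hall : ∀ i ≤ 2 ^ M, u M i ≤ v := by
        intro i
        induction i with
        | zero => intro _; simpa [hu] using hsv
        | succ i ih => intro hi; exact (hcon i (by omega) (ih (by omega))).le
      have hpos : 0 < 2 ^ M := by positivity
      have hlast := hall (2 ^ M - 1) (by omega)
      have := hcon (2 ^ M - 1) (by omega) hlast
      rw [Nat.sub_add_cancel hpos] at this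
      have hend : u M (2 ^ M) = s * (1 + d) := by
        simp only [hu]; push_cast; field_simp
      linarith
    obtain ⟨i, hi, hi1, hi2⟩ := hexists
    -- Inside a finest cell the monotone count is bounded by its value at the right end; only the
    -- increase of the mean, at most `a M`, is lost. This is the fifth `η` on top of the four from
    -- chaining.
    have h1 : occCount E v ω ≤ occCount E (u M (i + 1)) ω := hKmono _ _ hi2
    have h2 : occMean μ E (u M i) ≤ occMean μ E v := h.occMean_mono hp hi1
    have h3 := hinc M i hi
    have h4 := hchain (i + 1) hi
    simp only [occDev] at h4 ⊢
    linarith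

end IsOccupancyFamily

/-! ### The law of the iterated logarithm: upper half -/

lemma eventually_mul_log_log_le_rpow (A : ℝ) {r : ℝ} (hr : 0 < r) :
    ∀ᶠ x : ℝ in atTop, A * Real.log (Real.log x) ≤ x ^ r := by
  have h1 := (isLittleO_log_rpow_atTop hr).bound (show 0 < (|A| + 1)⁻¹ by positivity)
  have h2 : ∀ᶠ x : ℝ in atTop, 1 ≤ Real.log x := Real.tendsto_log_atTop.eventually_ge_atTop 1
  filter_upwards [h1, h2, eventually_gt_atTop 0] with x hx1 hx2 hx0
  have hl0 : 0 ≤ Real.log (Real.log x) := Real.log_nonneg hx2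
  have hl : Real.log (Real.log x) ≤ Real.log x := Real.log_le_self (by linarith)
  rw [Real.norm_of_nonneg (by linarith), Real.norm_of_nonneg (by positivity), inv_mul_eq_div,
    le_div_iff₀ (by positivity)] at hx1
  have hA : A ≤ |A| + 1 := by linarith [le_abs_self A]
  calc A * Real.log (Real.log x) ≤ (|A| + 1) * Real.log x := by
        apply mul_le_mul hA hl hl0 (by positivity)
    _ ≤ x ^ r := by linarith

/-- A monotone regularly varying function `v` which is equivalent to the variance and dominates
the mean. -/
structure IsVarianceScale {Ω : Type*} [MeasurableSpace Ω] (μ : Measure Ω) (E : ℕ → ℝ → Set Ω)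
    (v : ℝ → ℝ) (α : ℝ) : Prop where
  mono : Monotone v
  tendsto_atTop : Tendsto v atTop atTop
  regularlyVarying : RegularlyVarying v α
  index_pos : 0 < α
  variance_div : Tendsto (fun t => Var[occCount E t; μ] / v t) atTop (𝓝 1)
  mean_le : ∃ C : ℝ, 0 < C ∧ ∀ᶠ t in atTop, occMean μ E t ≤ C * v t

/-- The iterated logarithm of `v`. -/
def logLog (v : ℝ → ℝ) (t : ℝ) : ℝ := Real.log (Real.log (v t))

section Scale

variable {v : ℝ → ℝ} {α : ℝ}

lemma tendsto_logLog (hv : Tendsto v atTop atTop) : Tendsto (logLog v) atTop atTop :=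
  Real.tendsto_log_atTop.comp (Real.tendsto_log_atTop.comp hv)

lemma logLog_mono_of_one_lt (hv : Monotone v) {s t : ℝ} (hs : 1 < v s) (hst : s ≤ t) :
    logLog v s ≤ logLog v t :=
  Real.log_le_log (Real.log_pos hs) (Real.log_le_log (by linarith) (hv hst))

lemma eventually_mul_logLog_le (hv : Tendsto v atTop atTop) (A : ℝ) :
    ∀ᶠ t in atTop, A * logLog v t ≤ v t := by
  have := hv.eventually (eventually_mul_log_log_le_rpow A one_pos)
  simpa [logLog] using this

/-- By regular variation `v` grows at least geometrically along `g ^ n`, so `log (v (t n)) ≥ κ * n`,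
and the terms `(log v) ^ (-β)` are dominated by a convergent power series in `n ^ (-β)`. -/
lemma summable_exp_neg_logLog (hmono : Monotone v) (hv : Tendsto v atTop atTop)
    (hR : RegularlyVarying v α) (hα : 0 < α) {t : ℕ → ℝ} {g : ℝ} (hg : 1 < g)
    (ht : ∀ᶠ n in atTop, g ^ n ≤ t n) {β : ℝ} (hβ : 1 < β) :
    Summable fun n => Real.exp (-(β * logLog v (t n))) := by
  have hg0 : 0 < g := by linarith
  have hgn : Tendsto (fun n : ℕ => g ^ n) atTop atTop := tendsto_pow_atTop_atTop_of_one_lt hg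
  have hgα : 1 < g ^ α := Real.one_lt_rpow hg hα
  obtain ⟨r, hr1, hr2⟩ := exists_between hgα
  have hratio := ((hR g hg0).comp hgn).eventually (lt_mem_nhds hr2)
  have hge1 := (hv.comp hgn).eventually_ge_atTop 1
  obtain ⟨N, hN⟩ := eventually_atTop.1 (hratio.and hge1)
  have hgrow : ∀ k, r ^ k ≤ v (g ^ (N + k)) := by
    intro k
    induction k with
    | zero => simpa using (hN N le_rfl).2
    | succ k ih =>
      obtain ⟨h1, h2⟩ := hN (N + k) (by omega)
      simp only [Function.comp] at h1 h2
      rw [lt_div_iff₀ (by linarith)] at h1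
      calc r ^ (k + 1) = r * r ^ k := pow_succ' _ _
        _ ≤ r * v (g ^ (N + k)) := by gcongr
        _ ≤ v (g * g ^ (N + k)) := h1.le
        _ = v (g ^ (N + (k + 1))) := by rw [← pow_succ']; rfl
  have hlr : 0 < Real.log r := Real.log_pos hr1
  set κ := Real.log r / 2 with hκ
  have hκ0 : 0 < κ := by positivity
  have hlogv : ∀ᶠ n : ℕ in atTop, κ * n ≤ Real.log (v (t n)) := by
    filter_upwards [ht, eventually_ge_atTop (2 * N)] with n hn hn2
    obtain ⟨k, rfl⟩ := Nat.exists_eq_add_of_le (show N ≤ n by omega)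
    have h1 : r ^ k ≤ v (t (N + k)) := (hgrow k).trans (hmono hn)
    have h2 := Real.log_le_log (by positivity) h1
    rw [Real.log_pow] at h2
    refine le_trans ?_ h2
    rw [hκ]
    have : ((N + k : ℕ) : ℝ) ≤ 2 * k := by
      have : N + k ≤ 2 * k := by omega
      exact_mod_cast this
    nlinarith
  have hsum : Summable fun n : ℕ => κ ^ (-β) * (n : ℝ) ^ (-β) :=
    (Real.summable_nat_rpow.2 (by linarith)).mul_left _
  refine hsum.of_norm_bounded_eventually_nat ?_
  filter_upwards [hlogv, eventually_gt_atTop 0] with n hn hn0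
  have hn0' : (0 : ℝ) < n := by exact_mod_cast hn0
  have hκn : 0 < κ * n := by positivity
  rw [Real.norm_of_nonneg (Real.exp_pos _).le, ← Real.mul_rpow hκ0.le hn0'.le,
    Real.rpow_def_of_pos hκn]
  apply Real.exp_le_exp.2
  have := Real.log_le_log hκn hn
  unfold logLog
  nlinarith

end Scale

lemma ae_eventually_notMem_of_summable {Ω : Type*} [MeasurableSpace Ω] {μ : Measure Ω}
    [IsFiniteMeasure μ] {G : ℕ → Set Ω} {b : ℕ → ℝ} (hb : Summable b)
    (h : ∀ᶠ n in atTop, μ.real (G n) ≤ b n) : ∀ᵐ ω ∂μ, ∀ᶠ n in atTop, ω ∉ G n := by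
  have hs : Summable fun n => μ.real (G n) := by
    refine hb.of_norm_bounded_eventually_nat ?_
    filter_upwards [h] with n hn
    rwa [Real.norm_of_nonneg measureReal_nonneg]
  have : ∑' k, μ (G k) ≠ ⊤ := by
    have h := hs.tsum_ofReal_ne_top
    simpa [Measure.real] using h
  exact ae_eventually_notMem this

namespace IsOccupancyFamily

variable {Ω : Type*} [MeasurableSpace Ω] {μ : Measure Ω} [IsProbabilityMeasure μ] {p : ℕ → ℝ}
  {m : ℕ} {E : ℕ → ℝ → Set Ω} {v : ℝ → ℝ} {α : ℝ}

/-- The near-optimal choice `θ = x / V` gives an exponent close to `β ^ 2 / 2 * logLog v t`; since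
`β ^ 2 / 2 > 1`, small relative errors still leave a factor `δ > 1`. -/
lemma eventually_upper_tail (h : IsOccupancyFamily μ p m E) (hp : IsBoxDistribution p)
    (hv : IsVarianceScale μ E v α) {β : ℝ} (hβ0 : 0 < β) (hβ : 2 < β ^ 2) :
    ∃ δ : ℝ, 1 < δ ∧ ∀ᶠ t in atTop,
      μ.real {ω | β * √(v t * logLog v t) ≤ occDev μ E t ω} ≤ Real.exp (-(δ * logLog v t)) := by
  -- Capping at `2` keeps `η ≤ 1 / 8`, where `(1 + η) ^ 2 ≤ (1 + 8 * η) * (1 - η)`.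
  set b := min (β ^ 2 / 2) 2 with hb
  have hb1 : 1 < b := lt_min (by linarith) (by norm_num)
  have hb2 : b ≤ 2 := min_le_right _ _
  have hbβ : b ≤ β ^ 2 / 2 := min_le_left _ _
  set η := (b - 1) / 8 with hη
  have hη0 : 0 < η := by rw [hη]; linarith
  have hη1 : η ≤ 1 / 8 := by rw [hη]; linarith
  have hbη : b = 1 + 8 * η := by rw [hη]; ring
  refine ⟨1 + η, by linarith, ?_⟩
  have hV := hv.variance_div.eventually (gt_mem_nhds (show (1 : ℝ) < 1 + η by linarith))
  filter_upwards [hV, hv.tendsto_atTop.eventually_ge_atTop 1,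
    (tendsto_logLog hv.tendsto_atTop).eventually_ge_atTop 1,
    eventually_mul_logLog_le hv.tendsto_atTop (β ^ 2 / η ^ 2)] with t h1 h2 h3 h4
  have hv0 : 0 < v t := by linarith
  set l := logLog v t with hl
  have hl0 : 0 < l := by linarith
  rw [div_lt_iff₀ hv0] at h1
  have hsq : √(v t * l) ^ 2 = v t * l := Real.sq_sqrt (by positivity)
  set x := β * √(v t * l) with hx
  have hx0 : 0 ≤ x := by positivity
  have hx2 : x ^ 2 = β ^ 2 * (v t * l) := by rw [hx, mul_pow, hsq]
  set V := (1 + η) * v t with hVdef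
  have hV0 : 0 < V := by positivity
  have hxη : x ≤ η * v t := by
    refine le_of_pow_le_pow_left₀ two_ne_zero (by positivity) ?_
    rw [hx2, mul_pow]
    rw [div_mul_eq_mul_div, div_le_iff₀ (by positivity)] at h4
    nlinarith
  have hθη : x / V ≤ η := by
    rw [div_le_iff₀ hV0, hVdef]
    nlinarith [mul_pos hη0 hv0, mul_pos (mul_pos hη0 hη0) hv0]
  have htail := eventCount_upper_tail (fun k => h.measurableSet k t) (h.iIndepSet_events t)
    (h.summable_events hp t) (θ := x / V) (by positivity) (by linarith) h1.le x
  refine htail.trans (Real.exp_le_exp.2 ?_)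
  have e1 : -(x / V) * x + (x / V) ^ 2 * V / 2 * (1 + x / V) =
      -(x ^ 2 / V * ((1 - x / V) / 2)) := by field_simp; ring
  have e2 : x ^ 2 / V = β ^ 2 * l / (1 + η) := by
    rw [hx2, hVdef]; field_simp
  rw [e1, e2]
  apply neg_le_neg
  have e3 : (1 - η) / 2 ≤ (1 - x / V) / 2 := by linarith
  calc (1 + η) * l ≤ β ^ 2 * l / (1 + η) * ((1 - η) / 2) := by
        have : (1 + η) * (1 + η) ≤ (1 + 8 * η) * (1 - η) := by nlinarith
        have h6 : (1 + η) * (1 + η) ≤ β ^ 2 / 2 * (1 - η) := by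
          refine this.trans ?_
          rw [← hbη]
          exact mul_le_mul_of_nonneg_right hbβ (by linarith)
        rw [div_mul_eq_mul_div, le_div_iff₀ (by linarith)]
        nlinarith
    _ ≤ _ := by gcongr

/-- The block ratio `d` is taken small against `η ^ 2 / D`, where `D` bounds the mean relative to
`v`. The other hypotheses of `measure_block_le` hold eventually, since `logLog v` tends to infinity
but more slowly than `v ^ (1 / 3)`. -/
lemma eventually_block (h : IsOccupancyFamily μ p m E) (hp : IsBoxDistribution p)
    (hv : IsVarianceScale μ E v α) {η : ℝ} (hη : 0 < η) :
    ∃ d : ℝ, 0 < d ∧ ∀ᶠ s in atTop, ∃ G : Set Ω, μ.real G ≤ 2 * Real.exp (-(2 * logLog v s)) ∧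
      ∀ᵐ ω ∂μ, ω ∉ G → ∀ u, s ≤ u → u ≤ s * (1 + d) →
        occDev μ E u ω - occDev μ E s ω ≤ 5 * η * √(v s * logLog v s) := by
  obtain ⟨C, hC0, hC⟩ := hv.mean_le
  have h2α : (0 : ℝ) < 2 ^ α := Real.rpow_pos_of_pos two_pos _
  set D : ℝ := 2 ^ (m + 1) * (C * (2 ^ α + 1)) with hD
  have hD0 : 0 < D := by positivity
  set d : ℝ := min 1 (η ^ 2 / (128 * D)) with hd
  have hd0 : 0 < d := lt_min one_pos (by positivity)
  have hd1 : d ≤ 1 := min_le_left _ _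
  have hdη : 128 * (d * D) ≤ η ^ 2 := by
    have : d ≤ η ^ 2 / (128 * D) := min_le_right _ _
    rw [le_div_iff₀ (by positivity)] at this
    linarith
  refine ⟨d, hd0, ?_⟩
  have h2 : Tendsto (fun s : ℝ => 2 * s) atTop atTop := tendsto_id.const_mul_atTop two_pos
  have hreg := (hv.regularlyVarying 2 two_pos).eventually
    (gt_mem_nhds (show (2 : ℝ) ^ α < 2 ^ α + 1 by linarith))
  have hbig := hv.tendsto_atTop.eventually
    (eventually_mul_log_log_le_rpow (η ^ 2 / (16 * (d * D) ^ 2)) (show (0 : ℝ) < 1 / 3 by norm_num))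
  filter_upwards [eventually_ge_atTop 0, h2.eventually hC, hreg,
    hv.tendsto_atTop.eventually_ge_atTop 1, hbig,
    (tendsto_logLog hv.tendsto_atTop).eventually_ge_atTop 1,
    (tendsto_logLog hv.tendsto_atTop).eventually_ge_atTop ((2 * (d * D) / η) ^ 2)]
    with s hs hmean hr hv1 hlog hl1 hl2
  have hv0 : 0 < v s := by linarith
  obtain ⟨M, hM1, hM2⟩ := exists_nat_pow_near (Real.one_le_sqrt.2 hv1) one_lt_two
  refine h.measure_block_le hp hs hd0 hd1 hη hD0 hv0 hl1 ?_ hdη hM1 hM2 ?_ ?_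
  · rw [div_lt_iff₀ hv0] at hr
    calc 2 ^ (m + 1) * occMean μ E (2 * s) ≤ 2 ^ (m + 1) * (C * ((2 ^ α + 1) * v s)) := by
          gcongr
          exact hmean.trans (mul_le_mul_of_nonneg_left hr.le hC0.le)
      _ = D * v s := by rw [hD]; ring
  · rw [div_mul_eq_mul_div, div_le_iff₀ (by positivity)] at hlog
    unfold logLog
    linarith
  · have h5 := Real.sqrt_le_sqrt hl2
    rw [Real.sqrt_sq (by positivity), div_le_iff₀ hη] at h5
    linarith

/-- Borel–Cantelli along the times `(1 + d) ^ n`. Half of `ε` is spent at the grid times and the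
other half, `5 * (ε / 10)`, on the oscillation inside a block. -/
theorem ae_eventually_le (h : IsOccupancyFamily μ p m E) (hp : IsBoxDistribution p)
    (hv : IsVarianceScale μ E v α) {ε : ℝ} (hε : 0 < ε) :
    ∀ᵐ ω ∂μ, ∀ᶠ t in atTop, occDev μ E t ω ≤ (√2 + ε) * √(v t * logLog v t) := by
  have hs2 : √2 ^ 2 = (2 : ℝ) := Real.sq_sqrt zero_le_two
  have hs20 : 0 < √(2 : ℝ) := Real.sqrt_pos.2 two_pos
  set β := √2 + ε / 2 with hβ
  have hβ0 : 0 < β := by positivity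
  obtain ⟨δ, hδ, htail⟩ := h.eventually_upper_tail hp hv hβ0 (by rw [hβ]; nlinarith)
  obtain ⟨d, hd, hblock⟩ := h.eventually_block hp hv (show 0 < ε / 10 by positivity)
  have hg : 1 < 1 + d := by linarith
  have htn : Tendsto (fun n : ℕ => (1 + d) ^ n) atTop atTop := tendsto_pow_atTop_atTop_of_one_lt hg
  have hs1 : Summable fun n : ℕ => Real.exp (-(δ * logLog v ((1 + d) ^ n))) :=
    summable_exp_neg_logLog hv.mono hv.tendsto_atTop hv.regularlyVarying hv.index_pos hg
      (Eventually.of_forall fun n => le_rfl) hδ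
  have hs2 : Summable fun n : ℕ => 2 * Real.exp (-(2 * logLog v ((1 + d) ^ n))) :=
    (summable_exp_neg_logLog hv.mono hv.tendsto_atTop hv.regularlyVarying hv.index_pos hg
      (Eventually.of_forall fun n => le_rfl) one_lt_two).mul_left 2
  have hA := ae_eventually_notMem_of_summable hs1 (htn.eventually htail)
  obtain ⟨N, hN⟩ := eventually_atTop.1 (htn.eventually hblock)
  choose! G hG1 hG2 using hN
  have hB := ae_eventually_notMem_of_summable (G := G) hs2
    (eventually_atTop.2 ⟨N, fun n hn => hG1 n hn⟩)
  have hG3 : ∀ᵐ ω ∂μ, ∀ n, n ≥ N → ω ∉ G n → ∀ u, (1 + d) ^ n ≤ u → u ≤ (1 + d) ^ n * (1 + d) →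
      occDev μ E u ω - occDev μ E ((1 + d) ^ n) ω ≤
        5 * (ε / 10) * √(v ((1 + d) ^ n) * logLog v ((1 + d) ^ n)) := by
    rw [ae_all_iff]
    intro n
    by_cases hn : n ≥ N
    · filter_upwards [hG2 n hn] with ω hω _ using hω
    · exact ae_of_all _ fun ω h => absurd h hn
  have hv1 := (hv.tendsto_atTop.comp htn).eventually_gt_atTop 1
  have hl1 := ((tendsto_logLog hv.tendsto_atTop).comp htn).eventually_ge_atTop 0
  filter_upwards [hA, hB, hG3] with ω h1 h2 h3
  obtain ⟨N₁, hN₁⟩ := eventually_atTop.1 (h1.and (h2.and (hv1.and hl1)))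
  filter_upwards [eventually_ge_atTop ((1 + d) ^ (max N N₁))] with t ht
  have ht1 : 1 ≤ t := (one_le_pow₀ hg.le).trans ht
  obtain ⟨n, hn1, hn2⟩ := exists_nat_pow_near ht1 hg
  have hn : max N N₁ < n + 1 := (pow_lt_pow_iff_right₀ hg).1 (ht.trans_lt hn2)
  have hnN : n ≥ N := by have := le_max_left N N₁; omega
  have hnN₁ : n ≥ N₁ := by have := le_max_right N N₁; omega
  obtain ⟨ha, hb, hc, he⟩ := hN₁ n hnN₁
  simp only [Function.comp] at hc he
  have hup := h3 n hnN hb t hn1 (by rw [← pow_succ]; exact hn2.le)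
  have hat : occDev μ E ((1 + d) ^ n) ω ≤ β * √(v ((1 + d) ^ n) * logLog v ((1 + d) ^ n)) := by
    by_contra hcon
    exact ha (not_le.1 hcon).le
  have hphi : √(v ((1 + d) ^ n) * logLog v ((1 + d) ^ n)) ≤ √(v t * logLog v t) := by
    apply Real.sqrt_le_sqrt
    exact mul_le_mul (hv.mono hn1) (logLog_mono_of_one_lt hv.mono hc hn1) he
      (by linarith [hv.mono hn1])
  calc occDev μ E t ω ≤ (√2 + ε) * √(v ((1 + d) ^ n) * logLog v ((1 + d) ^ n)) := by
        rw [hβ] at hat; linarith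
    _ ≤ _ := by gcongr

end IsOccupancyFamily

/-! ### The law of the iterated logarithm: lower half -/

/-- Events which depend on disjoint blocks of independent `σ`-algebras are independent. -/
lemma iIndepSet_of_disjoint_blocks {Ω : Type*} [mΩ : MeasurableSpace Ω] {μ : Measure Ω}
    {𝓜 : ℕ → MeasurableSpace Ω} (hle : ∀ k, 𝓜 k ≤ mΩ) (hi : iIndep 𝓜 μ) {A : ℕ → Set ℕ}
    (hA : ∀ n l, n ≠ l → Disjoint (A n) (A l)) {G : ℕ → Set Ω}
    (hG : ∀ n, MeasurableSet[⨆ k ∈ A n, 𝓜 k] (G n)) : iIndepSet G μ := by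
  classical
  have hμ := hi.isProbabilityMeasure
  have hGm : ∀ n, MeasurableSet (G n) := fun n =>
    (iSup₂_le fun k _ => hle k : (⨆ k ∈ A n, 𝓜 k) ≤ mΩ) _ (hG n)
  rw [iIndepSet_iff_meas_biInter hGm]
  intro S
  induction S using Finset.induction_on with
  | empty => simp
  | insert a S ha ih =>
    rw [Finset.set_biInter_insert, Finset.prod_insert ha, ← ih]
    have hdisj : Disjoint (A a) (⋃ n ∈ S, A n) := by
      rw [Set.disjoint_iUnion₂_right]
      exact fun n hn => hA a n fun h => ha (h ▸ hn)
    have hind := indep_iSup_of_disjoint hle hi hdisj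
    rw [Indep_iff] at hind
    refine hind _ _ (hG a) (S.measurableSet_biInter fun n hn => ?_)
    refine (biSup_mono fun k hk => ?_ : (⨆ k ∈ A n, 𝓜 k) ≤ _) _ (hG n)
    exact Set.mem_biUnion hn hk

/-- The events with index in `A`. -/
def restrictEvents {Ω : Type*} (A : Set ℕ) (F : ℕ → Set Ω) (k : ℕ) : Set Ω := {ω | k ∈ A ∧ ω ∈ F k}

section Restrict

variable {Ω : Type*} {F : ℕ → Set Ω} {A : Set ℕ}

lemma restrictEvents_of_mem {k : ℕ} (hk : k ∈ A) : restrictEvents A F k = F k := by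
  ext ω; simp [restrictEvents, hk]

lemma restrictEvents_of_notMem {k : ℕ} (hk : k ∉ A) : restrictEvents A F k = ∅ := by
  ext ω; simp [restrictEvents, hk]

lemma eventCount_restrict_add {ω : Ω} (h : {k | ω ∈ F k}.Finite) (A : Set ℕ) :
    eventCount (restrictEvents A F) ω + eventCount (restrictEvents Aᶜ F) ω = eventCount F ω := by
  unfold eventCount
  have h1 := Set.ncard_inter_add_ncard_sdiff_eq_ncard {k | ω ∈ F k} A h
  rw [← h1]
  push_cast
  congr 3
  · ext k; simp [restrictEvents, and_comm]
  · ext k; simp [restrictEvents, and_comm]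

lemma measurableSet_restrictEvents {𝓜 : MeasurableSpace Ω} {k : ℕ} (A : Set ℕ)
    (h : MeasurableSet[𝓜] (F k)) : MeasurableSet[𝓜] (restrictEvents A F k) := by
  by_cases hk : k ∈ A
  · rwa [restrictEvents_of_mem hk]
  · rw [restrictEvents_of_notMem hk]; exact @MeasurableSet.empty _ 𝓜

lemma measurable_eventCount_restrict {𝓜 : ℕ → MeasurableSpace Ω} (hA : A.Finite)
    (hF : ∀ k, MeasurableSet[𝓜 k] (F k)) :
    Measurable[⨆ k ∈ A, 𝓜 k] (eventCount (restrictEvents A F)) := by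
  classical
  have heq : eventCount (restrictEvents A F) =
      fun ω => ∑ k ∈ hA.toFinset, (F k).indicator (fun _ => (1 : ℝ)) ω := by
    funext ω
    have : {k : ℕ | ω ∈ restrictEvents A F k} =
        (hA.toFinset.filter fun k => ω ∈ F k : Finset ℕ) := by
      ext k; simp [restrictEvents]
    rw [eventCount, this, Set.ncard_coe_finset, Finset.card_filter]
    push_cast
    exact Finset.sum_congr rfl fun k _ => by simp [Set.indicator]
  rw [heq]
  refine Finset.measurable_sum _ fun k hk => measurable_const.indicator ?_
  exact (le_biSup 𝓜 (hA.mem_toFinset.1 hk) : 𝓜 k ≤ _) _ (hF k)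

variable [MeasurableSpace Ω] {μ : Measure Ω} [IsProbabilityMeasure μ]

lemma summable_restrictEvents (hs : Summable fun k => μ.real (F k)) (A : Set ℕ) :
    Summable fun k => μ.real (restrictEvents A F k) :=
  hs.of_nonneg_of_le (fun _ => measureReal_nonneg)
    fun k => measureReal_mono fun _ hω => hω.2

end Restrict

/-- The indices of the boxes with `p k * n!` of order one. -/
def factorialBlock (p : ℕ → ℝ) (n : ℕ) : Set ℕ :=
  {k | 1 / √((n : ℝ) + 1) ≤ p k * n ! ∧ p k * n ! < √n}

lemma factorialBlock_finite {p : ℕ → ℝ} (hp : IsBoxDistribution p) (n : ℕ) :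
    (factorialBlock p n).Finite := by
  refine (finite_boxes hp (√((n : ℝ) + 1) * n !)).subset ?_
  rintro k ⟨hk, -⟩
  have hf : (0 : ℝ) < n ! := by positivity
  have hs : 0 < √((n : ℝ) + 1) := by positivity
  have hpk : 0 < p k := by
    have : 0 < p k * n ! := lt_of_lt_of_le (by positivity) hk
    exact pos_of_mul_pos_left this hf.le
  refine ⟨hpk, ?_⟩
  rw [div_le_iff₀ hs] at hk
  rw [div_le_iff₀ hpk]
  linarith

/-- For `n < l` one has `l! ≥ l * n!`, so `p k * n! ≥ 1 / √(n + 1) ≥ 1 / √l` forces `p k * l! ≥ √l`.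
-/
lemma factorialBlock_disjoint (p : ℕ → ℝ) {n l : ℕ} (hnl : n ≠ l) :
    Disjoint (factorialBlock p n) (factorialBlock p l) := by
  wlog h : n < l generalizing n l
  · exact (this hnl.symm (by omega)).symm
  rw [Set.disjoint_left]
  rintro k ⟨hk1, -⟩ ⟨-, hk2⟩
  have hfac : (l : ℝ) * n ! ≤ l ! := by
    obtain ⟨r, rfl⟩ := Nat.exists_eq_succ_of_ne_zero (show l ≠ 0 by omega)
    have : (r + 1) * n ! ≤ (r + 1)! := by
      rw [Nat.factorial_succ]
      exact Nat.mul_le_mul_left _ (Nat.factorial_le (by omega))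
    exact_mod_cast this
  have hf : (0 : ℝ) < n ! := by positivity
  have hl0 : (0 : ℝ) < l := by exact_mod_cast (by omega : 0 < l)
  have hnl' : (n : ℝ) + 1 ≤ l := by exact_mod_cast h
  have hpk : 0 < p k := by
    have : 0 < p k * n ! := lt_of_lt_of_le (by positivity) hk1
    exact pos_of_mul_pos_left this hf.le
  have h1 : 1 / √(l : ℝ) ≤ p k * n ! :=
    (one_div_le_one_div_of_le (by positivity) (Real.sqrt_le_sqrt hnl')).trans hk1
  have hsl : 0 < √(l : ℝ) := Real.sqrt_pos.2 hl0
  have h2 : √(l : ℝ) ≤ p k * l ! := by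
    calc √(l : ℝ) = l * (1 / √(l : ℝ)) := by
          rw [mul_one_div, eq_div_iff hsl.ne', Real.mul_self_sqrt hl0.le]
      _ ≤ l * (p k * n !) := by gcongr
      _ = p k * (l * n !) := by ring
      _ ≤ p k * l ! := by gcongr
  linarith

lemma tendsto_factorial_cast : Tendsto (fun n : ℕ => (n ! : ℝ)) atTop atTop :=
  tendsto_atTop_mono (fun n => by exact_mod_cast n.self_le_factorial)
    tendsto_natCast_atTop_atTop

/-- Relative to `ρ t`, the left side tends to `e ^ α + e ^ (1 - α) / (1 - α)`, which vanishes as `e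
→ 0` because `0 < α < 1`. Its two terms bound the variance due to boxes with `p k * t ≥ 1 / e` and
with `p k * t ≤ e`. -/
lemma eventually_boxCounting_add_le {p : ℕ → ℝ} {α : ℝ} (hp : IsBoxDistribution p)
    (hR : RegularlyVarying (boxCounting p) α) (hα0 : 0 < α) (hα1 : α < 1) {δ : ℝ} (hδ : 0 < δ) :
    ∃ e : ℝ, 0 < e ∧ ∀ᶠ t in atTop,
      boxCounting p (e * t) + ∑' k, min (p k * t) e ≤ δ * boxCounting p t := by
  have hlim : Tendsto (fun e : ℝ => e ^ α + e ^ (1 - α) / (1 - α)) (𝓝[>] 0) (𝓝 0) := by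
    have h1 : ContinuousAt (fun e : ℝ => e ^ α + e ^ (1 - α) / (1 - α)) 0 :=
      (Real.continuousAt_rpow_const _ _ (Or.inr hα0.le)).add
        ((Real.continuousAt_rpow_const _ _ (Or.inr (by linarith))).div_const _)
    have h2 := h1.tendsto
    simp only [Real.zero_rpow hα0.ne', Real.zero_rpow (show 1 - α ≠ 0 by linarith), zero_div,
      add_zero] at h2
    exact h2.mono_left nhdsWithin_le_nhds
  obtain ⟨e, he1, he0⟩ := ((hlim.eventually (gt_mem_nhds hδ)).and self_mem_nhdsWithin).exists
  refine ⟨e, he0, ?_⟩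
  have h3 := ((hR e he0).add (tendsto_tsum_min_div hp hR hα0 hα1 he0)).eventually (gt_mem_nhds he1)
  filter_upwards [h3, eventually_boxCounting_pos hp] with t ht hpos
  rw [← add_div, div_lt_iff₀ hpos] at ht
  exact ht.le

/-- The choice of the exponential tilting parameter in the lower bound for block sums. -/
lemma exists_tilting_parameter {ε w l V : ℝ} (hε : 0 < ε) (hε1 : ε ≤ 1 / 10) (hw0 : 0 < w)
    (hl1 : 1 ≤ l) (hl2 : 10 / ε ^ 2 ≤ l) (h4 : 1600 / ε ^ 4 * l ≤ w) (hVl : (1 - ε) * w ≤ V) :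
    ∃ θ : ℝ, 0 < θ ∧ θ * (1 + ε) ≤ ε ^ 2 / 10 ∧ 6 ≤ ε ^ 2 * (θ ^ 2 * V) ∧
      √2 * (1 - 8 * ε) * √(w * l) ≤ (1 - ε) * (θ * V) ∧
      θ ^ 2 * V * (1 / 2 + 2 * ε) ≤ (1 - 2 * ε) * l := by
  have hl0 : 0 < l := by linarith
  have hV0 : 0 < V := lt_of_lt_of_le (mul_pos (by linarith) hw0) hVl
  have h6 : 0 < 1 - 6 * ε := by linarith
  -- Without the factor `1 - 6 * ε` this is the optimal tilt. The factor lowers the exponent to `(1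
  -- - 6 * ε) * (1 + 4 * ε) * l ≤ (1 - 2 * ε) * l`, at the cost of only `1 - 8 * ε` in the
  -- threshold.
  set θ := √(2 * (1 - 6 * ε) * l / V) with hθ
  have hθ0 : 0 < θ := Real.sqrt_pos.2 (by positivity)
  have hθ2 : θ ^ 2 * V = 2 * (1 - 6 * ε) * l := by
    rw [hθ, Real.sq_sqrt (by positivity)]; field_simp
  refine ⟨θ, hθ0, ?_, ?_, ?_, ?_⟩
  · have hθs : θ ≤ ε ^ 2 / 20 := by
      refine le_of_pow_le_pow_left₀ two_ne_zero (by positivity) ?_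
      refine le_of_mul_le_mul_right ?_ hV0
      rw [hθ2]
      rw [div_mul_eq_mul_div, div_le_iff₀ (by positivity)] at h4
      have hVw : w / 2 ≤ V := by
        have : ε * w ≤ 1 / 10 * w := by gcongr
        linarith
      calc 2 * (1 - 6 * ε) * l ≤ 2 * 1 * l := by gcongr; linarith
        _ = 1600 * l / 800 := by ring
        _ ≤ w * ε ^ 4 / 800 := by gcongr
        _ = (ε ^ 2 / 20) ^ 2 * (w / 2) := by ring
        _ ≤ (ε ^ 2 / 20) ^ 2 * V := by gcongr
    calc θ * (1 + ε) ≤ ε ^ 2 / 20 * 2 := by gcongr; linarith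
      _ = _ := by ring
  · rw [hθ2]
    rw [div_le_iff₀ (by positivity)] at hl2
    calc (6 : ℝ) ≤ 2 * (1 - 6 * (1 / 10)) * 10 := by norm_num
      _ ≤ 2 * (1 - 6 * ε) * (l * ε ^ 2) := by gcongr
      _ = _ := by ring
  · refine le_of_pow_le_pow_left₀ two_ne_zero
      (mul_nonneg (by linarith) (by positivity)) ?_
    have e1 : (√2 * (1 - 8 * ε) * √(w * l)) ^ 2 = 2 * l * w * (1 - 8 * ε) ^ 2 := by
      rw [mul_pow, mul_pow, Real.sq_sqrt zero_le_two, Real.sq_sqrt (by positivity)]; ring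
    have e2 : ((1 - ε) * (θ * V)) ^ 2 = 2 * l * ((1 - ε) ^ 2 * (1 - 6 * ε)) * V := by
      rw [mul_pow, mul_pow, show θ ^ 2 * V ^ 2 = θ ^ 2 * V * V by ring, hθ2]; ring
    rw [e1, e2]
    have e3 : (1 - 8 * ε) ^ 2 ≤ (1 - ε) ^ 2 * (1 - 6 * ε) * (1 - ε) := by
      have e4 : 1 - 3 * ε ≤ (1 - ε) ^ 2 * (1 - ε) := by
        have : 0 ≤ ε ^ 2 * (3 - ε) := mul_nonneg (by positivity) (by linarith)
        linarith
      have e5 := mul_le_mul_of_nonneg_right e4 h6.le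
      have e6 : 0 ≤ ε * (7 - 46 * ε) := mul_nonneg hε.le (by linarith)
      linarith
    calc 2 * l * w * (1 - 8 * ε) ^ 2
        ≤ 2 * l * w * ((1 - ε) ^ 2 * (1 - 6 * ε) * (1 - ε)) := by gcongr
      _ = 2 * l * ((1 - ε) ^ 2 * (1 - 6 * ε)) * ((1 - ε) * w) := by ring
      _ ≤ _ := by gcongr
  · rw [hθ2]
    have : 0 ≤ ε ^ 2 * l := by positivity
    linarith

namespace IsOccupancyFamily

variable {Ω : Type*} [MeasurableSpace Ω] {μ : Measure Ω} {p : ℕ → ℝ} {m : ℕ}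
  {E : ℕ → ℝ → Set Ω}

lemma measurableSet_restrict (h : IsOccupancyFamily μ p m E) (A : Set ℕ) (t : ℝ) (k : ℕ) :
    MeasurableSet (restrictEvents A (fun k => E k t) k) :=
  measurableSet_restrictEvents A (h.measurableSet k t)

lemma iIndepSet_restrict (h : IsOccupancyFamily μ p m E) (A : Set ℕ) (t : ℝ) :
    iIndepSet (restrictEvents A (fun k => E k t)) μ :=
  h.iIndepSet_of_measurableSet fun k =>
    measurableSet_restrictEvents A (measurableSet_generateFrom k t)

variable [IsProbabilityMeasure μ]

lemma summable_restrict (h : IsOccupancyFamily μ p m E) (hp : IsBoxDistribution p) (A : Set ℕ)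
    (t : ℝ) : Summable fun k => μ.real (restrictEvents A (fun k => E k t) k) :=
  summable_restrictEvents (h.summable_events hp t) A

lemma occMean_restrict (h : IsOccupancyFamily μ p m E) (hp : IsBoxDistribution p) (A : Set ℕ)
    (t : ℝ) : ∫ ω, eventCount (restrictEvents A fun k => E k t) ω ∂μ +
      ∫ ω, eventCount (restrictEvents Aᶜ fun k => E k t) ω ∂μ = occMean μ E t := by
  have hint : ∀ A, Integrable (eventCount (restrictEvents A fun k => E k t)) μ := fun A =>
    (memLp_eventCount (h.measurableSet_restrict A t) (h.iIndepSet_restrict A t)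
      (h.summable_restrict hp A t)).integrable one_le_two
  rw [← integral_add (hint A) (hint Aᶜ)]
  refine integral_congr_ae ?_
  filter_upwards [h.ae_finite hp] with ω hω
  exact eventCount_restrict_add (hω t) A

lemma variance_restrict (h : IsOccupancyFamily μ p m E) (hp : IsBoxDistribution p) (A : Set ℕ)
    (t : ℝ) : Var[eventCount (restrictEvents A fun k => E k t); μ] +
      Var[eventCount (restrictEvents Aᶜ fun k => E k t); μ] = Var[occCount E t; μ] := by
  rw [variance_eventCount (h.measurableSet_restrict A t) (h.iIndepSet_restrict A t)
      (h.summable_restrict hp A t),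
    variance_eventCount (h.measurableSet_restrict Aᶜ t) (h.iIndepSet_restrict Aᶜ t)
      (h.summable_restrict hp Aᶜ t),
    ← (summable_mul_one_sub (h.summable_restrict hp A t)).tsum_add
      (summable_mul_one_sub (h.summable_restrict hp Aᶜ t))]
  refine Eq.trans ?_ (variance_eventCount (fun k => h.measurableSet k t) (h.iIndepSet_events t)
    (h.summable_events hp t)).symm
  refine tsum_congr fun k => ?_
  by_cases hk : k ∈ A
  · rw [restrictEvents_of_mem hk, restrictEvents_of_notMem (A := Aᶜ) (by simpa using hk)]; simp
  · rw [restrictEvents_of_mem (A := Aᶜ) hk, restrictEvents_of_notMem hk]; simp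

/-- A box outside `A` contributes at most `p k * t` if this is small and at most `1` if it is large;
the large ones number `ρ (e * t)`. -/
lemma variance_restrict_le (h : IsOccupancyFamily μ p m E) (hp : IsBoxDistribution p) {A : Set ℕ}
    {t e : ℝ} (ht : 0 < t) (he : 0 < e) (hA : ∀ k ∉ A, p k * t ≤ e ∨ 1 / e ≤ p k * t) :
    Var[eventCount (restrictEvents Aᶜ fun k => E k t); μ] ≤
      boxCounting p (e * t) + ∑' k, min (p k * t) e := by
  have h1 := boxCounting_eq_tsum hp (one_div_pos.2 he) ht
  rw [show t / (1 / e) = e * t by field_simp] at h1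
  have h2 : Summable fun k => min (p k * t) e :=
    (hp.hasSum_one.summable.mul_right t).of_nonneg_of_le
      (fun k => le_min (mul_nonneg (hp.nonneg k) ht.le) he.le) fun k => min_le_left _ _
  rw [variance_eventCount (h.measurableSet_restrict Aᶜ t) (h.iIndepSet_restrict Aᶜ t)
      (h.summable_restrict hp Aᶜ t), ← h1.tsum_eq, ← h1.summable.tsum_add h2]
  refine (summable_mul_one_sub (h.summable_restrict hp Aᶜ t)).tsum_le_tsum (fun k => ?_)
    (h1.summable.add h2)
  have hpk : 0 ≤ p k * t := mul_nonneg (hp.nonneg k) ht.le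
  have hmin : 0 ≤ min (p k * t) e := le_min hpk he.le
  by_cases hk : k ∈ A
  · rw [restrictEvents_of_notMem (A := Aᶜ) (by simpa using hk)]
    simp only [measureReal_empty, zero_mul]
    split_ifs <;> linarith
  · rw [restrictEvents_of_mem (A := Aᶜ) hk, h.measureReal k t ht.le]
    have hq0 := poissonTail_nonneg m hpk
    have hq1 := poissonTail_lt_one m hpk
    have hq2 := poissonTail_le_self m hpk
    rcases hA k hk with hc | hc
    · rw [min_eq_left hc]
      have : poissonTail (m + 1) (p k * t) * (1 - poissonTail (m + 1) (p k * t)) ≤ p k * t := by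
        nlinarith
      split_ifs <;> linarith
    · rw [if_pos hc]
      nlinarith

variable {v : ℝ → ℝ} {α c : ℝ}

lemma eventually_variance_compl_factorialBlock_le (h : IsOccupancyFamily μ p m E)
    (hp : IsBoxDistribution p) (hR : RegularlyVarying (boxCounting p) α) (hα0 : 0 < α)
    (hα1 : α < 1) (hc : 0 < c) (hvc : ∀ t, v t = c * boxCounting p t) {δ : ℝ} (hδ : 0 < δ) :
    ∀ᶠ n : ℕ in atTop,
      Var[eventCount (restrictEvents (factorialBlock p n)ᶜ fun k => E k n !); μ] ≤ δ * v n ! := by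
  obtain ⟨e, he, hev⟩ := eventually_boxCounting_add_le hp hR hα0 hα1 (mul_pos hδ hc)
  have hsq : Tendsto (fun n : ℕ => √(n : ℝ)) atTop atTop :=
    Real.tendsto_sqrt_atTop.comp tendsto_natCast_atTop_atTop
  filter_upwards [tendsto_factorial_cast.eventually hev, hsq.eventually_ge_atTop (1 / e)]
    with n hn hn2
  rw [hvc, ← mul_assoc]
  refine (h.variance_restrict_le hp (by positivity) he fun k hk => ?_).trans hn
  have hn3 : 1 / √((n : ℝ) + 1) ≤ e := by
    rw [one_div_le (by positivity) he]
    exact hn2.trans (Real.sqrt_le_sqrt (by linarith))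
  by_cases hk1 : 1 / √((n : ℝ) + 1) ≤ p k * (n ! : ℝ)
  · right
    by_contra hcon
    exact hk ⟨hk1, (not_le.1 hcon).trans_le hn2⟩
  · left
    linarith

lemma eventually_lower_tail_compl (h : IsOccupancyFamily μ p m E) (hp : IsBoxDistribution p)
    (hv : IsVarianceScale μ E v α) (hR : RegularlyVarying (boxCounting p) α) (hα1 : α < 1)
    (hc : 0 < c) (hvc : ∀ t, v t = c * boxCounting p t) {ε : ℝ} (hε : 0 < ε) :
    ∀ᶠ n : ℕ in atTop,
      μ.real {ω | eventCount (restrictEvents (factorialBlock p n)ᶜ fun k => E k n !) ω -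
        ∫ ω', eventCount (restrictEvents (factorialBlock p n)ᶜ fun k => E k n !) ω' ∂μ ≤
          -(ε * √(v n ! * logLog v n !))} ≤ Real.exp (-(2 * logLog v n !)) := by
  -- With `V = ε ^ 2 / 8 * w` and `θ = x / (2 * V)` the Chernoff exponent is exactly `x ^ 2 / (4 *
  -- V) = 2 * l`.
  have hδ : 0 < ε ^ 2 / 8 := by positivity
  filter_upwards [h.eventually_variance_compl_factorialBlock_le hp hR hv.index_pos hα1 hc hvc hδ,
    tendsto_factorial_cast.eventually (hv.tendsto_atTop.eventually_ge_atTop 1),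
    tendsto_factorial_cast.eventually
      ((tendsto_logLog hv.tendsto_atTop).eventually_ge_atTop 1),
    tendsto_factorial_cast.eventually (eventually_mul_logLog_le hv.tendsto_atTop (16 / ε ^ 2))]
    with n hV h2 h3 h4
  set w := v n ! with hw
  set l := logLog v n ! with hl
  have hw0 : 0 < w := by linarith
  have hl0 : 0 < l := by linarith
  have hsq : √(w * l) ^ 2 = w * l := Real.sq_sqrt (by positivity)
  set x := ε * √(w * l) with hx
  have hx0 : 0 ≤ x := by positivity
  have hx2 : x ^ 2 = ε ^ 2 * (w * l) := by rw [hx, mul_pow, hsq]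
  set V := ε ^ 2 / 8 * w with hVdef
  have hV0 : 0 < V := by positivity
  have hθ1 : x / (2 * V) ≤ 1 := by
    rw [div_le_one (by positivity)]
    refine le_of_pow_le_pow_left₀ two_ne_zero (by positivity) ?_
    rw [hx2, hVdef]
    rw [div_mul_eq_mul_div, div_le_iff₀ (by positivity)] at h4
    calc ε ^ 2 * (w * l) = ε ^ 2 * w * (16 * l) / 16 := by ring
      _ ≤ ε ^ 2 * w * (w * ε ^ 2) / 16 := by gcongr
      _ = _ := by ring
  refine (eventCount_lower_tail (h.measurableSet_restrict _ _) (h.iIndepSet_restrict _ _)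
    (h.summable_restrict hp _ _) (θ := x / (2 * V)) (by positivity) hθ1 hV x).trans ?_
  apply Real.exp_le_exp.2
  have e1 : (x / (2 * V)) ^ 2 * V / 2 * (1 + x / (2 * V)) ≤ (x / (2 * V)) ^ 2 * V / 2 * 2 :=
    mul_le_mul_of_nonneg_left (by linarith) (by positivity)
  have e2 : -(x / (2 * V)) * x + (x / (2 * V)) ^ 2 * V / 2 * 2 = -(x ^ 2 / (4 * V)) := by
    field_simp; ring
  have e3 : x ^ 2 / (4 * V) = 2 * l := by
    rw [hx2, hVdef]; field_simp; norm_num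
  linarith

/-- Lower bound for the probability of a large deviation of the block sums. -/
lemma eventually_lower_bound_factorialBlock (h : IsOccupancyFamily μ p m E)
    (hp : IsBoxDistribution p) (hv : IsVarianceScale μ E v α)
    (hR : RegularlyVarying (boxCounting p) α) (hα1 : α < 1) (hc : 0 < c)
    (hvc : ∀ t, v t = c * boxCounting p t) {ε : ℝ} (hε : 0 < ε) (hε1 : ε ≤ 1 / 10) :
    ∀ᶠ n : ℕ in atTop, 1 / 2 * Real.exp (-((1 - 2 * ε) * logLog v n !)) ≤
      μ.real {ω | √2 * (1 - 8 * ε) * √(v n ! * logLog v n !) ≤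
        eventCount (restrictEvents (factorialBlock p n) fun k => E k n !) ω -
        ∫ ω', eventCount (restrictEvents (factorialBlock p n) fun k => E k n !) ω' ∂μ} := by
  have hVar := tendsto_factorial_cast.eventually (hv.variance_div.eventually
    (lt_mem_nhds (show 1 - ε / 2 < 1 by linarith)))
  have hVar' := tendsto_factorial_cast.eventually (hv.variance_div.eventually
    (gt_mem_nhds (show (1 : ℝ) < 2 by norm_num)))
  filter_upwards [h.eventually_variance_compl_factorialBlock_le hp hR hv.index_pos hα1 hc hvc
      (half_pos hε), hVar, hVar',
    tendsto_factorial_cast.eventually (hv.tendsto_atTop.eventually_ge_atTop 1),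
    tendsto_factorial_cast.eventually
      ((tendsto_logLog hv.tendsto_atTop).eventually_ge_atTop (max 1 (10 / ε ^ 2))),
    tendsto_factorial_cast.eventually (eventually_mul_logLog_le hv.tendsto_atTop (1600 / ε ^ 4))]
    with n hVc hV1 hV2 h2 h3 h4
  have hsum := h.variance_restrict hp (factorialBlock p n) n !
  set w := v n ! with hw
  set l := logLog v n ! with hl
  set V := Var[eventCount (restrictEvents (factorialBlock p n) fun k => E k n !); μ] with hVdef
  have hw0 : 0 < w := by linarith
  have hl1 : 1 ≤ l := (le_max_left _ _).trans h3
  have hl2 : 10 / ε ^ 2 ≤ l := (le_max_right _ _).trans h3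
  have hl0 : 0 < l := by linarith
  rw [lt_div_iff₀ hw0] at hV1
  rw [div_lt_iff₀ hw0] at hV2
  have hVl : (1 - ε) * w ≤ V := by nlinarith
  obtain ⟨θ, hθ0, hθε, hbig, hthr, hexp⟩ :=
    exists_tilting_parameter hε hε1 hw0 hl1 hl2 h4 hVl
  have hlow := eventCount_lower_bound (h.measurableSet_restrict (factorialBlock p n) n !)
    (h.iIndepSet_restrict _ _) (h.summable_restrict hp _ _) hθ0 hε (by linarith) hθε hbig
  calc 1 / 2 * Real.exp (-((1 - 2 * ε) * l))
      ≤ 1 / 2 * Real.exp (-(θ ^ 2 * V * (1 / 2 + 2 * ε))) := by gcongr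
    _ ≤ _ := hlow
    _ ≤ _ := measureReal_mono fun ω hω => hthr.trans hω

/-- The variance is at most `∑ p k * t = t`, and eventually at least half of `v t`. Any polynomial
bound would do for estimating `logLog v n!`. -/
lemma eventually_scale_le (h : IsOccupancyFamily μ p m E) (hp : IsBoxDistribution p)
    (hv : IsVarianceScale μ E v α) : ∀ᶠ t in atTop, v t ≤ 2 * t := by
  filter_upwards [hv.variance_div.eventually (lt_mem_nhds (show (1 / 2 : ℝ) < 1 by norm_num)),
    hv.tendsto_atTop.eventually_gt_atTop 0, eventually_ge_atTop 0] with t ht hv0 ht0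
  rw [lt_div_iff₀ hv0] at ht
  have hs : Summable fun k => p k * t := hp.hasSum_one.summable.mul_right t
  have hV : Var[occCount E t; μ] ≤ t := by
    refine (variance_eventCount (fun k => h.measurableSet k t) (h.iIndepSet_events t)
      (h.summable_events hp t)).trans_le ?_
    calc _ ≤ ∑' k, p k * t := by
          refine (summable_mul_one_sub (h.summable_events hp t)).tsum_le_tsum (fun k => ?_) hs
          rw [h.measureReal k t ht0]
          have hpk : 0 ≤ p k * t := mul_nonneg (hp.nonneg k) ht0
          nlinarith [poissonTail_nonneg m hpk, poissonTail_le_self m hpk]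
      _ = t := by rw [tsum_mul_right, hp.hasSum_one.tsum_eq, one_mul]
  linarith

/-- From `v t ≤ 2 * t` and `n! ≤ n ^ n` follows `log (v n!) ≤ 2 * n * log n`, so `logLog v n!` is at
most `log n` up to `o(log n)`; the factor `1 - 2 * ε` absorbs the error. -/
lemma eventually_one_div_le_exp (h : IsOccupancyFamily μ p m E) (hp : IsBoxDistribution p)
    (hv : IsVarianceScale μ E v α) {ε : ℝ} (hε : 0 < ε) (hε1 : ε ≤ 1 / 10) :
    ∀ᶠ n : ℕ in atTop, 1 / (n : ℝ) ≤ 1 / 2 * Real.exp (-((1 - 2 * ε) * logLog v n !)) := by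
  have hlogn : Tendsto (fun n : ℕ => Real.log n) atTop atTop :=
    Real.tendsto_log_atTop.comp tendsto_natCast_atTop_atTop
  have hlo := hlogn.eventually (Real.isLittleO_log_id_atTop.bound hε)
  filter_upwards [tendsto_factorial_cast.eventually (h.eventually_scale_le hp hv),
    tendsto_factorial_cast.eventually (hv.tendsto_atTop.eventually_gt_atTop 1),
    hlo, hlogn.eventually_ge_atTop (2 / ε), hlogn.eventually_ge_atTop 1,
    eventually_ge_atTop 2] with n h1 h2 h3 h4 h5 h6
  have hn0 : (0 : ℝ) < n := by exact_mod_cast (by omega : 0 < n)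
  have hn2 : (2 : ℝ) ≤ n := by exact_mod_cast h6
  set x := Real.log n with hx
  have hx0 : 0 < x := by linarith
  simp only [id, Real.norm_eq_abs] at h3
  rw [abs_of_pos hx0] at h3
  have h3' : Real.log x ≤ ε * x := (le_abs_self _).trans h3
  rw [div_le_iff₀ hε] at h4
  have hlog2 : Real.log 2 ≤ 1 := by linarith [Real.log_two_lt_d9]
  have hlog20 : 0 ≤ Real.log 2 := Real.log_nonneg one_le_two
  have hlogv : Real.log (v n !) ≤ 2 * (n * x) := by
    have e1 : (n ! : ℝ) ≤ (n : ℝ) ^ n := by exact_mod_cast Nat.factorial_le_pow n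
    have e2 : v n ! ≤ (n : ℝ) ^ (2 * n) := by
      calc v n ! ≤ 2 * (n : ℝ) ^ n := by linarith
        _ ≤ (n : ℝ) ^ n * (n : ℝ) ^ n := by
          gcongr
          exact hn2.trans (le_self_pow₀ (by linarith) (by omega))
        _ = _ := by rw [← pow_add]; ring_nf
    have e3 := Real.log_le_log (by linarith) e2
    rw [Real.log_pow] at e3
    push_cast at e3
    linarith
  have hl : logLog v n ! ≤ Real.log 2 + x + Real.log x := by
    have := Real.log_le_log (Real.log_pos h2) hlogv
    rw [Real.log_mul two_ne_zero (by positivity), Real.log_mul hn0.ne' hx0.ne'] at this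
    unfold logLog
    linarith
  have hkey : (1 - 2 * ε) * logLog v n ! ≤ x - Real.log 2 := by
    have e1 : (1 - 2 * ε) * logLog v n ! ≤ (1 - 2 * ε) * (1 + x + ε * x) :=
      mul_le_mul_of_nonneg_left (by linarith) (by linarith)
    nlinarith [mul_pos hε hx0, mul_pos (mul_pos hε hε) hx0]
  have e5 : Real.exp (-(x - Real.log 2)) = 2 / n := by
    rw [neg_sub, Real.exp_sub, Real.exp_log two_pos, Real.exp_log hn0]
  calc 1 / (n : ℝ) = 1 / 2 * Real.exp (-(x - Real.log 2)) := by rw [e5]; ring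
    _ ≤ _ := by gcongr

/-- Disjoint blocks make the events independent, and their probabilities dominate the harmonic
series, so the second Borel–Cantelli lemma applies. -/
lemma ae_frequently_factorialBlock (h : IsOccupancyFamily μ p m E)
    (hp : IsBoxDistribution p) (hv : IsVarianceScale μ E v α)
    (hR : RegularlyVarying (boxCounting p) α) (hα1 : α < 1) (hc : 0 < c)
    (hvc : ∀ t, v t = c * boxCounting p t) {ε : ℝ} (hε : 0 < ε) (hε1 : ε ≤ 1 / 10) :
    ∀ᵐ ω ∂μ, ∃ᶠ n : ℕ in atTop, √2 * (1 - 8 * ε) * √(v n ! * logLog v n !) ≤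
        eventCount (restrictEvents (factorialBlock p n) fun k => E k n !) ω -
        ∫ ω', eventCount (restrictEvents (factorialBlock p n) fun k => E k n !) ω' ∂μ := by
  set G : ℕ → Set Ω := fun n => {ω | √2 * (1 - 8 * ε) * √(v n ! * logLog v n !) ≤
        eventCount (restrictEvents (factorialBlock p n) fun k => E k n !) ω -
        ∫ ω', eventCount (restrictEvents (factorialBlock p n) fun k => E k n !) ω' ∂μ} with hG
  have hGm : ∀ n, MeasurableSet[⨆ k ∈ factorialBlock p n,
      MeasurableSpace.generateFrom (Set.range (E k))] (G n) := fun n =>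
    (((measurable_eventCount_restrict (factorialBlock_finite hp n)
      fun k => measurableSet_generateFrom k _).sub_const _) measurableSet_Ici :)
  have hGm' : ∀ n, MeasurableSet (G n) := fun n =>
    (iSup₂_le fun k _ => h.generateFrom_le k : _ ≤ ‹MeasurableSpace Ω›) _ (hGm n)
  have hind : iIndepSet G μ := iIndepSet_of_disjoint_blocks h.generateFrom_le h.iIndep
    (fun n l hnl => factorialBlock_disjoint p hnl) hGm
  have hdiv : ∑' n, μ (G n) = ⊤ := by
    by_contra hcon
    have hs := ENNReal.summable_toReal hcon
    refine Real.not_summable_one_div_natCast (hs.of_norm_bounded_eventually_nat ?_)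
    filter_upwards [h.eventually_lower_bound_factorialBlock hp hv hR hα1 hc hvc hε hε1,
      h.eventually_one_div_le_exp hp hv hε hε1] with n h1 h2
    rw [Real.norm_of_nonneg (by positivity)]
    exact h2.trans h1
  have hone := measure_limsup_eq_one hGm' hind hdiv
  rw [← mem_ae_iff_prob_eq_one (MeasurableSet.measurableSet_limsup hGm')] at hone
  filter_upwards [hone] with ω hω
  exact mem_limsup_iff_frequently_mem.1 hω

theorem ae_frequently_ge (h : IsOccupancyFamily μ p m E)
    (hp : IsBoxDistribution p) (hv : IsVarianceScale μ E v α)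
    (hR : RegularlyVarying (boxCounting p) α) (hα1 : α < 1) (hc : 0 < c)
    (hvc : ∀ t, v t = c * boxCounting p t) {ε : ℝ} (hε : 0 < ε) :
    ∀ᵐ ω ∂μ, ∃ᶠ t in atTop, (√2 - ε) * √(v t * logLog v t) ≤ occDev μ E t ω := by
  -- Then `8 * √2 * η ≤ ε / 2`; the other half of `ε` covers the boxes outside the block.
  set η := min (1 / 10) (ε / 32) with hη
  have hη0 : 0 < η := lt_min (by norm_num) (by positivity)
  have hη1 : η ≤ 1 / 10 := min_le_left _ _
  have hη2 : η ≤ ε / 32 := min_le_right _ _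
  have hs2 : √(2 : ℝ) ≤ 2 := by rw [Real.sqrt_le_left] <;> norm_num
  have hsum := summable_exp_neg_logLog hv.mono hv.tendsto_atTop hv.regularlyVarying hv.index_pos
    (t := fun n => (n ! : ℝ)) one_lt_two (by
      filter_upwards [Nat.eventually_pow_lt_factorial_sub 2 0] with n hn
      exact_mod_cast hn.le) one_lt_two
  have hrest := ae_eventually_notMem_of_summable hsum
    (h.eventually_lower_tail_compl hp hv hR hα1 hc hvc (half_pos hε))
  filter_upwards [h.ae_frequently_factorialBlock hp hv hR hα1 hc hvc hη0 hη1, hrest,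
    h.ae_finite hp] with ω h1 h2 h3
  refine tendsto_factorial_cast.frequently ((h1.and_eventually h2).mono ?_)
  rintro n ⟨h4, h5⟩
  rw [not_le] at h5
  have h6 := eventCount_restrict_add (h3 n !) (factorialBlock p n)
  have h7 := h.occMean_restrict hp (factorialBlock p n) n !
  have h8 : 0 ≤ √(v n ! * logLog v n !) := Real.sqrt_nonneg _
  unfold occDev occCount
  rw [← h6, ← h7]
  have h9 : (√2 - ε) * √(v n ! * logLog v n !) ≤
      √2 * (1 - 8 * η) * √(v n ! * logLog v n !) - ε / 2 * √(v n ! * logLog v n !) := by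
    rw [← sub_mul]
    refine mul_le_mul_of_nonneg_right ?_ h8
    have : √2 * η ≤ 2 * (ε / 32) := by gcongr
    linarith
  linarith

end IsOccupancyFamily

/-! ### The law of the iterated logarithm -/

lemma tendsto_log_div_log {l : Filter ℝ} {f g : ℝ → ℝ} (hg : Tendsto g l atTop)
    (h : Tendsto (fun t => f t / g t) l (𝓝 1)) :
    Tendsto (fun t => Real.log (f t) / Real.log (g t)) l (𝓝 1) := by
  have hlg := Real.tendsto_log_atTop.comp hg
  have h1 : Tendsto (fun t => Real.log (f t / g t)) l (𝓝 0) := by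
    have := (Real.continuousAt_log one_ne_zero).tendsto.comp h
    rwa [Real.log_one] at this
  have h2 : Tendsto (fun t => Real.log (f t / g t) / Real.log (g t) + 1) l (𝓝 1) := by
    simpa using (h1.div_atTop hlg).add_const 1
  refine h2.congr' ?_
  filter_upwards [hg.eventually_gt_atTop 0, hlg.eventually_gt_atTop 0,
    h.eventually (lt_mem_nhds one_pos)] with t hg0 hlg0 hfg
  simp only [Function.comp] at hlg0
  have hf0 : 0 < f t := by
    have := mul_pos hfg hg0
    rwa [div_mul_cancel₀ _ hg0.ne'] at this
  rw [Real.log_div hf0.ne' hg0.ne']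
  field_simp
  ring

/-- The normalization of the law of the iterated logarithm only depends on the variance up to
asymptotic equivalence. -/
lemma tendsto_lil_normalization_div {V v : ℝ → ℝ} (hv : Tendsto v atTop atTop)
    (h : Tendsto (fun t => V t / v t) atTop (𝓝 1)) :
    Tendsto (fun t => √(v t * logLog v t) / √(V t * logLog V t)) atTop (𝓝 1) := by
  have h1 := tendsto_log_div_log (Real.tendsto_log_atTop.comp hv) (tendsto_log_div_log hv h)
  have h2 : Tendsto (fun t => √((V t / v t * (logLog V t / logLog v t))⁻¹)) atTop (𝓝 1) := by
    have h3 := ((h.mul h1).inv₀ (by norm_num)).sqrt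
    simp only [mul_one, inv_one, Real.sqrt_one] at h3
    exact h3
  refine h2.congr' ?_
  filter_upwards [hv.eventually_gt_atTop 0, (tendsto_logLog hv).eventually_gt_atTop 0] with t ht hlt
  rw [← Real.sqrt_div (by positivity)]
  congr 1
  rw [div_mul_div_comm, inv_div]

/-- Both the tolerance and the ratio `u / w` are handled with the same error `1 / (n + 1)`, which is
then sent to zero. -/
lemma limsup_eq_of_eventually_of_frequently {f u w : ℝ → ℝ} {a : ℝ} (ha : 0 < a)
    (hu : ∀ t, 0 ≤ u t) (hw : Tendsto (fun t => u t / w t) atTop (𝓝 1))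
    (hup : ∀ n : ℕ, ∀ᶠ t in atTop, f t ≤ (a + 1 / ((n : ℝ) + 1)) * u t)
    (hlo : ∀ n : ℕ, ∃ᶠ t in atTop, (a - 1 / ((n : ℝ) + 1)) * u t ≤ f t) :
    limsup (fun t => ((f t / w t : ℝ) : EReal)) atTop = (a : EReal) := by
  have hn := tendsto_one_div_add_atTop_nhds_zero_nat (𝕜 := ℝ)
  have hw0 : ∀ᶠ t in atTop, 0 < w t := by
    filter_upwards [hw.eventually (lt_mem_nhds one_pos)] with t ht
    rcases div_pos_iff.1 ht with h | h
    · exact h.2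
    · exact absurd h.1 (not_lt.2 (hu t))
  have hsmall : ∀ᶠ n : ℕ in atTop, 1 / ((n : ℝ) + 1) < min a 1 :=
    hn.eventually (gt_mem_nhds (by positivity))
  refine le_antisymm ?_ ?_
  · have hlim : Tendsto (fun n : ℕ => (((a + 1 / ((n : ℝ) + 1)) * (1 + 1 / ((n : ℝ) + 1)) : ℝ) :
        EReal)) atTop (𝓝 (a : EReal)) := by
      have := (hn.const_add a).mul (hn.const_add 1)
      simp only [add_zero, mul_one] at this
      exact (continuous_coe_real_ereal.tendsto _).comp this
    refine ge_of_tendsto' hlim fun n => ?_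
    have hn0 : 0 < 1 / ((n : ℝ) + 1) := by positivity
    refine limsup_le_of_le ?_ ?_
    · isBoundedDefault
    filter_upwards [hup n, hw.eventually (gt_mem_nhds (lt_add_of_pos_right 1 hn0)), hw0]
      with t h1 h2 h3
    rw [EReal.coe_le_coe_iff]
    calc f t / w t ≤ (a + 1 / ((n : ℝ) + 1)) * u t / w t := by gcongr
      _ = (a + 1 / ((n : ℝ) + 1)) * (u t / w t) := mul_div_assoc _ _ _
      _ ≤ _ := by gcongr
  · have hlim : Tendsto (fun n : ℕ => (((a - 1 / ((n : ℝ) + 1)) * (1 - 1 / ((n : ℝ) + 1)) : ℝ) :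
        EReal)) atTop (𝓝 (a : EReal)) := by
      have := (hn.const_sub a).mul (hn.const_sub 1)
      simp only [sub_zero, mul_one] at this
      exact (continuous_coe_real_ereal.tendsto _).comp this
    refine le_of_tendsto hlim ?_
    filter_upwards [hsmall] with n hna
    have hn0 : 0 < 1 / ((n : ℝ) + 1) := by positivity
    have hna0 : 0 ≤ a - 1 / ((n : ℝ) + 1) := by linarith [min_le_left a 1]
    refine le_limsup_of_frequently_le ?_ (by isBoundedDefault)
    refine ((hlo n).and_eventually
      ((hw.eventually (lt_mem_nhds (sub_lt_self 1 hn0))).and hw0)).mono ?_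
    rintro t ⟨h1, h2, h3⟩
    rw [EReal.coe_le_coe_iff]
    calc (a - 1 / ((n : ℝ) + 1)) * (1 - 1 / ((n : ℝ) + 1))
        ≤ (a - 1 / ((n : ℝ) + 1)) * (u t / w t) := by gcongr
      _ = (a - 1 / ((n : ℝ) + 1)) * u t / w t := (mul_div_assoc _ _ _).symm
      _ ≤ f t / w t := by gcongr

lemma tendsto_boxCounting_atTop {p : ℕ → ℝ} (hp : IsBoxDistribution p) :
    Tendsto (boxCounting p) atTop atTop := by
  refine tendsto_atTop_atTop_of_monotone (boxCounting_mono hp) fun b => ?_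
  obtain ⟨N, hN⟩ := exists_nat_ge b
  obtain ⟨F, hF, hcard⟩ := hp.infinite_support.exists_subset_card_eq N
  obtain ⟨t, ht⟩ := (F.image fun k => 1 / p k).bddAbove
  refine ⟨t, hN.trans ?_⟩
  rw [← hcard, boxCounting, ← Set.ncard_coe_finset F]
  have hsub : (F : Set ℕ) ⊆ {k : ℕ | 0 < p k ∧ 1 / p k ≤ t} := fun k hk =>
    ⟨hF hk, ht (by simpa using ⟨k, hk, rfl⟩)⟩
  exact_mod_cast Set.ncard_le_ncard hsub (finite_boxes hp t)

namespace IsOccupancyFamily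

variable {Ω : Type*} [MeasurableSpace Ω] {μ : Measure Ω} [IsProbabilityMeasure μ] {p : ℕ → ℝ}
  {m : ℕ} {E : ℕ → ℝ → Set Ω} {α : ℝ}

lemma tendsto_occMean_div (h : IsOccupancyFamily μ p m E) (hp : IsBoxDistribution p)
    (hR : RegularlyVarying (boxCounting p) α) (hα0 : 0 < α) (hα1 : α < 1) :
    Tendsto (fun t => occMean μ E t / boxCounting p t) atTop
      (𝓝 (Real.Gamma (((m + 1 : ℕ) : ℝ) - α) / (m ! : ℝ))) := by
  refine (tendsto_tsum_poissonTail_div hp hR hα0 hα1 m).congr' ?_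
  filter_upwards [eventually_ge_atTop 0] with t ht
  rw [h.occMean_eq_tsum hp ht]

lemma tendsto_variance_div (h : IsOccupancyFamily μ p m E) (hp : IsBoxDistribution p)
    (hR : RegularlyVarying (boxCounting p) α) (hα0 : 0 < α) (hα1 : α < 1) :
    Tendsto (fun t => Var[occCount E t; μ] / boxCounting p t) atTop
      (𝓝 (varianceConst α (m + 1))) := by
  refine (tendsto_tsum_poissonTail_var_div hp hR hα0 hα1 m).congr' ?_
  filter_upwards [eventually_ge_atTop 0] with t ht
  rw [h.variance_eq_tsum hp ht]

/-- The scale is a multiple of `ρ`, whose monotonicity is evident, unlike that of the variance. -/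
lemma isVarianceScale (h : IsOccupancyFamily μ p m E) (hp : IsBoxDistribution p)
    (hR : RegularlyVarying (boxCounting p) α) (hα0 : 0 < α) (hα1 : α < 1) :
    IsVarianceScale μ E (fun t => varianceConst α (m + 1) * boxCounting p t) α := by
  have hc := varianceConst_pos hp hR hα0 hα1 m
  have hΓ : 0 < Real.Gamma (((m + 1 : ℕ) : ℝ) - α) / (m ! : ℝ) := by
    refine div_pos (Real.Gamma_pos_of_pos ?_) (by positivity)
    push_cast
    linarith [m.cast_nonneg (α := ℝ)]
  refine ⟨fun s t hst => mul_le_mul_of_nonneg_left (boxCounting_mono hp hst) hc.le,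
    (tendsto_boxCounting_atTop hp).const_mul_atTop hc, fun b hb => ?_, hα0, ?_, ?_⟩
  · simpa only [mul_div_mul_left _ _ hc.ne'] using hR b hb
  · have h1 := (h.tendsto_variance_div hp hR hα0 hα1).div_const (varianceConst α (m + 1))
    rw [div_self hc.ne'] at h1
    refine h1.congr fun t => ?_
    rw [div_div, mul_comm]
  · set Γ := Real.Gamma (((m + 1 : ℕ) : ℝ) - α) / (m ! : ℝ) with hΓdef
    refine ⟨(Γ + 1) / varianceConst α (m + 1), by positivity, ?_⟩
    filter_upwards [(h.tendsto_occMean_div hp hR hα0 hα1).eventually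
      (gt_mem_nhds (lt_add_one Γ)), eventually_boxCounting_pos hp] with t h1 h2
    rw [div_lt_iff₀ h2] at h1
    rw [← mul_assoc, div_mul_cancel₀ _ hc.ne']
    exact h1.le

theorem ae_limsup_eq (h : IsOccupancyFamily μ p m E) (hp : IsBoxDistribution p)
    (hR : RegularlyVarying (boxCounting p) α) (hα0 : 0 < α) (hα1 : α < 1) :
    ∀ᵐ ω ∂μ, limsup (fun t : ℝ => ((occDev μ E t ω /
      √(Var[occCount E t; μ] * Real.log (Real.log Var[occCount E t; μ])) : ℝ) : EReal)) atTop =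
        ((√2 : ℝ) : EReal) := by
  have hv := h.isVarianceScale hp hR hα0 hα1
  have hc := varianceConst_pos hp hR hα0 hα1 m
  have hup : ∀ᵐ ω ∂μ, ∀ n : ℕ, ∀ᶠ t in atTop, _ := ae_all_iff.2 fun n : ℕ =>
    h.ae_eventually_le hp hv (ε := 1 / ((n : ℝ) + 1)) (by positivity)
  have hlo : ∀ᵐ ω ∂μ, ∀ n : ℕ, ∃ᶠ t in atTop, _ := ae_all_iff.2 fun n : ℕ =>
    h.ae_frequently_ge hp hv hR hα1 hc (fun t => rfl) (ε := 1 / ((n : ℝ) + 1)) (by positivity)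
  filter_upwards [hup, hlo] with ω h1 h2
  exact limsup_eq_of_eventually_of_frequently (Real.sqrt_pos.2 two_pos)
    (fun t => Real.sqrt_nonneg _)
    (tendsto_lil_normalization_div hv.tendsto_atTop hv.variance_div) h1 h2

end IsOccupancyFamily

lemma isOccupancyFamily_fullEvent {Ω : Type*} [MeasurableSpace Ω] {μ : Measure Ω}
    [IsProbabilityMeasure μ] {p : ℕ → ℝ} (hp : IsBoxDistribution p) {ξ : ℕ → Ω → ℝ}
    {B : ℕ → Ω → ℕ} (hS : IsPoissonizedScheme μ p ξ B) (m : ℕ) :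
    IsOccupancyFamily μ p m (fullEvent ξ B (m + 1)) where
  measurableSet k t := measurableSet_fullEvent hS (m + 1) k t
  mono k _ _ hst := fullEvent_mono (m + 1) k hst
  iIndep := iIndep_fullEvent hS hp.nonneg (m + 1)
  measureReal k t ht := by rw [measureReal_fullEvent hS hp.nonneg, max_eq_left ht]

lemma isEquivalent_of_tendsto_div {f g h : ℝ → ℝ} {c : ℝ} (hc : 0 < c)
    (hg : ∀ᶠ t in atTop, 0 < g t) (hfg : Tendsto (fun t => f t / g t) atTop (𝓝 c))
    (hgh : g ~[atTop] h) : f ~[atTop] fun t => c * h t := by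
  have h1 : f ~[atTop] fun t => c * g t := by
    refine (isEquivalent_iff_tendsto_one (hg.mono fun t ht => (mul_pos hc ht).ne')).2 ?_
    have h2 := hfg.div_const c
    rw [div_self hc.ne'] at h2
    refine h2.congr fun t => ?_
    simp only [Pi.div_apply]
    rw [div_div, mul_comm]
  exact h1.trans (IsEquivalent.refl.mul hgh)

end

theorem theorem3p2 {Ω : Type*} [MeasurableSpace Ω] (μ : Measure Ω) [IsProbabilityMeasure μ]
    (p : ℕ → ℝ) (hp : IsBoxDistribution p)
    (ξ : ℕ → Ω → ℝ) (B : ℕ → Ω → ℕ) (hS : IsPoissonizedScheme μ p ξ B)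
    (α : ℝ) (hα0 : 0 < α) (hα1 : α < 1)
    (L : ℝ → ℝ) (hL : SlowlyVarying L)
    (hρ : boxCounting p ~[atTop] fun t : ℝ => t ^ α * L t)
    (j : ℕ) (hj : 1 ≤ j) :
    (∀ᵐ ω ∂μ, ∀ t : ℝ, (boxesAtLeast ξ B j t ω).Finite) ∧
    (∀ t : ℝ, MemLp (occupancy ξ B j t) 2 μ) ∧
    (∀ᵐ ω ∂μ,
      limsup (fun t : ℝ =>
          (((occupancy ξ B j t ω - ∫ ω', occupancy ξ B j t ω' ∂μ) /
            Real.sqrt (Var[occupancy ξ B j t; μ] *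
              Real.log (Real.log (Var[occupancy ξ B j t; μ]))) : ℝ) : EReal)) atTop
        = ((Real.sqrt 2 : ℝ) : EReal)) ∧
    ((fun t : ℝ => ∫ ω, occupancy ξ B j t ω ∂μ) ~[atTop]
      fun t : ℝ => Real.Gamma ((j : ℝ) - α) / ((j - 1)! : ℝ) * (t ^ α * L t)) ∧
    ((fun t : ℝ => Var[occupancy ξ B j t; μ]) ~[atTop]
      fun t : ℝ => varianceConst α j * (t ^ α * L t)) ∧
    0 < varianceConst α j := by
  obtain ⟨m, rfl⟩ : ∃ m, j = m + 1 := ⟨j - 1, by omega⟩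
  have hR : RegularlyVarying (boxCounting p) α := hL.regularlyVarying hρ
  have h := isOccupancyFamily_fullEvent hp hS m
  have hc := varianceConst_pos hp hR hα0 hα1 m
  have hΓ : 0 < Real.Gamma (((m + 1 : ℕ) : ℝ) - α) / (m ! : ℝ) := by
    refine div_pos (Real.Gamma_pos_of_pos ?_) (by positivity)
    push_cast
    linarith [m.cast_nonneg (α := ℝ)]
  -- `occupancy ξ B (m + 1)` and `occCount (fullEvent ξ B (m + 1))` agree by definition, so the
  -- results for the family transfer as they stand.
  exact ⟨h.ae_finite hp, h.memLp hp, h.ae_limsup_eq hp hR hα0 hα1,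
    isEquivalent_of_tendsto_div hΓ (eventually_boxCounting_pos hp)
      (h.tendsto_occMean_div hp hR hα0 hα1) hρ,
    isEquivalent_of_tendsto_div hc (eventually_boxCounting_pos hp)
      (h.tendsto_variance_div hp hR hα0 hα1) hρ, hc⟩
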